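/- Let $S$ be a discrete valuation ring with uniformising parameter $t$ and residue field $k$, let $G$ be a finite group, let $n\ge 1$, and put $R_n=S/t^n$ and $A_n=R_nG$. Let $\mathcal D_n$ be the relative stable category of $A_n$: the stable category of the finitely generated $A_n$-modules with the exact structure given by the $R_n$-split short exact sequences, i.e. modules modulo the maps that factor through direct summands of modules $A_n\otimes_{R_n}L$ with $L$ a finitely generated $R_n$-module. It is triangulated, and it has the tensor product $\otimes_{R_n}$ with diagonal $G$-action. Let $\operatorname{stmod}kG$ be the usual stable category of finitely generated $kG$-modules modulo projectives, mapped to $\mathcal D_n$ by restriction of scalars along $A_n\to kG$; let $\mathcal D_1\subseteq\mathcal D_n$ be the essential image of this functor. Let $\Omega_n$ be the functor on $\mathcal D_n$ induced by the syzygy (the kernel of a surjection from a finitely generated projective $A_n$-module) in the abelian category of finitely generated $A_n$-modules, let $W_n=\Omega_n^{-1}k$ be the cokernel of $k\to A_n$, $1\mapsto t^{n-1}\sum_{g\in G}g$, and let $\mathcal K_n$ be the kernel of base change $-\otimes_{R_n}R_{n-1}$ on $\mathcal D_n$. Write $\operatorname{thick}^\otimes(X)$ for the smallest thick tensor ideal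 of $\mathcal D_n$ that contains $X$. Then $\Omega_n$ induces an equivalence of triangulated categories $$\operatorname{thick}^\otimes(W_n)\;\cong\;\operatorname{thick}^\otimes(k)=\operatorname{stmod}kG,$$ where the last equality means that $\operatorname{stmod}kG\to\mathcal D_n$ is an equivalence of triangulated categories onto $\operatorname{thick}^\otimes(k)=\mathcal D_1$. Moreover $\operatorname{thick}^\otimes(W_n)=\mathcal K_n$, and $\Omega_n\mathcal K_n=\mathcal D_1$ up to isomorphism of objects. The equivalence is not monoidal in general: for every $n\ge 1$ there are $S$, $t$, $G$ as above and $X,Y\in\operatorname{thick}^\otimes(W_n)$ such that $\Omega_n(X\otimes Y)$ and $\Omega_nX\otimes\Omega_nY$ are not isomorphic in $\mathcal D_n$. -/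

import Mathlib

open CategoryTheory

universe u

namespace RelStab

noncomputable section

/-! ### Finitely generated `RG`-modules -/

section Modules

variable (R G : Type u) [CommRing R] [Group G]

/-- The category of finitely generated `RG`-modules, as representations of `G` on `R`-modules.
Since `G` is finite in all uses, finite generation over `RG` and over `R` agree. -/
abbrev FGRep : Type (u + 1) :=
  ObjectProperty.FullSubcategory (fun M : Rep.{u} R G => Module.Finite R M.V)

variable {R G}

/-- The object attached to a representation on a finitely generated `R`-module. -/
abbrev FGRep.of {V : Type u} [AddCommGroup V] [Module R V] [h : Module.Finite R V]
    (ρ : Representation R G V) : FGRep R G :=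
  ⟨Rep.of ρ, h⟩

instance (M : FGRep R G) : Module.Finite R M.obj.V := M.property

/-- The underlying `R`-linear map of a morphism. -/
def lin {M N : FGRep R G} (f : M ⟶ N) : M.obj.V →ₗ[R] N.obj.V := f.hom.hom.toLinearMap

/-- A morphism from a `G`-equivariant `R`-linear map. -/
def mkHom {M N : FGRep R G} (f : M.obj.V →ₗ[R] N.obj.V)
    (hf : ∀ g x, f (M.obj.ρ g x) = N.obj.ρ g (f x)) : M ⟶ N :=
  ObjectProperty.homMk (Rep.ofHom ⟨f, fun g => LinearMap.ext (hf g)⟩)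

@[simp] theorem lin_mkHom {M N : FGRep R G} (f : M.obj.V →ₗ[R] N.obj.V)
    (hf : ∀ g x, f (M.obj.ρ g x) = N.obj.ρ g (f x)) : lin (mkHom f hf) = f := rfl

@[simp] theorem lin_comp {M N K : FGRep R G} (f : M ⟶ N) (g : N ⟶ K) :
    lin (f ≫ g) = lin g ∘ₗ lin f := rfl

@[simp] theorem lin_id (M : FGRep R G) : lin (𝟙 M) = LinearMap.id := rfl

@[simp] theorem lin_sub {M N : FGRep R G} (f g : M ⟶ N) : lin (f - g) = lin f - lin g := rfl

@[simp] theorem lin_add {M N : FGRep R G} (f g : M ⟶ N) : lin (f + g) = lin f + lin g := rfl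

theorem lin_equivariant {M N : FGRep R G} (f : M ⟶ N) (g : G) (x : M.obj.V) :
    lin f (M.obj.ρ g x) = N.obj.ρ g (lin f x) :=
  Rep.hom_comm_apply f.hom g x

theorem lin_injective {M N : FGRep R G} {f g : M ⟶ N} (h : lin f = lin g) : f = g := by
  apply ObjectProperty.hom_ext
  apply Rep.hom_ext
  exact Representation.IntertwiningMap.ext h

@[simp] theorem rho_inv_self (M : FGRep R G) (g : G) (x : M.obj.V) :
    M.obj.ρ g⁻¹ (M.obj.ρ g x) = x := by
  rw [← Module.End.mul_apply, ← map_mul]; simp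

@[simp] theorem rho_self_inv (M : FGRep R G) (g : G) (x : M.obj.V) :
    M.obj.ρ g (M.obj.ρ g⁻¹ x) = x := by
  rw [← Module.End.mul_apply, ← map_mul]; simp

theorem rho_mul (M : FGRep R G) (g h : G) (x : M.obj.V) :
    M.obj.ρ (g * h) x = M.obj.ρ g (M.obj.ρ h x) := by
  rw [map_mul]; rfl

variable [Fintype G]

set_option linter.unusedSectionVars false

variable (R G) in
/-- The induced module `RG ⊗_R L`. As `G` is finite, the elements `∑ g, g ⊗ a g` of `RG ⊗_R L`
are the functions `a : G → L`, and `h ∈ G` acts by `(h a) g = a (h⁻¹ g)`. -/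
abbrev ind (L : Type u) [AddCommGroup L] [Module R L] [Module.Finite R L] : FGRep R G :=
  FGRep.of (V := G → L)
    { toFun := fun h => LinearMap.funLeft R L (fun g => h⁻¹ * g)
      map_one' := by ext a g; simp [LinearMap.funLeft]
      map_mul' := by intro h h'; ext a g; simp [LinearMap.funLeft, mul_assoc] }

theorem ind_rho (L : Type u) [AddCommGroup L] [Module R L] [Module.Finite R L]
    (h : G) (a : G → L) (g : G) : (ind R G L).obj.ρ h a g = a (h⁻¹ * g) := rfl

/-- The weakly projective modules: direct summands of the modules induced from finitely generated
`R`-modules. -/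
def weaklyProjective (R G : Type u) [CommRing R] [Group G] [Fintype G] :
    ObjectProperty (FGRep R G) := fun M =>
  ∃ (L : Type u) (_ : AddCommGroup L) (_ : Module R L) (_ : Module.Finite R L),
    Nonempty (Retract M (ind R G L))

/-- The projective objects of the category of finitely generated `RG`-modules. -/
def projectiveObj (R G : Type u) [CommRing R] [Group G] :
    ObjectProperty (FGRep R G) := fun M => Projective M

/-- The embedding `M → RG ⊗_R M`, `m ↦ ∑ g, g ⊗ g⁻¹ m`. -/
def unit (M : FGRep R G) : M ⟶ ind R G M.obj.V :=
  mkHom (LinearMap.pi fun g => M.obj.ρ g⁻¹) (by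
    intro h x
    funext g
    change M.obj.ρ g⁻¹ (M.obj.ρ h x) = M.obj.ρ (h⁻¹ * g)⁻¹ x
    rw [← rho_mul]; simp)

theorem unit_apply (M : FGRep R G) (m : M.obj.V) (g : G) :
    (lin (unit M) m : G → M.obj.V) g = M.obj.ρ g⁻¹ m := rfl

/-- For an `R`-linear map `s : L → M`, the induced map `RG ⊗_R L → M`, `g ⊗ l ↦ g (s l)`. -/
def indLift {L : Type u} [AddCommGroup L] [Module R L] [Module.Finite R L] {M : FGRep R G}
    (s : L →ₗ[R] M.obj.V) : ind R G L ⟶ M :=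
  mkHom (∑ g : G, M.obj.ρ g ∘ₗ s ∘ₗ LinearMap.proj g) (by
    intro h a
    change (∑ g : G, M.obj.ρ g ∘ₗ s ∘ₗ LinearMap.proj g) (fun g => (a : G → L) (h⁻¹ * g)) = _
    simp only [LinearMap.sum_apply, LinearMap.comp_apply, LinearMap.proj_apply, map_sum]
    refine (Fintype.sum_equiv (Equiv.mulLeft h) _ _ fun g => ?_).symm
    simp)

theorem indLift_apply {L : Type u} [AddCommGroup L] [Module R L] [Module.Finite R L]
    {M : FGRep R G} (s : L →ₗ[R] M.obj.V) (a : G → L) :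
    lin (indLift (G := G) s) a = ∑ g : G, M.obj.ρ g (s (a g)) := by
  change (∑ g : G, M.obj.ρ g ∘ₗ s ∘ₗ LinearMap.proj g) a = _
  simp only [LinearMap.sum_apply, LinearMap.comp_apply, LinearMap.proj_apply]

/-- The trace `∑ g, g θ g⁻¹` of an `R`-linear map between `RG`-modules. -/
def tr {M N : FGRep R G} (θ : M.obj.V →ₗ[R] N.obj.V) : M.obj.V →ₗ[R] N.obj.V :=
  ∑ g : G, N.obj.ρ g ∘ₗ θ ∘ₗ M.obj.ρ g⁻¹

theorem tr_apply {M N : FGRep R G} (θ : M.obj.V →ₗ[R] N.obj.V) (x : M.obj.V) :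
    tr (G := G) θ x = ∑ g : G, N.obj.ρ g (θ (M.obj.ρ g⁻¹ x)) := by
  simp [tr]

theorem tr_equivariant {M N : FGRep R G} (θ : M.obj.V →ₗ[R] N.obj.V) (h : G) (x : M.obj.V) :
    tr θ (M.obj.ρ h x) = N.obj.ρ h (tr θ x) := by
  rw [tr_apply, tr_apply, map_sum]
  refine (Fintype.sum_equiv (Equiv.mulLeft h) _ _ fun g => ?_).symm
  simp

theorem tr_add {M N : FGRep R G} (θ θ' : M.obj.V →ₗ[R] N.obj.V) :
    tr (M := M) (N := N) (θ + θ') = tr θ + tr θ' := by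
  ext x; simp [tr_apply, Finset.sum_add_distrib]

theorem comp_tr {M N K : FGRep R G} (θ : M.obj.V →ₗ[R] N.obj.V) (f : N ⟶ K) :
    lin f ∘ₗ tr θ = tr (M := M) (N := K) (lin f ∘ₗ θ) := by
  ext x; simp [tr_apply, map_sum, lin_equivariant]

theorem tr_comp {M N K : FGRep R G} (θ : N.obj.V →ₗ[R] K.obj.V) (f : M ⟶ N) :
    tr θ ∘ₗ lin f = tr (M := M) (N := K) (θ ∘ₗ lin f) := by
  ext x; simp [tr_apply, lin_equivariant]

/-- A map out of an induced module is a trace. -/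
theorem exists_tr_of_ind {L : Type u} [AddCommGroup L] [Module R L] [Module.Finite R L]
    {N : FGRep R G} (b : ind R G L ⟶ N) :
    ∃ θ : (ind R G L).obj.V →ₗ[R] N.obj.V, lin b = tr θ := by
  classical
  refine ⟨lin b ∘ₗ LinearMap.single R (fun _ : G => L) 1 ∘ₗ LinearMap.proj 1, ?_⟩
  refine LinearMap.ext fun a => ?_
  rw [tr_apply]
  have key : ∀ g : G, N.obj.ρ g ((lin b ∘ₗ LinearMap.single R (fun _ : G => L) 1 ∘ₗ
      LinearMap.proj 1) ((ind R G L).obj.ρ g⁻¹ a)) =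
      lin b (Pi.single g ((a : G → L) g) : G → L) := by
    intro g
    simp only [LinearMap.comp_apply]
    rw [← lin_equivariant]
    congr 1
    funext x
    rw [ind_rho]
    change (Pi.single (1 : G) ((ind R G L).obj.ρ g⁻¹ a (1 : G)) : G → L) (g⁻¹ * x) = _
    rw [ind_rho]
    by_cases h : x = g
    · subst h; simp
    · have h' : g⁻¹ * x ≠ 1 := fun h' => h (by rw [inv_mul_eq_one] at h'; exact h'.symm)
      simp [Pi.single_eq_of_ne h, Pi.single_eq_of_ne h']
  rw [Finset.sum_congr rfl fun g _ => key g, ← map_sum]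
  congr 1
  exact (Finset.univ_sum_single (a : G → L)).symm

/-- A trace factors through an induced module. -/
theorem tr_factors {M N : FGRep R G} (f : M ⟶ N) (θ : M.obj.V →ₗ[R] N.obj.V)
    (h : lin f = tr θ) : f = unit M ≫ indLift (G := G) θ := by
  apply lin_injective
  rw [h]
  refine LinearMap.ext fun x => ?_
  rw [lin_comp, LinearMap.comp_apply, tr_apply]
  exact (indLift_apply θ _).symm

/-! ### Stable categories -/

/-- Two maps are identified if their difference factors through an object of `P`. -/
def facRel (P : ObjectProperty (FGRep R G)) : HomRel (FGRep R G) := fun X Y f g =>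
  ∃ (V : FGRep R G) (_ : P V) (a : X ⟶ V) (b : V ⟶ Y), f - g = a ≫ b

/-- Technical condition: the maps that factor through `P` are the traces of `R`-linear maps.
It holds for the weakly projective modules, and for the projective modules if `R` is a field. -/
class TraceClass (P : ObjectProperty (FGRep R G)) : Prop where
  exists_tr : ∀ {V : FGRep R G}, P V → ∃ θ : V.obj.V →ₗ[R] V.obj.V, LinearMap.id = tr θ
  ind_mem : ∀ (M : FGRep R G), P (ind R G M.obj.V)

theorem facRel_iff (P : ObjectProperty (FGRep R G)) [TraceClass P] {X Y : FGRep R G}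
    (f g : X ⟶ Y) : facRel P f g ↔ ∃ θ : X.obj.V →ₗ[R] Y.obj.V, lin f - lin g = tr θ := by
  constructor
  · rintro ⟨V, hV, a, b, h⟩
    obtain ⟨θ, hθ⟩ := TraceClass.exists_tr hV
    refine ⟨lin b ∘ₗ θ ∘ₗ lin a, ?_⟩
    rw [← lin_sub, h, lin_comp, ← comp_tr, ← tr_comp, ← hθ, LinearMap.id_comp]
  · rintro ⟨θ, hθ⟩
    exact ⟨_, TraceClass.ind_mem X, unit X, indLift θ, tr_factors _ θ hθ⟩

theorem weaklyProjective_exists_tr {V : FGRep R G} (hV : weaklyProjective R G V) :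
    ∃ θ : V.obj.V →ₗ[R] V.obj.V, LinearMap.id = tr θ := by
  obtain ⟨L, _, _, _, ⟨r⟩⟩ := hV
  obtain ⟨θ, hθ⟩ := exists_tr_of_ind r.r
  refine ⟨θ ∘ₗ lin r.i, ?_⟩
  rw [← tr_comp, ← hθ, ← lin_comp, r.retract, lin_id]

instance : TraceClass (weaklyProjective R G) where
  exists_tr := weaklyProjective_exists_tr
  ind_mem M := ⟨M.obj.V, inferInstance, inferInstance, inferInstance, ⟨Retract.refl _⟩⟩

theorem surjective_of_epi {M N : FGRep R G} (f : M ⟶ N) [Epi f] :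
    Function.Surjective (lin f) := by
  have hle : ∀ g, LinearMap.range (lin f) ≤ (LinearMap.range (lin f)).comap (N.obj.ρ g) := by
    rintro g _ ⟨x, rfl⟩
    exact ⟨M.obj.ρ g x, lin_equivariant f g x⟩
  let Q : FGRep R G := FGRep.of (N.obj.ρ.quotient (LinearMap.range (lin f)) hle)
  let q : N ⟶ Q := mkHom (LinearMap.range (lin f)).mkQ (fun _ _ => rfl)
  have h : f ≫ q = f ≫ 0 := by
    apply lin_injective
    refine LinearMap.ext fun x => ?_
    exact (Submodule.Quotient.mk_eq_zero _).2 ⟨x, rfl⟩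
  have h0 : q = 0 := (cancel_epi f).1 h
  intro y
  have : lin q y = 0 := by rw [h0]; rfl
  exact (Submodule.Quotient.mk_eq_zero _).1 this

theorem epi_of_surjective {M N : FGRep R G} (f : M ⟶ N)
    (h : Function.Surjective (lin f)) : Epi f where
  left_cancellation a b hab := by
    apply lin_injective
    refine LinearMap.ext fun y => ?_
    obtain ⟨x, rfl⟩ := h y
    exact LinearMap.congr_fun (congrArg lin hab) x

instance {k : Type u} [Field k] : TraceClass (projectiveObj k G) where
  exists_tr {V} hV := by
    classical
    have hs : Function.Surjective
        (lin (indLift (G := G) (M := V) (LinearMap.id : V.obj.V →ₗ[k] V.obj.V))) := by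
      intro x
      refine ⟨(Pi.single 1 x : G → V.obj.V), ?_⟩
      rw [indLift_apply, Finset.sum_eq_single 1]
      · simp
      · intro g _ hg; simp [Pi.single_eq_of_ne hg]
      · simp
    have := epi_of_surjective _ hs
    have : Projective V := hV
    exact weaklyProjective_exists_tr ⟨V.obj.V, inferInstance, inferInstance, inferInstance,
      ⟨{ i := Projective.factorThru (𝟙 V) (indLift LinearMap.id), r := indLift LinearMap.id
         retract := Projective.factorThru_comp _ _ }⟩⟩
  ind_mem M := by
    constructor
    intro E X f e he
    classical
    obtain ⟨s, hs⟩ := (lin e).exists_rightInverse_of_surjective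
      (LinearMap.range_eq_top.2 (surjective_of_epi e))
    obtain ⟨θ, hθ⟩ := exists_tr_of_ind f
    refine ⟨mkHom (tr (M := ind k G M.obj.V) (N := E) (s ∘ₗ θ)) (tr_equivariant _), ?_⟩
    apply lin_injective
    rw [lin_comp, lin_mkHom, comp_tr, ← LinearMap.comp_assoc, hs, LinearMap.id_comp, hθ]

instance (P : ObjectProperty (FGRep R G)) [TraceClass P] : Congruence (facRel P) where
  comp_left f g g' h := by
    rw [facRel_iff] at *
    obtain ⟨θ, h⟩ := h
    refine ⟨θ ∘ₗ lin f, ?_⟩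
    rw [← tr_comp, ← h]; rfl
  comp_right g h := by
    rw [facRel_iff] at *
    obtain ⟨θ, h⟩ := h
    refine ⟨lin g ∘ₗ θ, ?_⟩
    rw [← comp_tr, ← h, LinearMap.comp_sub]; rfl
  equivalence :=
    { refl := fun f => by
        rw [facRel_iff]
        exact ⟨0, by ext x; simp [tr_apply]⟩
      symm := fun {f g} h => by
        rw [facRel_iff] at *
        obtain ⟨θ, h⟩ := h
        refine ⟨-θ, ?_⟩
        have : tr (-θ) = - tr θ := by ext x; simp [tr_apply]
        rw [this, ← h, neg_sub]
      trans := fun {f g e} h h' => by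
        rw [facRel_iff] at *
        obtain ⟨θ, h⟩ := h
        obtain ⟨θ', h'⟩ := h'
        refine ⟨θ + θ', ?_⟩
        rw [tr_add, ← h, ← h', sub_add_sub_cancel] }

/-- The stable category of finitely generated `RG`-modules modulo the objects of `P`. -/
abbrev Stable (P : ObjectProperty (FGRep R G)) : Type (u + 1) := Quotient (facRel P)

instance (P : ObjectProperty (FGRep R G)) [TraceClass P] : Preadditive (Stable P) :=
  Quotient.preadditive _ (by
    intro X Y f₁ f₂ g₁ g₂ h h'
    rw [facRel_iff] at *
    obtain ⟨θ, h⟩ := h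
    obtain ⟨θ', h'⟩ := h'
    refine ⟨θ + θ', ?_⟩
    rw [tr_add, ← h, ← h', lin_add, lin_add]
    abel)

/-- The passage from modules to the stable category. -/
abbrev toStable (P : ObjectProperty (FGRep R G)) : FGRep R G ⥤ Stable P :=
  Quotient.functor (facRel P)

/-! ### Suspension and triangles -/

theorem unit_natural {M N : FGRep R G} (f : M ⟶ N) (x : M.obj.V) :
    (fun g => lin f ((lin (unit M) x : G → M.obj.V) g)) = (lin (unit N) (lin f x) : G → N.obj.V) := by
  funext g
  rw [unit_apply, unit_apply, lin_equivariant]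

/-- The suspension of a module: the cokernel of `M → RG ⊗_R M`. -/
def suspObj (M : FGRep R G) : FGRep R G :=
  FGRep.of ((ind R G M.obj.V).obj.ρ.quotient (LinearMap.range (lin (unit M))) (by
    rintro g _ ⟨x, rfl⟩
    exact ⟨M.obj.ρ g x, lin_equivariant (unit M) g x⟩))

/-- The projection `RG ⊗_R M → ΣM`. -/
def suspProj (M : FGRep R G) : ind R G M.obj.V ⟶ suspObj M :=
  mkHom (LinearMap.range (lin (unit M))).mkQ (fun _ _ => rfl)

/-- An `R`-linear map `θ : M → N` induces `g ⊗ m ↦ g ⊗ g⁻¹ (θ (g m))` from `RG ⊗_R M` to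
`RG ⊗_R N`; this is `g ⊗ m ↦ g ⊗ θ m` if `θ` is equivariant. -/
def indTwist {M N : FGRep R G} (θ : M.obj.V →ₗ[R] N.obj.V) :
    (G → M.obj.V) →ₗ[R] (G → N.obj.V) :=
  LinearMap.pi fun g => N.obj.ρ g⁻¹ ∘ₗ θ ∘ₗ M.obj.ρ g ∘ₗ LinearMap.proj g

theorem indTwist_apply {M N : FGRep R G} (θ : M.obj.V →ₗ[R] N.obj.V) (a : G → M.obj.V) (g : G) :
    indTwist θ a g = N.obj.ρ g⁻¹ (θ (M.obj.ρ g (a g))) := rfl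

theorem indTwist_unit {M N : FGRep R G} (θ : M.obj.V →ₗ[R] N.obj.V) (x : M.obj.V) :
    indTwist θ (lin (unit M) x) = lin (unit N) (θ x) := by
  funext g
  rw [indTwist_apply, unit_apply, unit_apply, rho_self_inv]

/-- The map `ΣM → ΣN` induced by an `R`-linear map. -/
def suspLin {M N : FGRep R G} (θ : M.obj.V →ₗ[R] N.obj.V) :
    (suspObj M).obj.V →ₗ[R] (suspObj N).obj.V :=
  Submodule.mapQ (LinearMap.range (lin (unit M))) (LinearMap.range (lin (unit N)))
    (indTwist θ) (by
      rintro _ ⟨x, rfl⟩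
      exact ⟨θ x, (indTwist_unit θ x).symm⟩)

theorem suspLin_mk {M N : FGRep R G} (θ : M.obj.V →ₗ[R] N.obj.V) (a : G → M.obj.V) :
    suspLin θ (lin (suspProj M) a) = lin (suspProj N) (indTwist θ a) := rfl

theorem suspProj_surjective (M : FGRep R G) : Function.Surjective (lin (suspProj M)) :=
  Submodule.mkQ_surjective _

theorem indTwist_lin {M N : FGRep R G} (f : M ⟶ N) (a : G → M.obj.V) :
    indTwist (lin f) a = fun g => lin f (a g) := by
  funext g
  rw [indTwist_apply, lin_equivariant, rho_inv_self]

/-- The suspension of a morphism of modules, induced by `g ⊗ m ↦ g ⊗ f m`. -/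
def suspMap {M N : FGRep R G} (f : M ⟶ N) : suspObj M ⟶ suspObj N :=
  mkHom (suspLin (lin f)) (by
    intro h x
    obtain ⟨a, rfl⟩ := suspProj_surjective M x
    rw [← lin_equivariant, suspLin_mk, suspLin_mk, ← lin_equivariant, indTwist_lin, indTwist_lin]
    rfl)

/-- The suspension as a functor on modules. -/
def suspMod : FGRep R G ⥤ FGRep R G where
  obj := suspObj
  map := suspMap
  map_id M := by
    apply lin_injective
    refine LinearMap.ext fun x => ?_
    obtain ⟨a, rfl⟩ := suspProj_surjective M x
    change suspLin (lin (𝟙 M)) _ = _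
    rw [suspLin_mk, indTwist_lin]; rfl
  map_comp {M N K} f f' := by
    apply lin_injective
    refine LinearMap.ext fun x => ?_
    obtain ⟨a, rfl⟩ := suspProj_surjective M x
    change suspLin (lin (f ≫ f')) (lin (suspProj M) a) =
      suspLin (lin f') (suspLin (lin f) (lin (suspProj M) a))
    rw [suspLin_mk, suspLin_mk, suspLin_mk, indTwist_lin, indTwist_lin, indTwist_lin]; rfl

theorem suspLin_sub {M N : FGRep R G} (θ θ' : M.obj.V →ₗ[R] N.obj.V) :
    suspLin θ - suspLin θ' = suspLin (M := M) (N := N) (θ - θ') := by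
  refine LinearMap.ext fun x => ?_
  obtain ⟨a, rfl⟩ := suspProj_surjective M x
  rw [LinearMap.sub_apply, suspLin_mk, suspLin_mk, suspLin_mk, ← map_sub]
  congr 1
  funext g
  simp [indTwist_apply]

theorem suspLin_tr {M N : FGRep R G} (θ : M.obj.V →ₗ[R] N.obj.V) :
    suspLin (tr θ) = tr (M := suspObj M) (N := suspObj N) (suspLin (M := M) (N := N) θ) := by
  refine LinearMap.ext fun x => ?_
  obtain ⟨a, rfl⟩ := suspProj_surjective M x
  rw [tr_apply, suspLin_mk]
  have key : ∀ h : G, (suspObj N).obj.ρ h (suspLin (M := M) (N := N) θ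
      ((suspObj M).obj.ρ h⁻¹ (lin (suspProj M) a))) =
      lin (suspProj N) ((ind R G N.obj.V).obj.ρ h (indTwist θ
        ((ind R G M.obj.V).obj.ρ h⁻¹ a))) := by
    intro h
    rw [← lin_equivariant, suspLin_mk, ← lin_equivariant]
  rw [Finset.sum_congr rfl fun h _ => key h, ← map_sum]
  congr 1
  funext g
  rw [indTwist_apply, tr_apply, map_sum, Finset.sum_apply]
  refine Finset.sum_congr rfl fun h _ => ?_
  rw [ind_rho, indTwist_apply, ind_rho]
  simp

/-- The suspension functor `Σ` of the stable category. -/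
def susp (P : ObjectProperty (FGRep R G)) [TraceClass P] : Stable P ⥤ Stable P :=
  CategoryTheory.Quotient.lift (facRel P) (suspMod ⋙ toStable P) (by
    intro M N f f' h
    apply CategoryTheory.Quotient.sound
    rw [facRel_iff] at *
    obtain ⟨θ, hθ⟩ := h
    refine ⟨suspLin θ, ?_⟩
    have h := suspLin_tr (M := M) (N := N) θ
    rw [← hθ, ← suspLin_sub] at h
    exact h)

/-- Short exact sequences of `RG`-modules. -/
def IsSES ⦃X Y Z : FGRep R G⦄ (i : X ⟶ Y) (p : Y ⟶ Z) : Prop :=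
  Function.Injective (lin i) ∧ Function.Exact (lin i) (lin p) ∧ Function.Surjective (lin p)

/-- Short exact sequences of `RG`-modules that split over `R`. -/
def IsSplitSES ⦃X Y Z : FGRep R G⦄ (i : X ⟶ Y) (p : Y ⟶ Z) : Prop :=
  IsSES i p ∧ ∃ s : Z.obj.V →ₗ[R] Y.obj.V, lin p ∘ₗ s = LinearMap.id

end Modules

/-- The data of a triangulated structure: a suspension functor and a class of distinguished
triangles `X → Y → Z → ΣX`. -/
structure TriData (C : Type*) [Category* C] where
  /-- The suspension functor. -/
  susp : C ⥤ C
  /-- The distinguished triangles. -/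
  dist : ∀ {X Y Z : C}, (X ⟶ Y) → (Y ⟶ Z) → (Z ⟶ susp.obj X) → Prop

/-- The structure induced on a full subcategory that is closed under the suspension. -/
def TriData.restrict {C : Type*} [Category* C] (T : TriData C) (Q : ObjectProperty C)
    (hQ : ∀ X, Q X → Q (T.susp.obj X)) : TriData Q.FullSubcategory where
  susp := Q.lift (Q.ι ⋙ T.susp) (fun X => hQ X.obj X.property)
  dist f g h := T.dist f.hom g.hom h.hom

/-- An equivalence of triangulated categories: an additive equivalence of categories with a
natural isomorphism to commute it past the suspensions, such that a triangle is distinguished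
if and only if its image is. -/
structure TriEquiv {C D : Type*} [Category* C] [Category* D] [Preadditive C] [Preadditive D]
    (S : TriData C) (T : TriData D) where
  /-- The underlying equivalence of categories. -/
  equiv : C ≌ D
  additive : equiv.functor.Additive
  /-- The comparison of the suspensions. -/
  comm : S.susp ⋙ equiv.functor ≅ equiv.functor ⋙ T.susp
  dist_iff : ∀ {X Y Z : C} (f : X ⟶ Y) (g : Y ⟶ Z) (h : Z ⟶ S.susp.obj X),
    S.dist f g h ↔
      T.dist (equiv.functor.map f) (equiv.functor.map g) (equiv.functor.map h ≫ comm.hom.app X)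

section StableCategories

variable {R G : Type u} [CommRing R] [Group G] [Fintype G]

/-- The triangulated structure of a stable category, for a class `adm` of admissible short exact
sequences. Each admissible sequence `0 → X → Y → Z → 0` maps to `0 → X → RG ⊗_R X → ΣX → 0` by a
map that is the identity on `X`; with the resulting map `Z → ΣX` it gives a triangle, and the
distinguished triangles are those isomorphic to one of these. -/
def triData (P : ObjectProperty (FGRep R G)) [TraceClass P]
    (adm : ∀ ⦃X Y Z : FGRep R G⦄, (X ⟶ Y) → (Y ⟶ Z) → Prop) : TriData (Stable P) where
  susp := susp P
  dist {A B C} f g h :=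
    ∃ (X Y Z : FGRep R G) (i : X ⟶ Y) (p : Y ⟶ Z) (_ : adm i p)
      (e : Y ⟶ ind R G X.obj.V) (d : Z ⟶ suspObj X)
      (_ : i ≫ e = unit X) (_ : p ≫ d = e ≫ suspProj X)
      (a : A ≅ (toStable P).obj X) (b : B ≅ (toStable P).obj Y) (c : C ≅ (toStable P).obj Z),
      f ≫ b.hom = a.hom ≫ (toStable P).map i ∧
      g ≫ c.hom = b.hom ≫ (toStable P).map p ∧
      h ≫ (susp P).map a.hom = c.hom ≫ (toStable P).map d

variable (R G) in
/-- The relative stable category: finitely generated `RG`-modules modulo weakly projectives. -/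
abbrev StRel : Type (u + 1) := Stable (weaklyProjective R G)

variable (R G) in
/-- The triangulated structure of the relative stable category. -/
def relTri : TriData (StRel R G) := triData _ IsSplitSES

/-- The usual stable module category over a field `k`: finitely generated `kG`-modules modulo
projectives. -/
abbrev StMod (k G : Type u) [Field k] [Group G] [Fintype G] : Type (u + 1) :=
  Stable (projectiveObj k G)

/-- The triangulated structure of the stable module category; all short exact sequences are
admissible, and `ΣM`, the cokernel of the embedding of `M` in the injective module `kG ⊗_k M`,
is the cosyzygy of `M`. -/
def stTri (k G : Type u) [Field k] [Group G] [Fintype G] : TriData (StMod k G) :=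
  triData _ IsSES

/-- The tensor product over `R`, with the diagonal action of `G`. -/
def tensorObj {P : ObjectProperty (FGRep R G)} (X Y : Stable P) : Stable P :=
  (toStable P).obj (FGRep.of (X.as.obj.ρ.tprod Y.as.obj.ρ))

/-- Thick tensor ideals: full triangulated subcategories closed under direct summands and under
the tensor product with any object. -/
structure IsThickTensorIdeal (Q : ObjectProperty (StRel R G)) : Prop where
  zero : ∀ X, Limits.IsZero X → Q X
  iso : ∀ {X Y : StRel R G}, (X ≅ Y) → Q X → Q Y
  susp_iff : ∀ X, Q ((relTri R G).susp.obj X) ↔ Q X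
  ext₁ : ∀ {X Y Z : StRel R G} (f : X ⟶ Y) (g : Y ⟶ Z) (h : Z ⟶ (relTri R G).susp.obj X),
    (relTri R G).dist f g h → Q Y → Q Z → Q X
  ext₂ : ∀ {X Y Z : StRel R G} (f : X ⟶ Y) (g : Y ⟶ Z) (h : Z ⟶ (relTri R G).susp.obj X),
    (relTri R G).dist f g h → Q X → Q Z → Q Y
  ext₃ : ∀ {X Y Z : StRel R G} (f : X ⟶ Y) (g : Y ⟶ Z) (h : Z ⟶ (relTri R G).susp.obj X),
    (relTri R G).dist f g h → Q X → Q Y → Q Z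
  retract : ∀ {X Y : StRel R G}, Retract X Y → Q Y → Q X
  tensor : ∀ X Y, Q X → Q (tensorObj Y X)

/-- The thick tensor ideal generated by an object. -/
def thickIdeal (W : StRel R G) : ObjectProperty (StRel R G) := fun X =>
  ∀ Q : ObjectProperty (StRel R G), IsThickTensorIdeal Q → Q W → Q X

/-- The triangulated structure of the thick tensor ideal generated by an object. -/
def thickTri (W : StRel R G) : TriData (thickIdeal W).FullSubcategory :=
  (relTri R G).restrict (thickIdeal W)
    (fun X hX Q hQ hW => (hQ.susp_iff X).2 (hX Q hQ hW))

/-! ### Syzygies -/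

section Syzygy

set_option linter.unusedSectionVars false

theorem exists_cover (M : FGRep R G) :
    ∃ (n : ℕ) (s : (Fin n → R) →ₗ[R] M.obj.V), Function.Surjective s :=
  Module.Finite.exists_fin' R M.obj.V

/-- The rank of a chosen free `RG`-module that maps onto `M`. -/
def coverRank (M : FGRep R G) : ℕ := (exists_cover M).choose

/-- The chosen surjection from a free `R`-module. -/
def coverLin (M : FGRep R G) : (Fin (coverRank M) → R) →ₗ[R] M.obj.V :=
  (exists_cover M).choose_spec.choose

theorem coverLin_surjective (M : FGRep R G) : Function.Surjective (coverLin M) :=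
  (exists_cover M).choose_spec.choose_spec

/-- The chosen free `RG`-module that maps onto `M`. -/
abbrev coverObj (M : FGRep R G) : FGRep R G := ind R G (Fin (coverRank M) → R)

/-- The map from the chosen free `RG`-module onto `M`. -/
def cover (M : FGRep R G) : coverObj M ⟶ M := indLift (coverLin M)

theorem cover_surjective (M : FGRep R G) : Function.Surjective (lin (cover M)) := by
  classical
  intro x
  obtain ⟨y, hy⟩ := coverLin_surjective M x
  refine ⟨(Pi.single 1 y : G → Fin (coverRank M) → R), ?_⟩
  rw [cover, indLift_apply, Finset.sum_eq_single 1]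
  · simpa using hy
  · intro g _ hg; simp [Pi.single_eq_of_ne hg]
  · simp

/-- An `R`-linear map out of a free `RG`-module lifts along a cover, `R`-linearly. -/
theorem exists_linear_lift (M : FGRep R G) {n : ℕ}
    (θ : (G → Fin n → R) →ₗ[R] M.obj.V) :
    ∃ l : (G → Fin n → R) →ₗ[R] (coverObj M).obj.V, lin (cover M) ∘ₗ l = θ :=
  Module.projective_lifting_property _ _ (cover_surjective M)

/-- A map out of a free `RG`-module lifts along a cover, `G`-equivariantly. -/
theorem exists_lift (M : FGRep R G) {n : ℕ} (f : ind R G (Fin n → R) ⟶ M) :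
    ∃ l : ind R G (Fin n → R) ⟶ coverObj M, l ≫ cover M = f := by
  obtain ⟨θ, hθ⟩ := exists_tr_of_ind f
  obtain ⟨l, hl⟩ := exists_linear_lift M θ
  refine ⟨mkHom (tr (M := ind R G (Fin n → R)) l) (tr_equivariant _), ?_⟩
  apply lin_injective
  rw [lin_comp, lin_mkHom, comp_tr, hl, hθ]

variable [IsNoetherianRing R]

/-- The syzygy of `M`: the kernel of the map from a free `RG`-module onto `M`. -/
def syzObj (M : FGRep R G) : FGRep R G :=
  FGRep.of (V := LinearMap.ker (lin (cover M)))
    ((coverObj M).obj.ρ.subrepresentation (LinearMap.ker (lin (cover M))) (by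
      intro g x hx
      rw [Submodule.mem_comap, LinearMap.mem_ker, lin_equivariant, LinearMap.mem_ker.1 hx,
        map_zero]))

/-- The inclusion of the syzygy in the free module. -/
def syzIncl (M : FGRep R G) : syzObj M ⟶ coverObj M :=
  mkHom (LinearMap.ker (lin (cover M))).subtype (fun _ _ => rfl)

theorem syzIncl_injective (M : FGRep R G) : Function.Injective (lin (syzIncl M)) :=
  Subtype.val_injective

/-- The map of syzygies induced by an `R`-linear map of covers. -/
def syzLin {M N : FGRep R G} (l : (coverObj M).obj.V →ₗ[R] (coverObj N).obj.V)
    (hl : ∀ x, lin (cover M) x = 0 → lin (cover N) (l x) = 0) :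
    (syzObj M).obj.V →ₗ[R] (syzObj N).obj.V :=
  l.restrict hl

/-- The chosen lift to the covers of a morphism. -/
def coverMap {M N : FGRep R G} (f : M ⟶ N) : coverObj M ⟶ coverObj N :=
  (exists_lift N (cover M ≫ f)).choose

theorem coverMap_comm {M N : FGRep R G} (f : M ⟶ N) :
    coverMap f ≫ cover N = cover M ≫ f :=
  (exists_lift N (cover M ≫ f)).choose_spec

/-- The map of syzygies induced by a lift of a morphism to the covers. -/
def syzMapOf {M N : FGRep R G} (f : M ⟶ N) (l : coverObj M ⟶ coverObj N)
    (h : l ≫ cover N = cover M ≫ f) : syzObj M ⟶ syzObj N :=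
  mkHom (syzLin (lin l) (fun x hx => by
      have := LinearMap.congr_fun (congrArg lin h) x
      rw [lin_comp, lin_comp, LinearMap.comp_apply, LinearMap.comp_apply, hx, map_zero] at this
      exact this))
    (fun g x => syzIncl_injective N (lin_equivariant l g x.1))

theorem syzMapOf_incl {M N : FGRep R G} (f : M ⟶ N) (l : coverObj M ⟶ coverObj N)
    (h : l ≫ cover N = cover M ≫ f) :
    syzMapOf f l h ≫ syzIncl N = syzIncl M ≫ l := rfl

/-- If the difference of two morphisms is a trace, the induced maps of syzygies are equal in the
stable category, whatever the lifts. -/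
theorem syzMapOf_rel {M N : FGRep R G} {f f' : M ⟶ N} (l l' : coverObj M ⟶ coverObj N)
    (h : l ≫ cover N = cover M ≫ f) (h' : l' ≫ cover N = cover M ≫ f')
    (hff' : facRel (weaklyProjective R G) f f') :
    facRel (weaklyProjective R G) (syzMapOf f l h) (syzMapOf f' l' h') := by
  rw [facRel_iff] at *
  obtain ⟨θ, hθ⟩ := hff'
  obtain ⟨m, hm⟩ := exists_linear_lift N (θ ∘ₗ lin (cover M))
  have hm' : lin (cover N) ∘ₗ (lin (l - l') - tr m) = 0 := by
    rw [LinearMap.comp_sub, comp_tr, hm, ← tr_comp, ← hθ, ← lin_comp, Preadditive.sub_comp, h, h',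
      LinearMap.sub_comp, lin_sub, lin_comp, lin_comp, sub_self]
  let w : (coverObj M).obj.V →ₗ[R] (coverObj N).obj.V :=
    lin (l - l') - tr (M := coverObj M) (N := coverObj N) m
  let d : coverObj M ⟶ syzObj N := mkHom (LinearMap.codRestrict (LinearMap.ker (lin (cover N)))
      w (fun x => LinearMap.congr_fun hm' x)) (fun g x => by
    apply syzIncl_injective N
    rw [lin_equivariant (syzIncl N)]
    change w ((coverObj M).obj.ρ g x) = (coverObj N).obj.ρ g (w x)
    rw [LinearMap.sub_apply, LinearMap.sub_apply, lin_equivariant, tr_equivariant, map_sub])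
  obtain ⟨η, hη⟩ := exists_tr_of_ind d
  refine ⟨η ∘ₗ lin (syzIncl M) + syzLin m (fun x hx => ?_), ?_⟩
  · have := LinearMap.congr_fun hm x
    rw [LinearMap.comp_apply, LinearMap.comp_apply, hx, map_zero] at this
    exact this
  · rw [tr_add, ← tr_comp, ← hη]
    refine LinearMap.ext fun x => syzIncl_injective N ?_
    have e1 : ∀ y, lin (syzIncl N) (lin d y) = lin l y - lin l' y -
        tr (M := coverObj M) (N := coverObj N) m y := fun _ => rfl
    rw [LinearMap.add_apply, map_add, LinearMap.comp_apply, e1]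
    rw [tr_apply (M := syzObj M) (N := syzObj N), map_sum,
      tr_apply (M := coverObj M) (N := coverObj N)]
    have e2 : ∀ g : G, lin (syzIncl N) ((syzObj N).obj.ρ g (syzLin m (fun x hx => by
        have := LinearMap.congr_fun hm x
        rw [LinearMap.comp_apply, LinearMap.comp_apply, hx, map_zero] at this
        exact this) ((syzObj M).obj.ρ g⁻¹ x))) =
        (coverObj N).obj.ρ g (m ((coverObj M).obj.ρ g⁻¹ (lin (syzIncl M) x))) := fun _ => rfl
    rw [Finset.sum_congr rfl fun g _ => e2 g, sub_add_cancel]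
    rfl

variable (R G) in
/-- The syzygy functor `Ω` on the relative stable category: on objects it is the kernel of a
surjection from a free `RG`-module (not an `R`-split one), and on morphisms it is induced by
lifting to the free modules. -/
def syzygy : StRel R G ⥤ StRel R G :=
  CategoryTheory.Quotient.lift (facRel (weaklyProjective R G))
    { obj := fun M => (toStable (weaklyProjective R G)).obj (syzObj M)
      map := fun f => (toStable (weaklyProjective R G)).map
        (syzMapOf f (coverMap f) (coverMap_comm f))
      map_id := fun M => by
        rw [← (toStable (weaklyProjective R G)).map_id]
        exact CategoryTheory.Quotient.sound _ (syzMapOf_rel (f := 𝟙 M) (f' := 𝟙 M) (coverMap (𝟙 M)) (𝟙 _)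
          (coverMap_comm _) (by simp) (Congruence.equivalence.refl _))
      map_comp := fun {M N K} f f' => by
        rw [← (toStable (weaklyProjective R G)).map_comp]
        exact CategoryTheory.Quotient.sound _ (syzMapOf_rel (f := f ≫ f') (f' := f ≫ f') (coverMap (f ≫ f'))
          (coverMap f ≫ coverMap f') (coverMap_comm _)
          (by rw [Category.assoc, coverMap_comm, ← Category.assoc, coverMap_comm, Category.assoc])
          (Congruence.equivalence.refl _)) }
    (by
      intro M N f f' h
      exact CategoryTheory.Quotient.sound _ (syzMapOf_rel _ _ _ _ h))

end Syzygy

/-! ### Change of rings -/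

/-- The additive group `M` regarded as an `R`-module along `φ : R → R'`. -/
def Along {R R' : Type u} [CommRing R] [CommRing R'] (_ : R →+* R') (M : Type u) : Type u := M

section Along

variable {R R' : Type u} [CommRing R] [CommRing R'] (φ : R →+* R')

instance (M : Type u) [h : AddCommGroup M] : AddCommGroup (Along φ M) := h

instance (M : Type u) [AddCommGroup M] [Module R' M] : Module R (Along φ M) :=
  Module.compHom M φ

/-- An `R'`-linear map as an `R`-linear map. -/
def alongMap {M N : Type u} [AddCommGroup M] [Module R' M] [AddCommGroup N] [Module R' N]
    (f : M →ₗ[R'] N) : Along φ M →ₗ[R] Along φ N where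
  toFun := f
  map_add' := f.map_add
  map_smul' r x := f.map_smul (φ r) x

theorem finite_along (hφ : Function.Surjective φ) (M : Type u) [AddCommGroup M] [Module R' M]
    [Module.Finite R' M] : Module.Finite R (Along φ M) := by
  let : Algebra R R' := φ.toAlgebra
  let : Module R M := Module.compHom M φ
  have : IsScalarTower R R' M := ⟨fun r s x => by
    rw [Algebra.smul_def, mul_smul]; rfl⟩
  have : Module.Finite R R' := RingHom.Finite.of_surjective φ hφ
  exact Module.Finite.trans R' M

/-- Restriction of scalars of a representation along a surjection `R → R'`. -/
def alongObj (hφ : Function.Surjective φ) (M : FGRep R' G) : FGRep R G :=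
  FGRep.of (V := Along φ M.obj.V) (h := finite_along φ hφ M.obj.V)
    { toFun := fun g => alongMap φ (M.obj.ρ g)
      map_one' := by rw [map_one]; rfl
      map_mul' := fun g h => by rw [map_mul]; rfl }

/-- Restriction of scalars of a morphism. -/
def alongHom (hφ : Function.Surjective φ) {M N : FGRep R' G} (f : M ⟶ N) :
    alongObj φ hφ M ⟶ alongObj φ hφ N :=
  mkHom (M := alongObj φ hφ M) (N := alongObj φ hφ N)
    (alongMap φ (M := M.obj.V) (N := N.obj.V) (lin f)) (fun g x => lin_equivariant f g x)

/-- Restriction of scalars along a surjection `R → R'`, as a functor on modules. -/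
def alongMod (hφ : Function.Surjective φ) : FGRep R' G ⥤ FGRep R G where
  obj := alongObj φ hφ
  map := alongHom φ hφ
  map_id _ := rfl
  map_comp _ _ := rfl

theorem alongMap_tr (hφ : Function.Surjective φ) {M N : FGRep R' G}
    (θ : M.obj.V →ₗ[R'] N.obj.V) :
    alongMap φ (M := M.obj.V) (N := N.obj.V) (tr θ) =
      tr (M := alongObj φ hφ M) (N := alongObj φ hφ N)
        (alongMap φ (M := M.obj.V) (N := N.obj.V) θ) := by
  refine LinearMap.ext fun x => ?_
  exact (tr_apply (M := M) (N := N) θ x).trans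
    (tr_apply (M := alongObj φ hφ M) (N := alongObj φ hφ N)
      (alongMap φ (M := M.obj.V) (N := N.obj.V) θ) x).symm

/-- Restriction of scalars along a surjection `R → R'`, as a functor from a stable category over
`R'` to the relative stable category over `R`. -/
def inflate (hφ : Function.Surjective φ) (P : ObjectProperty (FGRep R' G)) [TraceClass P] :
    Stable P ⥤ StRel R G :=
  CategoryTheory.Quotient.lift (facRel P) (alongMod φ hφ ⋙ toStable (weaklyProjective R G)) (by
    intro M N f f' h
    apply CategoryTheory.Quotient.sound
    rw [facRel_iff] at *
    obtain ⟨θ, hθ⟩ := h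
    refine ⟨alongMap φ (M := M.obj.V) (N := N.obj.V) θ, ?_⟩
    have h := alongMap_tr φ hφ (M := M) (N := N) θ
    rw [← hθ] at h
    exact h)

end Along

variable (R G) in
/-- The trivial module `R`. -/
def trivialRep : FGRep R G := FGRep.of (Representation.trivial R G R)

variable (G) in
/-- The cokernel of the map from the trivial module to `RG` with `1 ↦ c • ∑ g, g`. -/
def normCoker (c : R) : FGRep R G :=
  FGRep.of ((ind R G R).obj.ρ.quotient (Submodule.span R {fun _ : G => c}) (by
    intro g
    rw [Submodule.span_le, Set.singleton_subset_iff]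
    exact Submodule.subset_span rfl))

end StableCategories

/-! ### The rings `R_n` -/

section Rings

variable (S : Type u) [CommRing S] (t : S)

/-- The ring `R_n = S / t^n`. -/
abbrev Rn (n : ℕ) : Type u := S ⧸ Ideal.span {t ^ n}

/-- The surjection `R_n → R_{n-1}`. -/
def toPred (n : ℕ) : Rn S t n →+* Rn S t (n - 1) :=
  Ideal.Quotient.factor (Ideal.span_singleton_le_span_singleton.2 (pow_dvd_pow t (Nat.sub_le n 1)))

theorem toPred_surjective (n : ℕ) : Function.Surjective (toPred S t n) :=
  Ideal.Quotient.factor_surjective _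

variable [IsLocalRing S] {t}

/-- The surjection from `R_n` to the residue field `k`, for `n ≥ 1`. -/
def toResidue (ht : ¬ IsUnit t) {n : ℕ} (hn : 1 ≤ n) :
    Rn S t n →+* IsLocalRing.ResidueField S :=
  Ideal.Quotient.factor (S := Ideal.span {t ^ n}) (T := IsLocalRing.maximalIdeal S) (by
    rw [Ideal.span_singleton_le_iff_mem]
    exact Ideal.pow_mem_of_mem _ ((IsLocalRing.mem_maximalIdeal t).2 ht) n hn)

theorem toResidue_surjective (ht : ¬ IsUnit t) {n : ℕ} (hn : 1 ≤ n) :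
    Function.Surjective (toResidue S ht hn) :=
  Ideal.Quotient.factor_surjective _

end Rings

/-! ### The categories of the theorem -/

section Main

variable {S : Type u} [CommRing S] [IsLocalRing S] {t : S} (ht : ¬ IsUnit t) {n : ℕ} (hn : 1 ≤ n)
  (G : Type u) [Group G] [Fintype G]

variable (t n) in
/-- The module `W_n = Ω_n⁻¹ k`, the cokernel of `k → A_n`, `1 ↦ t^{n-1} ∑ g, g`. -/
def W : StRel (Rn S t n) G :=
  (toStable _).obj (normCoker G (Ideal.Quotient.mk (Ideal.span {t ^ n}) t ^ (n - 1)))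

/-- The functor `stmod kG → D_n` that regards `kG`-modules as `A_n`-modules. -/
def inflateResidue : StMod (IsLocalRing.ResidueField S) G ⥤ StRel (Rn S t n) G :=
  inflate (toResidue S ht hn) (toResidue_surjective S ht hn) _

/-- The trivial module `k` as an object of `D_n`. -/
def kObj : StRel (Rn S t n) G :=
  (inflateResidue ht hn G).obj ((toStable _).obj (trivialRep (IsLocalRing.ResidueField S) G))

variable (t n) in
/-- The trivial module `R_{n-1}` as an object of `D_n`. -/
def unitPred : StRel (Rn S t n) G :=
  (inflate (toPred S t n) (toPred_surjective S t n) (weaklyProjective (Rn S t (n - 1)) G)).obj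
    ((toStable _).obj (trivialRep (Rn S t (n - 1)) G))

variable (t n) in
/-- The kernel `K_n` of base change `- ⊗_{R_n} R_{n-1}`. -/
def K : ObjectProperty (StRel (Rn S t n) G) := fun X =>
  Limits.IsZero (tensorObj X (unitPred t n G))

end Main

end

end RelStab

/-!
# The thick tensor ideals of `W_n` and `k` in the relative stable category

Throughout, two maps of modules are stably equal if and only if their difference is a trace
`∑ g, g θ g⁻¹` of an `R`-linear map `θ`, and a module is relatively projective if and only if its
identity is a trace (Higman's criterion). All arguments are computations with traces.

*The syzygy functor.* By Schanuel's lemma and the horseshoe lemma, `Ω` commutes with `Σ` and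
preserves triangles (`syzygy_preserves_dist`). The ring `R_n = S / t ^ n` is self-injective
(`baer_self`), and finitely generated modules embed in free ones (`exists_embedding`). So maps of
syzygies extend to the covers, and `Ω` is a triangulated autoequivalence of `D_n` (`syzygy_full`,
`syzygy_faithful`, `exists_syzygy_iso`, `syzygy_reflects_dist`).

*The image of `K_n`.* The central step, `K_iff_syzygy`, is that `X` lies in `K_n` if and only if
`ΩX` is stably killed by `t`: the identity of `ΩX` is stably equal to an endomorphism killed by
`t`. If `F → X` is a free cover with kernel `Y`, both conditions say that the identity of `F` is the
trace of an `R_n`-linear map that preserves the kernel `Y + t ^ (n - 1) F` of `F → X ⊗ R_{n-1}`. By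
Fitting's lemma an object stably killed by `t` is stably isomorphic to a module killed by `t`, that
is, to a `kG`-module (`isStablyKilled_iff_essImage`). Hence `Ω K_n = D_1`.

*Generation.* The kernel `K_n` is a thick tensor ideal. It contains `W_n`, as `ΩW_n ≅ k` is killed
by `t`. Conversely, there is an `R_n`-split sequence `R_{n-1} → W_n → ΣR_n`, and tensoring it with
`X ∈ K_n` gives `X ⊗ W_n ≅ ΣX`; so `W_n` generates `K_n` (`thickIdeal_W_eq`). As `Ω` is an
autoequivalence, `D_1 = Ω K_n` is thick; it is a tensor ideal, and is generated by `k` because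
`M ⊗ k ≅ M` for a `kG`-module `M` (`thickIdeal_k_eq`).

*Inflation* from `kG`-modules is fully faithful, since an `R_n`-linear map between `k`-modules is
`k`-linear, so that traces over the two rings agree. It preserves triangles, as every short exact
sequence of `k`-modules splits.

*The tensor product.* For `X = Y = W_n` one has `Ω (X ⊗ Y) ≅ ΩΣW_n ≅ Σk` and
`ΩX ⊗ ΩY ≅ k ⊗ k ≅ k`, and these differ for the group of order three in characteristic three
(`eq_zero_of_iso_susp`).
-/

namespace RelStab

noncomputable section

set_option linter.unusedSectionVars false

open scoped TensorProduct

/-! ### Morphisms of representations and relative projectivity -/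

section Morphisms

variable {R G : Type u} [CommRing R] [Group G] [Fintype G]

theorem exists_linear_descend {R A B C : Type*} [CommRing R] [AddCommGroup A] [AddCommGroup B]
    [AddCommGroup C] [Module R A] [Module R B] [Module R C] (q : A →ₗ[R] B)
    (hq : Function.Surjective q) (f : A →ₗ[R] C) (h : ∀ x, q x = 0 → f x = 0) :
    ∃ l : B →ₗ[R] C, l ∘ₗ q = f := by
  refine ⟨(LinearMap.ker q).liftQ f h ∘ₗ (q.quotKerEquivOfSurjective hq).symm.toLinearMap, ?_⟩
  refine LinearMap.ext fun x => ?_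
  have : (q.quotKerEquivOfSurjective hq).symm (q x) = (LinearMap.ker q).mkQ x := by
    rw [LinearEquiv.symm_apply_eq]; rfl
  rw [LinearMap.comp_apply, LinearMap.comp_apply, LinearEquiv.coe_coe, this]
  exact (LinearMap.ker q).liftQ_apply f x

theorem exists_linear_corestrict {R A B C : Type*} [CommRing R] [AddCommGroup A] [AddCommGroup B]
    [AddCommGroup C] [Module R A] [Module R B] [Module R C] (i : B →ₗ[R] C)
    (hi : Function.Injective i) (f : A →ₗ[R] C) (h : ∀ x, ∃ y, i y = f x) :
    ∃ l : A →ₗ[R] B, i ∘ₗ l = f := by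
  refine ⟨(LinearEquiv.ofInjective i hi).symm.toLinearMap ∘ₗ f.codRestrict (LinearMap.range i) h, ?_⟩
  refine LinearMap.ext fun x => ?_
  have := (LinearEquiv.ofInjective i hi).apply_symm_apply (f.codRestrict (LinearMap.range i) h x)
  exact congrArg Subtype.val this

theorem hom_congr {M N : FGRep R G} {f g : M ⟶ N} (h : f = g) (x : M.obj.V) :
    lin f x = lin g x := by rw [h]

theorem hom_ext' {M N : FGRep R G} {f g : M ⟶ N} (h : ∀ x, lin f x = lin g x) : f = g :=
  lin_injective (LinearMap.ext h)

@[simp] theorem lin_comp_apply {M N K : FGRep R G} (f : M ⟶ N) (g : N ⟶ K) (x : M.obj.V) :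
    lin (f ≫ g) x = lin g (lin f x) := rfl

@[simp] theorem lin_zero {M N : FGRep R G} : lin (0 : M ⟶ N) = 0 := rfl

theorem exists_descend {M Q N : FGRep R G} (q : M ⟶ Q) (hq : Function.Surjective (lin q))
    (f : M ⟶ N) (h : ∀ x, lin q x = 0 → lin f x = 0) : ∃ f' : Q ⟶ N, q ≫ f' = f := by
  obtain ⟨l, hl⟩ := exists_linear_descend (lin q) hq (lin f) h
  refine ⟨mkHom l fun g y => ?_, lin_injective hl⟩
  obtain ⟨x, rfl⟩ := hq y
  have hl' := LinearMap.congr_fun hl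
  simp only [LinearMap.comp_apply] at hl'
  rw [← lin_equivariant, hl', hl', lin_equivariant]

theorem exists_corestrict {M Q N : FGRep R G} (i : Q ⟶ N) (hi : Function.Injective (lin i))
    (f : M ⟶ N) (h : ∀ x, ∃ y, lin i y = lin f x) : ∃ f' : M ⟶ Q, f' ≫ i = f := by
  obtain ⟨l, hl⟩ := exists_linear_corestrict (lin i) hi (lin f) h
  refine ⟨mkHom l fun g y => hi ?_, lin_injective hl⟩
  have hl' := LinearMap.congr_fun hl
  simp only [LinearMap.comp_apply] at hl'
  rw [lin_equivariant, hl', hl', lin_equivariant]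

theorem cancel_surjective {M Q N : FGRep R G} (q : M ⟶ Q) (hq : Function.Surjective (lin q))
    {f g : Q ⟶ N} (h : q ≫ f = q ≫ g) : f = g := by
  have := epi_of_surjective q hq
  exact (cancel_epi q).1 h

theorem cancel_injective {M Q N : FGRep R G} (i : Q ⟶ N) (hi : Function.Injective (lin i))
    {f g : M ⟶ Q} (h : f ≫ i = g ≫ i) : f = g :=
  hom_ext' fun x => hi (hom_congr h x)

namespace IsSES

variable {X Y Z : FGRep R G} {i : X ⟶ Y} {p : Y ⟶ Z}

theorem comp_eq_zero (h : IsSES i p) : i ≫ p = 0 :=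
  hom_ext' fun x => h.2.1.apply_apply_eq_zero x

theorem exists_desc (h : IsSES i p) {N : FGRep R G} (f : Y ⟶ N) (hf : i ≫ f = 0) :
    ∃ f' : Z ⟶ N, p ≫ f' = f := by
  refine exists_descend p h.2.2 f fun x hx => ?_
  obtain ⟨y, rfl⟩ := (h.2.1 x).1 hx
  exact hom_congr hf y

theorem exists_lift (h : IsSES i p) {N : FGRep R G} (f : N ⟶ Y) (hf : f ≫ p = 0) :
    ∃ f' : N ⟶ X, f' ≫ i = f :=
  exists_corestrict i h.1 f fun x => (h.2.1 _).1 (hom_congr hf x)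

end IsSES

/-- The kernel of a morphism. -/
abbrev kerObj [IsNoetherianRing R] {M N : FGRep R G} (f : M ⟶ N) : FGRep R G :=
  FGRep.of (V := LinearMap.ker (lin f))
    (M.obj.ρ.subrepresentation (LinearMap.ker (lin f)) (by
      intro g x hx
      rw [Submodule.mem_comap, LinearMap.mem_ker, lin_equivariant, LinearMap.mem_ker.1 hx,
        map_zero]))

/-- The inclusion of the kernel of a morphism. -/
def kerIncl [IsNoetherianRing R] {M N : FGRep R G} (f : M ⟶ N) : kerObj f ⟶ M :=
  mkHom (LinearMap.ker (lin f)).subtype (fun _ _ => rfl)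

theorem isSES_ker [IsNoetherianRing R] {M N : FGRep R G} (f : M ⟶ N)
    (hf : Function.Surjective (lin f)) : IsSES (kerIncl f) f :=
  ⟨Subtype.val_injective, LinearMap.exact_subtype_ker_map (lin f), hf⟩

/-- The cokernel of a morphism. -/
abbrev cokerObj {M N : FGRep R G} (f : M ⟶ N) : FGRep R G :=
  FGRep.of (N.obj.ρ.quotient (LinearMap.range (lin f)) (by
    rintro g _ ⟨x, rfl⟩
    exact ⟨M.obj.ρ g x, lin_equivariant f g x⟩))

/-- The projection to the cokernel of a morphism. -/
def cokerProj {M N : FGRep R G} (f : M ⟶ N) : N ⟶ cokerObj f :=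
  mkHom (LinearMap.range (lin f)).mkQ (fun _ _ => rfl)

theorem isSES_coker {M N : FGRep R G} (f : M ⟶ N) (hf : Function.Injective (lin f)) :
    IsSES f (cokerProj f) :=
  ⟨hf, LinearMap.exact_map_mkQ_range (lin f), Submodule.mkQ_surjective _⟩

/-- The direct sum of two representations. -/
abbrev prodObj (M N : FGRep R G) : FGRep R G := FGRep.of (M.obj.ρ.prod N.obj.ρ)

/-- The first projection of a direct sum. -/
def prodFst (M N : FGRep R G) : prodObj M N ⟶ M := mkHom (LinearMap.fst R _ _) (fun _ _ => rfl)

/-- The second projection of a direct sum. -/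
def prodSnd (M N : FGRep R G) : prodObj M N ⟶ N := mkHom (LinearMap.snd R _ _) (fun _ _ => rfl)

/-- The first inclusion in a direct sum. -/
def prodInl (M N : FGRep R G) : M ⟶ prodObj M N :=
  mkHom (LinearMap.inl R _ _) (fun g _ => Prod.ext rfl (map_zero (N.obj.ρ g)).symm)

/-- The second inclusion in a direct sum. -/
def prodInr (M N : FGRep R G) : N ⟶ prodObj M N :=
  mkHom (LinearMap.inr R _ _) (fun g _ => Prod.ext (map_zero (M.obj.ρ g)).symm rfl)

/-- The map to a direct sum with the given components. -/
def prodLift {K M N : FGRep R G} (f : K ⟶ M) (g : K ⟶ N) : K ⟶ prodObj M N :=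
  mkHom ((lin f).prod (lin g)) (fun h x => Prod.ext (lin_equivariant f h x) (lin_equivariant g h x))

end Morphisms

section RelProj

variable {R G : Type u} [CommRing R] [Group G] [Fintype G]

/-- Relative projectivity in the form of Higman's criterion: the identity is the trace of an
`R`-linear map. -/
def IsRelProj (M : FGRep R G) : Prop := ∃ θ : M.obj.V →ₗ[R] M.obj.V, LinearMap.id = tr θ

theorem isRelProj_ind (L : Type u) [AddCommGroup L] [Module R L] [Module.Finite R L] :
    IsRelProj (ind R G L) := by
  obtain ⟨θ, h⟩ := exists_tr_of_ind (𝟙 (ind R G L))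
  exact ⟨θ, h⟩

theorem IsRelProj.exists_tr_from {M N : FGRep R G} (h : IsRelProj M) (f : M ⟶ N) :
    ∃ θ : M.obj.V →ₗ[R] N.obj.V, lin f = tr θ := by
  obtain ⟨θ, h⟩ := h
  exact ⟨lin f ∘ₗ θ, by rw [← comp_tr, ← h, LinearMap.comp_id]⟩

theorem IsRelProj.exists_tr_to {M N : FGRep R G} (h : IsRelProj N) (f : M ⟶ N) :
    ∃ θ : M.obj.V →ₗ[R] N.obj.V, lin f = tr θ := by
  obtain ⟨θ, h⟩ := h
  exact ⟨θ ∘ₗ lin f, by rw [← tr_comp, ← h, LinearMap.id_comp]⟩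

theorem IsRelProj.retract {M N : FGRep R G} (h : IsRelProj N) (i : M ⟶ N) (r : N ⟶ M)
    (hir : i ≫ r = 𝟙 M) : IsRelProj M := by
  obtain ⟨θ, h⟩ := h
  refine ⟨lin r ∘ₗ θ ∘ₗ lin i, ?_⟩
  rw [← comp_tr, ← tr_comp, ← h, LinearMap.id_comp, ← lin_comp, hir, lin_id]

theorem IsRelProj.prod {M N : FGRep R G} (hM : IsRelProj M) (hN : IsRelProj N) :
    IsRelProj (prodObj M N) := by
  obtain ⟨θ, hθ⟩ := hM.exists_tr_from (prodInl M N)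
  obtain ⟨η, hη⟩ := hN.exists_tr_from (prodInr M N)
  refine ⟨θ ∘ₗ lin (prodFst M N) + η ∘ₗ lin (prodSnd M N), ?_⟩
  rw [tr_add, ← tr_comp, ← tr_comp, ← hθ, ← hη]
  refine LinearMap.ext fun x => ?_
  exact Prod.ext (add_zero _).symm (zero_add _).symm

/-- A morphism with the given trace form. -/
def trHom {M N : FGRep R G} (θ : M.obj.V →ₗ[R] N.obj.V) : M ⟶ N := mkHom (tr θ) (tr_equivariant θ)

@[simp] theorem lin_trHom {M N : FGRep R G} (θ : M.obj.V →ₗ[R] N.obj.V) :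
    lin (trHom θ : M ⟶ N) = tr θ := rfl

theorem IsSplitSES.exists_linear_retraction {X Y Z : FGRep R G} {i : X ⟶ Y} {p : Y ⟶ Z}
    (h : IsSplitSES i p) : ∃ r : Y.obj.V →ₗ[R] X.obj.V, r ∘ₗ lin i = LinearMap.id := by
  obtain ⟨⟨hi, hex, hp⟩, s, hs⟩ := h
  obtain ⟨l, hl⟩ := exists_linear_corestrict (lin i) hi (LinearMap.id - s ∘ₗ lin p) (fun y => by
    refine (hex _).1 ?_
    have := LinearMap.congr_fun hs (lin p y)
    simp only [LinearMap.comp_apply, LinearMap.id_apply] at this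
    simp [this])
  refine ⟨l, LinearMap.ext fun x => hi ?_⟩
  have := LinearMap.congr_fun hl (lin i x)
  simp only [LinearMap.comp_apply, LinearMap.sub_apply, LinearMap.id_apply,
    hex.apply_apply_eq_zero, map_zero, sub_zero] at this
  exact this

/-- A short exact sequence is `R`-split if its first map has an `R`-linear retraction. -/
theorem isSplitSES_of_retraction {X Y Z : FGRep R G} {i : X ⟶ Y} {p : Y ⟶ Z} (h : IsSES i p)
    (r : Y.obj.V →ₗ[R] X.obj.V) (hr : r ∘ₗ lin i = LinearMap.id) : IsSplitSES i p := by
  refine ⟨h, ?_⟩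
  obtain ⟨s, hs⟩ := exists_linear_descend (lin p) h.2.2 (LinearMap.id - lin i ∘ₗ r) (fun y hy => by
    obtain ⟨x, rfl⟩ := (h.2.1 y).1 hy
    have := LinearMap.congr_fun hr x
    simp only [LinearMap.comp_apply, LinearMap.id_apply] at this
    simp [this])
  refine ⟨s, LinearMap.ext fun z => ?_⟩
  obtain ⟨y, rfl⟩ := h.2.2 z
  have := LinearMap.congr_fun hs y
  simp only [LinearMap.comp_apply] at this ⊢
  simp [this, h.2.1.apply_apply_eq_zero]

/-- A relatively projective kernel of an `R`-split sequence has an equivariant retraction: if `r` is an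
`R`-linear retraction and the identity of the kernel is the trace of `θ`, take the trace of `θ r`. -/
theorem IsSplitSES.exists_retraction {X Y Z : FGRep R G} {i : X ⟶ Y} {p : Y ⟶ Z}
    (h : IsSplitSES i p) (hX : IsRelProj X) : ∃ r : Y ⟶ X, i ≫ r = 𝟙 X := by
  obtain ⟨r, hr⟩ := h.exists_linear_retraction
  obtain ⟨θ, hθ⟩ := hX
  refine ⟨trHom (θ ∘ₗ r), lin_injective ?_⟩
  rw [lin_comp, lin_trHom, tr_comp, LinearMap.comp_assoc, hr, LinearMap.comp_id, ← hθ, lin_id]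

theorem IsSplitSES.exists_section {X Y Z : FGRep R G} {i : X ⟶ Y} {p : Y ⟶ Z}
    (h : IsSplitSES i p) (hZ : IsRelProj Z) : ∃ s : Z ⟶ Y, s ≫ p = 𝟙 Z := by
  obtain ⟨s, hs⟩ := h.2
  obtain ⟨θ, hθ⟩ := hZ
  refine ⟨trHom (s ∘ₗ θ), lin_injective ?_⟩
  rw [lin_comp, lin_trHom, comp_tr, ← LinearMap.comp_assoc, hs, LinearMap.id_comp, ← hθ, lin_id]

theorem IsSES.exists_section_of_retraction {X Y Z : FGRep R G} {i : X ⟶ Y} {p : Y ⟶ Z}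
    (h : IsSES i p) (r : Y ⟶ X) (hr : i ≫ r = 𝟙 X) :
    ∃ s : Z ⟶ Y, s ≫ p = 𝟙 Z ∧ p ≫ s = 𝟙 Y - r ≫ i := by
  obtain ⟨s, hs⟩ := h.exists_desc (𝟙 Y - r ≫ i) (by
    rw [Preadditive.comp_sub, Category.comp_id, ← Category.assoc, hr, Category.id_comp, sub_self])
  refine ⟨s, cancel_surjective p h.2.2 ?_, hs⟩
  rw [← Category.assoc, hs, Preadditive.sub_comp, Category.assoc, h.comp_eq_zero]
  simp

theorem IsSES.exists_retraction_of_section {X Y Z : FGRep R G} {i : X ⟶ Y} {p : Y ⟶ Z}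
    (h : IsSES i p) (s : Z ⟶ Y) (hs : s ≫ p = 𝟙 Z) :
    ∃ r : Y ⟶ X, i ≫ r = 𝟙 X ∧ r ≫ i = 𝟙 Y - p ≫ s := by
  obtain ⟨r, hr⟩ := h.exists_lift (𝟙 Y - p ≫ s) (by
    rw [Preadditive.sub_comp, Category.id_comp, Category.assoc, hs, Category.comp_id, sub_self])
  refine ⟨r, cancel_injective i h.1 ?_, hr⟩
  rw [Category.assoc, hr, Preadditive.comp_sub, ← Category.assoc, h.comp_eq_zero]
  simp

namespace IsSplitSES

variable {X Y Z : FGRep R G} {i : X ⟶ Y} {p : Y ⟶ Z}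

theorem isRelProj₁ (h : IsSplitSES i p) (hY : IsRelProj Y) (hZ : IsRelProj Z) : IsRelProj X := by
  obtain ⟨s, hs⟩ := h.exists_section hZ
  obtain ⟨r, hr, -⟩ := h.1.exists_retraction_of_section s hs
  exact hY.retract i r hr

theorem isRelProj₃ (h : IsSplitSES i p) (hX : IsRelProj X) (hY : IsRelProj Y) : IsRelProj Z := by
  obtain ⟨r, hr⟩ := h.exists_retraction hX
  obtain ⟨s, hs, -⟩ := h.1.exists_section_of_retraction r hr
  exact hY.retract s p hs

theorem isRelProj₂ (h : IsSplitSES i p) (hX : IsRelProj X) (hZ : IsRelProj Z) : IsRelProj Y := by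
  obtain ⟨r, hr⟩ := h.exists_retraction hX
  obtain ⟨s, hs, hps⟩ := h.1.exists_section_of_retraction r hr
  obtain ⟨θ, hθ⟩ := hX.exists_tr_to r
  obtain ⟨η, hη⟩ := hZ.exists_tr_to p
  refine ⟨lin i ∘ₗ θ + lin s ∘ₗ η, ?_⟩
  rw [tr_add, ← comp_tr, ← comp_tr, ← hθ, ← hη, ← lin_comp, ← lin_comp, hps, ← lin_add]
  simp

end IsSplitSES

/-- The sequence `0 → M → RG ⊗_R M → ΣM → 0` splits over `R`: evaluation at `1` is a
retraction. -/
theorem isSplitSES_unit (M : FGRep R G) : IsSplitSES (unit M) (suspProj M) := by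
  have hr : (LinearMap.proj (1 : G) : (G → M.obj.V) →ₗ[R] M.obj.V) ∘ₗ lin (unit M)
      = LinearMap.id := by
    refine LinearMap.ext fun x => ?_
    change (lin (unit M) x : G → M.obj.V) 1 = x
    rw [unit_apply]; simp
  refine isSplitSES_of_retraction (i := unit M) (p := suspProj M) ⟨?_, ?_, suspProj_surjective M⟩
    (LinearMap.proj (1 : G)) hr
  · exact Function.LeftInverse.injective (g := (LinearMap.proj (1 : G) : (G → M.obj.V) →ₗ[R] M.obj.V))
      (LinearMap.congr_fun hr)
  · exact LinearMap.exact_map_mkQ_range (lin (unit M))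

/-! ### Morphisms in the stable category -/

variable {P : ObjectProperty (FGRep R G)} [TraceClass P]

instance toStable_additive : (toStable P).Additive := Quotient.functor_additive _ _

theorem stable_map_eq_iff {M N : FGRep R G} {f g : M ⟶ N} :
    (toStable P).map f = (toStable P).map g ↔
      ∃ θ : M.obj.V →ₗ[R] N.obj.V, lin f - lin g = tr θ := by
  rw [CategoryTheory.Quotient.functor_map_eq_iff, facRel_iff]

theorem stable_map_eq_zero_iff {M N : FGRep R G} {f : M ⟶ N} :
    (toStable P).map f = 0 ↔ ∃ θ : M.obj.V →ₗ[R] N.obj.V, lin f = tr θ := by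
  rw [← (toStable P).map_zero, stable_map_eq_iff]
  simp

theorem exists_rep {M N : FGRep R G} (f : (toStable P).obj M ⟶ (toStable P).obj N) :
    ∃ f₀ : M ⟶ N, (toStable P).map f₀ = f := (toStable P).map_surjective f

theorem stable_map_from_ind {L : Type u} [AddCommGroup L] [Module R L] [Module.Finite R L]
    {N : FGRep R G} (f : ind R G L ⟶ N) : (toStable P).map f = 0 :=
  stable_map_eq_zero_iff.2 (exists_tr_of_ind f)

theorem stable_map_eq_zero_exists {M N : FGRep R G} {f : M ⟶ N} (h : (toStable P).map f = 0) :
    ∃ m : ind R G M.obj.V ⟶ N, f = unit M ≫ m := by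
  obtain ⟨θ, hθ⟩ := stable_map_eq_zero_iff.1 h
  exact ⟨_, tr_factors f θ hθ⟩

theorem stable_map_trHom {M N : FGRep R G} (θ : M.obj.V →ₗ[R] N.obj.V) :
    (toStable P).map (trHom θ : M ⟶ N) = 0 := stable_map_eq_zero_iff.2 ⟨θ, rfl⟩

/-- Higman's criterion: the modules that vanish stably are the relatively projective ones. -/
theorem isZero_stable_iff {M : FGRep R G} :
    Limits.IsZero ((toStable P).obj M) ↔ IsRelProj M := by
  rw [Limits.IsZero.iff_id_eq_zero, ← (toStable P).map_id, stable_map_eq_zero_iff]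
  rfl

theorem isIso_of_isIso_comp {C : Type*} [Category* C] {X Y : C} (f : X ⟶ Y) (g : Y ⟶ X)
    (h₁ : IsIso (f ≫ g)) (h₂ : IsIso (g ≫ f)) : IsIso f := by
  have : IsSplitMono f := ⟨⟨⟨g ≫ inv (f ≫ g), by rw [← Category.assoc, IsIso.hom_inv_id]⟩⟩⟩
  have : Epi f := epi_of_epi g f
  exact isIso_of_epi_of_isSplitMono f

/-- The projection of an `R`-split sequence with relatively projective kernel is a stable
isomorphism. -/
theorem IsSplitSES.nonempty_iso {X Y Z : FGRep R G} {i : X ⟶ Y} {p : Y ⟶ Z}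
    (h : IsSplitSES i p) (hX : IsRelProj X) :
    Nonempty ((toStable P).obj Y ≅ (toStable P).obj Z) := by
  obtain ⟨r, hr⟩ := h.exists_retraction hX
  obtain ⟨s, hs, hps⟩ := h.1.exists_section_of_retraction r hr
  refine ⟨⟨(toStable P).map p, (toStable P).map s, ?_, ?_⟩⟩
  · obtain ⟨θ, hθ⟩ := hX.exists_tr_from i
    rw [← Functor.map_comp, hps, Functor.map_sub, Functor.map_comp,
      stable_map_eq_zero_iff.2 ⟨θ, hθ⟩]
    simp
  · rw [← CategoryTheory.Functor.map_comp, hs, CategoryTheory.Functor.map_id]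

end RelProj

/-! ### Triangles in stable categories -/

section Triangles

variable {R G : Type u} [CommRing R] [Group G] [Fintype G]

/-- An `R`-linear map `r : Y → L` induces `y ↦ ∑ g, g ⊗ r (g⁻¹ y)`. -/
def coindLift {L : Type u} [AddCommGroup L] [Module R L] [Module.Finite R L] {Y : FGRep R G}
    (r : Y.obj.V →ₗ[R] L) : Y ⟶ ind R G L :=
  mkHom (LinearMap.pi fun g => r ∘ₗ Y.obj.ρ g⁻¹) (by
    intro h x
    funext g
    change r (Y.obj.ρ g⁻¹ (Y.obj.ρ h x)) = r (Y.obj.ρ (h⁻¹ * g)⁻¹ x)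
    rw [← rho_mul]; simp)

theorem coindLift_apply {L : Type u} [AddCommGroup L] [Module R L] [Module.Finite R L]
    {Y : FGRep R G} (r : Y.obj.V →ₗ[R] L) (y : Y.obj.V) (g : G) :
    (lin (coindLift (G := G) r) y : G → L) g = r (Y.obj.ρ g⁻¹ y) := rfl

/-- A map into an induced module is determined by its component at `1`. -/
theorem apply_eq_apply_one {L : Type u} [AddCommGroup L] [Module R L] [Module.Finite R L]
    {Y : FGRep R G} (e : Y ⟶ ind R G L) (y : Y.obj.V) (g : G) :
    (lin e y : G → L) g = (lin e (Y.obj.ρ g⁻¹ y) : G → L) 1 := by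
  rw [lin_equivariant]
  change _ = (lin e y : G → L) ((g⁻¹)⁻¹ * 1)
  simp

/-- A linear retraction of `i : X → Y` gives an equivariant extension to `Y` of the embedding of `X`
in its induced module. -/
theorem comp_coindLift_of_retraction {X Y : FGRep R G} (i : X ⟶ Y)
    (r : Y.obj.V →ₗ[R] X.obj.V) (hr : r ∘ₗ lin i = LinearMap.id) :
    i ≫ coindLift r = unit X := by
  refine hom_ext' fun x => ?_
  funext g
  rw [lin_comp_apply, coindLift_apply, unit_apply, ← lin_equivariant]
  exact LinearMap.congr_fun hr _

/-- The map of induced modules given by a morphism. -/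
def indMap {M N : FGRep R G} (f : M ⟶ N) : ind R G M.obj.V ⟶ ind R G N.obj.V :=
  mkHom (M := ind R G M.obj.V) (N := ind R G N.obj.V)
    (LinearMap.pi fun g => lin f ∘ₗ LinearMap.proj g) (fun _ _ => rfl)

theorem unit_indMap {M N : FGRep R G} (f : M ⟶ N) : unit M ≫ indMap f = f ≫ unit N :=
  hom_ext' fun x => unit_natural f x

theorem suspProj_suspMap {M N : FGRep R G} (f : M ⟶ N) :
    suspProj M ≫ suspMap f = indMap f ≫ suspProj N := by
  refine hom_ext' fun a => ?_
  change suspLin (lin f) (lin (suspProj M) a) = _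
  rw [suspLin_mk, indTwist_lin]
  rfl

variable (P : ObjectProperty (FGRep R G)) [TraceClass P]

variable {P} in
/-- The stable class of a map into `ΣX`, as a morphism to the suspension of the class of `X`. -/
def toSusp {X Z : FGRep R G} (d : Z ⟶ suspObj X) :
    (toStable P).obj Z ⟶ (susp P).obj ((toStable P).obj X) := (toStable P).map d

variable {P} in
theorem map_comp_toSusp {X Z Z' : FGRep R G} (f : Z' ⟶ Z) (d : Z ⟶ suspObj X) :
    (toStable P).map f ≫ toSusp d = toSusp (f ≫ d) := ((toStable P).map_comp f d).symm

variable {P} in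
theorem toSusp_comp_map {X X' Z : FGRep R G} (d : Z ⟶ suspObj X) (f : X ⟶ X') :
    toSusp d ≫ (susp P).map ((toStable P).map f) = toSusp (d ≫ suspMap f) :=
  ((toStable P).map_comp d (suspMap f)).symm

/-- The triangulated structure given by the `R`-split sequences. -/
abbrev splitTri : TriData (Stable P) := triData P IsSplitSES

variable {P}

theorem stable_comp_ind {M N : FGRep R G} {L : Type u} [AddCommGroup L] [Module R L]
    [Module.Finite R L] (m : M ⟶ ind R G L) (n : ind R G L ⟶ N) :
    (toStable P).map (m ≫ n) = 0 := by
  rw [Functor.map_comp, stable_map_from_ind, Limits.comp_zero]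

theorem toSusp_eq_of_factors {X Z : FGRep R G} {L : Type u} [AddCommGroup L] [Module R L]
    [Module.Finite R L] {d d' : Z ⟶ suspObj X} {m : Z ⟶ ind R G L} {n : ind R G L ⟶ suspObj X}
    (h : d - d' = m ≫ n) : toSusp (P := P) d = toSusp d' := by
  refine (sub_eq_zero.1 ?_ : (toStable P).map d = (toStable P).map d')
  rw [← Functor.map_sub, h, stable_comp_ind]

section Standard

variable {X Y Z X₁ Y₁ Z₁ : FGRep R G} {i : X ⟶ Y} {p : Y ⟶ Z} {i₁ : X₁ ⟶ Y₁} {p₁ : Y₁ ⟶ Z₁}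

/-- The standard triangle of an `R`-split sequence is distinguished. -/
theorem dist_of_isSplitSES (h : IsSplitSES i p) {e : Y ⟶ ind R G X.obj.V} {d : Z ⟶ suspObj X}
    (he : i ≫ e = unit X) (hd : p ≫ d = e ≫ suspProj X) :
    (splitTri P).dist ((toStable P).map i) ((toStable P).map p) (toSusp d) := by
  refine ⟨X, Y, Z, i, p, h, e, d, he, hd, Iso.refl _, Iso.refl _, Iso.refl _, ?_, ?_, ?_⟩
  · simp
  · simp
  · rw [Iso.refl_hom, Iso.refl_hom, CategoryTheory.Functor.map_id]
    exact (Category.comp_id _).trans (Category.id_comp _).symm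

/-- Morphisms of two terms of standard triangles extend to the third term. -/
theorem exists_third (h : IsSplitSES i p) (h₁ : IsSplitSES i₁ p₁)
    {e : Y ⟶ ind R G X.obj.V} {d : Z ⟶ suspObj X}
    (he : i ≫ e = unit X) (hd : p ≫ d = e ≫ suspProj X)
    {e₁ : Y₁ ⟶ ind R G X₁.obj.V} {d₁ : Z₁ ⟶ suspObj X₁}
    (he₁ : i₁ ≫ e₁ = unit X₁) (hd₁ : p₁ ≫ d₁ = e₁ ≫ suspProj X₁)
    (α : (toStable P).obj X ⟶ (toStable P).obj X₁) (β : (toStable P).obj Y ⟶ (toStable P).obj Y₁)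
    (hαβ : (toStable P).map i ≫ β = α ≫ (toStable P).map i₁) :
    ∃ γ : (toStable P).obj Z ⟶ (toStable P).obj Z₁,
      (toStable P).map p ≫ γ = β ≫ (toStable P).map p₁ ∧
      toSusp d ≫ (susp P).map α = γ ≫ toSusp d₁ := by
  obtain ⟨α, rfl⟩ := exists_rep α
  obtain ⟨β, rfl⟩ := exists_rep β
  rw [← Functor.map_comp, ← Functor.map_comp, ← sub_eq_zero, ← Functor.map_sub] at hαβ
  obtain ⟨m, hm⟩ := stable_map_eq_zero_exists hαβ
  -- change `β` by a map through an induced module, so that the square commutes on the nose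
  have hβ : i ≫ (β - e ≫ m) = α ≫ i₁ := by
    rw [Preadditive.comp_sub, ← Category.assoc, he, ← hm]; abel
  have hβ' : (toStable P).map (β - e ≫ m) = (toStable P).map β := by
    rw [Functor.map_sub, stable_comp_ind, sub_zero]
  obtain ⟨γ, hγ⟩ := h.1.exists_desc ((β - e ≫ m) ≫ p₁) (by
    rw [← Category.assoc, hβ, Category.assoc, h₁.1.comp_eq_zero, Limits.comp_zero])
  obtain ⟨m', hm'⟩ := h.1.exists_desc (e ≫ indMap α - (β - e ≫ m) ≫ e₁) (by
    rw [Preadditive.comp_sub, ← Category.assoc, ← Category.assoc, he, hβ, unit_indMap,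
      Category.assoc, he₁, sub_self])
  refine ⟨(toStable P).map γ, ?_, ?_⟩
  · rw [← Functor.map_comp, hγ, Functor.map_comp, hβ']
  · have key : d ≫ suspMap α - γ ≫ d₁ = m' ≫ suspProj X₁ := by
      refine cancel_surjective p h.1.2.2 ?_
      rw [← Category.assoc p m', hm', Preadditive.comp_sub, ← Category.assoc, hd, Category.assoc,
        suspProj_suspMap, ← Category.assoc p, hγ, Category.assoc, hd₁]
      simp only [Preadditive.sub_comp, Category.assoc]
    rw [toSusp_comp_map, map_comp_toSusp]
    exact toSusp_eq_of_factors key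

/-- A map out of the third term of a standard triangle that vanishes on the second term factors
through the suspension of the first term. -/
theorem exists_factor_third (h : IsSplitSES i p)
    {e : Y ⟶ ind R G X.obj.V} {d : Z ⟶ suspObj X}
    (he : i ≫ e = unit X) (hd : p ≫ d = e ≫ suspProj X) {T : FGRep R G}
    (ε : (toStable P).obj Z ⟶ (toStable P).obj T) (hε : (toStable P).map p ≫ ε = 0) :
    ∃ u : (susp P).obj ((toStable P).obj X) ⟶ (toStable P).obj T, ε = toSusp d ≫ u := by
  obtain ⟨ε, rfl⟩ := exists_rep ε
  rw [← Functor.map_comp] at hε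
  obtain ⟨m, hm⟩ := stable_map_eq_zero_exists hε
  obtain ⟨u, hu⟩ := (isSplitSES_unit X).1.exists_desc (indMap i ≫ m) (by
    rw [← Category.assoc, unit_indMap, Category.assoc, ← hm, ← Category.assoc, h.1.comp_eq_zero,
      Limits.zero_comp])
  obtain ⟨n, hn⟩ := h.1.exists_desc (unit Y - e ≫ indMap i) (by
    rw [Preadditive.comp_sub, ← Category.assoc, he, unit_indMap, sub_self])
  refine ⟨(toStable P).map u, ?_⟩
  have key : ε - d ≫ u = n ≫ m := by
    refine cancel_surjective p h.1.2.2 ?_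
    rw [← Category.assoc p n, hn, Preadditive.comp_sub, hm, ← Category.assoc, hd, Category.assoc, hu,
      Preadditive.sub_comp, Category.assoc]
  refine (sub_eq_zero.1 ?_ : (toStable P).map ε = (toStable P).map (d ≫ u)).trans
    ((toStable P).map_comp d u)
  rw [← Functor.map_sub, key, stable_comp_ind]

/-- An endomorphism of a standard triangle that is the identity on the first two terms is
invertible on the third, as its difference from the identity has square zero. -/
theorem isIso_third (h : IsSplitSES i p)
    {e : Y ⟶ ind R G X.obj.V} {d : Z ⟶ suspObj X}
    (he : i ≫ e = unit X) (hd : p ≫ d = e ≫ suspProj X)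
    (φ : (toStable P).obj Z ⟶ (toStable P).obj Z)
    (h₁ : (toStable P).map p ≫ φ = (toStable P).map p)
    (h₂ : φ ≫ toSusp d = toSusp d) : IsIso φ := by
  obtain ⟨u, hu⟩ := exists_factor_third h he hd (φ - 𝟙 _) (by
    rw [Preadditive.comp_sub, h₁, Category.comp_id, sub_self])
  have h₃ : (φ - 𝟙 _) ≫ (φ - 𝟙 _) = 0 := by
    nth_rw 2 [hu]
    rw [← Category.assoc, Preadditive.sub_comp, h₂, Category.id_comp, sub_self,
      Limits.zero_comp]
  simp only [Preadditive.sub_comp, Preadditive.comp_sub, Category.comp_id, Category.id_comp] at h₃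
  have h₄ : φ ≫ φ = φ + φ - 𝟙 _ := by
    rw [← sub_eq_zero, ← h₃]; abel
  -- the inverse of `1 + ε` with `ε ^ 2 = 0` is `1 - ε`
  refine ⟨𝟙 _ + 𝟙 _ - φ, ?_, ?_⟩
  · simp only [Preadditive.comp_sub, Preadditive.comp_add, Category.comp_id, h₄]; abel
  · simp only [Preadditive.sub_comp, Preadditive.add_comp, Category.id_comp, h₄]; abel

/-- Isomorphisms of the first two terms of standard triangles extend to the third term. -/
theorem exists_iso_third (h : IsSplitSES i p) (h₁ : IsSplitSES i₁ p₁)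
    {e : Y ⟶ ind R G X.obj.V} {d : Z ⟶ suspObj X}
    (he : i ≫ e = unit X) (hd : p ≫ d = e ≫ suspProj X)
    {e₁ : Y₁ ⟶ ind R G X₁.obj.V} {d₁ : Z₁ ⟶ suspObj X₁}
    (he₁ : i₁ ≫ e₁ = unit X₁) (hd₁ : p₁ ≫ d₁ = e₁ ≫ suspProj X₁)
    (α : (toStable P).obj X ≅ (toStable P).obj X₁) (β : (toStable P).obj Y ≅ (toStable P).obj Y₁)
    (hαβ : (toStable P).map i ≫ β.hom = α.hom ≫ (toStable P).map i₁) :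
    ∃ γ : (toStable P).obj Z ≅ (toStable P).obj Z₁,
      (toStable P).map p ≫ γ.hom = β.hom ≫ (toStable P).map p₁ ∧
      toSusp d ≫ (susp P).map α.hom = γ.hom ≫ toSusp d₁ := by
  obtain ⟨γ, hγ, hγ'⟩ := exists_third h h₁ he hd he₁ hd₁ α.hom β.hom hαβ
  obtain ⟨δ, hδ, hδ'⟩ := exists_third h₁ h he₁ hd₁ he hd α.inv β.inv (by
    rw [← cancel_epi α.hom, ← cancel_mono β.hom]
    simp [hαβ])
  have e₂ := isIso_third h he hd (γ ≫ δ) (by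
      rw [← Category.assoc, hγ, Category.assoc, hδ, Iso.hom_inv_id_assoc]) (by
      rw [Category.assoc, ← hδ', ← Category.assoc, ← hγ', Category.assoc, ← Functor.map_comp,
        Iso.hom_inv_id, CategoryTheory.Functor.map_id]
      exact Category.comp_id _)
  have e₃ := isIso_third h₁ he₁ hd₁ (δ ≫ γ) (by
      rw [← Category.assoc, hδ, Category.assoc, hγ, Iso.inv_hom_id_assoc]) (by
      rw [Category.assoc, ← hγ', ← Category.assoc, ← hδ', Category.assoc, ← Functor.map_comp,
        Iso.inv_hom_id, CategoryTheory.Functor.map_id]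
      exact Category.comp_id _)
  have := isIso_of_isIso_comp γ δ e₂ e₃
  exact ⟨asIso γ, hγ, hγ'⟩

/-- The third term of an `R`-split sequence with relatively projective middle term is the
suspension of the first term. -/
theorem nonempty_iso_susp (h : IsSplitSES i p) (hY : IsRelProj Y) :
    Nonempty ((toStable P).obj Z ≅ (susp P).obj ((toStable P).obj X)) := by
  obtain ⟨r, hr⟩ := h.exists_linear_retraction
  have he := comp_coindLift_of_retraction i r hr
  obtain ⟨d, hd⟩ := h.1.exists_desc (coindLift r ≫ suspProj X) (by
    rw [← Category.assoc, he, (isSplitSES_unit X).1.comp_eq_zero])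
  have z₁ : Limits.IsZero ((toStable P).obj Y) := isZero_stable_iff.2 hY
  have z₂ : Limits.IsZero ((toStable P).obj (ind R G X.obj.V)) :=
    isZero_stable_iff.2 (isRelProj_ind _)
  obtain ⟨γ, -⟩ := exists_iso_third h (isSplitSES_unit X) he hd (e₁ := 𝟙 _) (d₁ := 𝟙 _)
    (Category.comp_id _) (by rw [Category.comp_id, Category.id_comp]) (Iso.refl _) (z₁.iso z₂)
    (z₂.eq_of_tgt _ _)
  exact ⟨γ⟩

end Standard

theorem splitTri_dist_of_iso {A B C A' B' C' : Stable P} (a : A ≅ A') (b : B ≅ B') (c : C ≅ C')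
    {f : A ⟶ B} {g : B ⟶ C} {h : C ⟶ (susp P).obj A}
    {f' : A' ⟶ B'} {g' : B' ⟶ C'} {h' : C' ⟶ (susp P).obj A'}
    (hf : f ≫ b.hom = a.hom ≫ f') (hg : g ≫ c.hom = b.hom ≫ g')
    (hh : h ≫ (susp P).map a.hom = c.hom ≫ h')
    (hd : (splitTri P).dist f' g' h') : (splitTri P).dist f g h := by
  obtain ⟨X, Y, Z, i, p, hs, e, d, he, hd, a', b', c', h₁, h₂, h₃⟩ := hd
  refine ⟨X, Y, Z, i, p, hs, e, d, he, hd, a ≪≫ a', b ≪≫ b', c ≪≫ c', ?_, ?_, ?_⟩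
  rotate_left 2
  · change h' ≫ (susp P).map a'.hom = c'.hom ≫ toSusp d at h₃
    change _ = _ ≫ toSusp d
    rw [Iso.trans_hom, Iso.trans_hom, Functor.map_comp, ← Category.assoc, hh, Category.assoc, h₃,
      Category.assoc]
  · simp [reassoc_of% hf, h₁]
  · simp [reassoc_of% hg, h₂]

/-- Every morphism is the first morphism of a distinguished triangle. -/
theorem splitTri_exists_dist {A B : Stable P} (f : A ⟶ B) :
    ∃ (C : Stable P) (g : B ⟶ C) (h : C ⟶ (susp P).obj A), (splitTri P).dist f g h := by
  obtain ⟨M⟩ := A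
  obtain ⟨N⟩ := B
  obtain ⟨f, rfl⟩ := exists_rep f
  have hr : (LinearMap.proj (1 : G) ∘ₗ LinearMap.fst R (G → M.obj.V) N.obj.V) ∘ₗ
      lin (prodLift (unit M) f) = LinearMap.id := by
    refine LinearMap.ext fun x => ?_
    change (lin (unit M) x : G → M.obj.V) 1 = x
    rw [unit_apply]; simp
  have hinj : Function.Injective (lin (prodLift (unit M) f)) := fun x y hxy => by
    have := congrArg (LinearMap.proj (1 : G) ∘ₗ LinearMap.fst R (G → M.obj.V) N.obj.V) hxy
    rw [← LinearMap.comp_apply, ← LinearMap.comp_apply, hr] at this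
    exact this
  -- replace `f : M → N` by the `R`-split injection of `M` in `RG ⊗ M ⊕ N`
  have hs := isSplitSES_of_retraction (isSES_coker (prodLift (unit M) f) hinj) _ hr
  obtain ⟨d, hd⟩ := hs.1.exists_desc (prodFst (ind R G M.obj.V) N ≫ suspProj M) (by
    change (prodLift (unit M) f ≫ prodFst (ind R G M.obj.V) N) ≫ suspProj M = 0
    exact (isSplitSES_unit M).1.comp_eq_zero)
  have z : (toStable P).map (prodFst (ind R G M.obj.V) N ≫ prodInl (ind R G M.obj.V) N) = 0 :=
    stable_comp_ind _ _
  have hsum : prodFst (ind R G M.obj.V) N ≫ prodInl (ind R G M.obj.V) N +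
      prodSnd (ind R G M.obj.V) N ≫ prodInr (ind R G M.obj.V) N = 𝟙 _ :=
    hom_ext' fun x => Prod.ext (add_zero _) (zero_add _)
  let b : (toStable P).obj N ≅ (toStable P).obj (prodObj (ind R G M.obj.V) N) :=
    { hom := (toStable P).map (prodInr _ _)
      inv := (toStable P).map (prodSnd _ _)
      hom_inv_id := by
        rw [← Functor.map_comp, ← CategoryTheory.Functor.map_id]; rfl
      inv_hom_id := by
        rw [← Functor.map_comp, ← CategoryTheory.Functor.map_id, ← hsum, Functor.map_add, z,
          zero_add] }
  refine ⟨_, b.hom ≫ (toStable P).map (cokerProj (prodLift (unit M) f)), toSusp d, ?_⟩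
  refine splitTri_dist_of_iso (Iso.refl _) b (Iso.refl _) ?_ ?_ ?_
    (dist_of_isSplitSES hs (e := prodFst _ _) rfl hd)
  · rw [Iso.refl_hom, Category.id_comp, ← Functor.map_comp, ← sub_eq_zero, ← Functor.map_sub]
    have : f ≫ prodInr (ind R G M.obj.V) N - prodLift (unit M) f =
        unit M ≫ (-prodInl (ind R G M.obj.V) N) := by
      refine hom_ext' fun x => Prod.ext ?_ ?_
      · exact zero_sub _
      · exact (sub_self _).trans neg_zero.symm
    rw [this, stable_comp_ind]
  · simp
  · rw [Iso.refl_hom, Iso.refl_hom, CategoryTheory.Functor.map_id]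
    exact (Category.comp_id _).trans (Category.id_comp _).symm

/-- Two distinguished triangles with the same first morphism are isomorphic. -/
theorem splitTri_unique {A B C C' : Stable P} {f : A ⟶ B} {g : B ⟶ C} {h : C ⟶ (susp P).obj A}
    {g' : B ⟶ C'} {h' : C' ⟶ (susp P).obj A} (hd : (splitTri P).dist f g h)
    (hd' : (splitTri P).dist f g' h') :
    ∃ c : C ≅ C', g ≫ c.hom = g' ∧ h = c.hom ≫ h' := by
  obtain ⟨X, Y, Z, i, p, hs, e, d, he, hd, a, b, c, h₁, h₂, h₃⟩ := hd
  obtain ⟨X', Y', Z', i', p', hs', e', d', he', hd', a', b', c', h₁', h₂', h₃'⟩ := hd'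
  change h ≫ (susp P).map a.hom = c.hom ≫ toSusp d at h₃
  change h' ≫ (susp P).map a'.hom = c'.hom ≫ toSusp d' at h₃'
  obtain ⟨γ, hγ, hγ'⟩ := exists_iso_third hs hs' he hd he' hd' (a.symm ≪≫ a') (b.symm ≪≫ b') (by
    simp only [Iso.trans_hom, Iso.symm_hom, Category.assoc]
    rw [← cancel_epi a.hom, ← h₁', ← Category.assoc, ← h₁]
    simp)
  refine ⟨c ≪≫ γ ≪≫ c'.symm, ?_, ?_⟩
  · rw [← cancel_mono c'.hom, h₂']
    simp [reassoc_of% h₂, hγ]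
  · simp only [Iso.trans_hom, Iso.symm_hom, Category.assoc] at hγ' ⊢
    rw [← cancel_mono ((susp P).map a'.hom)]
    simp only [Category.assoc, h₃', Iso.inv_hom_id_assoc]
    rw [← hγ', ← Category.assoc, ← h₃, Category.assoc, ← Functor.map_comp, Iso.hom_inv_id_assoc]

end Triangles

/-! ### Triangle equivalences -/

section Abstract

/-- A fully faithful functor that preserves distinguished triangles reflects them, if every
morphism completes to a triangle in the source and the third object of a triangle in the target is
determined by the first morphism. -/
theorem dist_reflects {C D : Type*} [Category* C] [Category* D] (S : TriData C) (T : TriData D)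
    (F : C ⥤ D) [F.Full] [F.Faithful] (comm : S.susp ⋙ F ≅ F ⋙ T.susp)
    (hF : ∀ {X Y Z : C} {f : X ⟶ Y} {g : Y ⟶ Z} {h : Z ⟶ S.susp.obj X}, S.dist f g h →
      T.dist (F.map f) (F.map g) (F.map h ≫ comm.hom.app X))
    (hS : ∀ {X Y : C} (f : X ⟶ Y), ∃ (Z : C) (g : Y ⟶ Z) (h : Z ⟶ S.susp.obj X), S.dist f g h)
    (hS' : ∀ {X Y Z Z' : C} {f : X ⟶ Y} {g : Y ⟶ Z} {h : Z ⟶ S.susp.obj X} (c : Z' ≅ Z)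
      {g' : Y ⟶ Z'} {h' : Z' ⟶ S.susp.obj X},
      g' ≫ c.hom = g → h' = c.hom ≫ h → S.dist f g h → S.dist f g' h')
    (hT : ∀ {X Y Z Z' : D} {f : X ⟶ Y} {g : Y ⟶ Z} {h : Z ⟶ T.susp.obj X}
      {g' : Y ⟶ Z'} {h' : Z' ⟶ T.susp.obj X}, T.dist f g h → T.dist f g' h' →
      ∃ c : Z ≅ Z', g ≫ c.hom = g' ∧ h = c.hom ≫ h')
    {X Y Z : C} (f : X ⟶ Y) (g : Y ⟶ Z) (h : Z ⟶ S.susp.obj X)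
    (hd : T.dist (F.map f) (F.map g) (F.map h ≫ comm.hom.app X)) : S.dist f g h := by
  obtain ⟨Z', g', h', hd'⟩ := hS f
  obtain ⟨c, hc, hc'⟩ := hT hd (hF hd')
  refine hS' (F.preimageIso c) (F.map_injective ?_) (F.map_injective ?_) hd'
  · rw [F.map_comp, F.preimageIso_hom, F.map_preimage, hc]
  · rw [F.map_comp, F.preimageIso_hom, F.map_preimage, ← cancel_mono (comm.hom.app X), hc',
      Category.assoc]

/-- A fully faithful functor that commutes with the suspensions, and preserves and reflects the
distinguished triangles, is an equivalence of triangulated categories onto its essential image. -/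
theorem exists_triEquiv {C D : Type*} [Category* C] [Category* D] [Preadditive C] [Preadditive D]
    (S : TriData C) (T : TriData D) (Q : ObjectProperty D) (hQ : ∀ X, Q X → Q (T.susp.obj X))
    (F : C ⥤ D) [F.Full] [F.Faithful] [F.Additive] (comm : S.susp ⋙ F ≅ F ⋙ T.susp)
    (hF : ∀ {X Y Z : C} (f : X ⟶ Y) (g : Y ⟶ Z) (h : Z ⟶ S.susp.obj X), S.dist f g h ↔
      T.dist (F.map f) (F.map g) (F.map h ≫ comm.hom.app X))
    (h₁ : ∀ X, Q (F.obj X)) (h₂ : ∀ Y, Q Y → ∃ X, Nonempty (F.obj X ≅ Y)) :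
    ∃ E : TriEquiv S (T.restrict Q hQ), Nonempty (E.equiv.functor ⋙ Q.ι ≅ F) := by
  have : (Q.lift F h₁).EssSurj := ⟨fun Y => by
    obtain ⟨X, ⟨e⟩⟩ := h₂ Y.obj Y.property
    exact ⟨X, ⟨Q.isoMk e⟩⟩⟩
  have : (Q.lift F h₁).IsEquivalence := { }
  refine ⟨{ equiv := (Q.lift F h₁).asEquivalence
            additive := ⟨fun {X Y f g} => ?_⟩
            comm := NatIso.ofComponents (fun X => Q.isoMk (comm.app X)) ?_
            dist_iff := fun f g h => hF f g h }, ⟨Iso.refl _⟩⟩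
  · apply ObjectProperty.hom_ext
    exact F.map_add
  · intro X Y f
    apply ObjectProperty.hom_ext
    exact comm.hom.naturality f

end Abstract

/-! ### The syzygy functor is triangulated -/

section Preserve

/-- A functor that commutes with the suspensions preserves distinguished triangles if it does so for
those that come from `R`-split sequences. -/
theorem preserves_dist_of_standard {R G R' G' : Type u} [CommRing R] [Group G] [Fintype G]
    [CommRing R'] [Group G'] [Fintype G'] {P : ObjectProperty (FGRep R G)} [TraceClass P]
    {P' : ObjectProperty (FGRep R' G')} [TraceClass P'] (F : Stable P ⥤ Stable P')
    (comm : susp P ⋙ F ≅ F ⋙ susp P')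
    (hF : ∀ {X Y Z : FGRep R G} {i : X ⟶ Y} {p : Y ⟶ Z} {e : Y ⟶ ind R G X.obj.V}
      {d : Z ⟶ suspObj X}, IsSplitSES i p → i ≫ e = unit X → p ≫ d = e ≫ suspProj X →
      (splitTri P').dist (F.map ((toStable P).map i)) (F.map ((toStable P).map p))
        (F.map (toSusp d) ≫ comm.hom.app _))
    {A B C : Stable P} {f : A ⟶ B} {g : B ⟶ C} {h : C ⟶ (susp P).obj A}
    (hd : (splitTri P).dist f g h) :
    (splitTri P').dist (F.map f) (F.map g) (F.map h ≫ comm.hom.app A) := by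
  obtain ⟨X, Y, Z, i, p, hs, e, d, he, hd, a, b, c, h₁, h₂, h₃⟩ := hd
  change h ≫ (susp P).map a.hom = c.hom ≫ toSusp d at h₃
  refine splitTri_dist_of_iso (F.mapIso a) (F.mapIso b) (F.mapIso c) ?_ ?_ ?_ (hF hs he hd)
  · rw [Functor.mapIso_hom, Functor.mapIso_hom, ← Functor.map_comp, ← Functor.map_comp, h₁]
  · rw [Functor.mapIso_hom, Functor.mapIso_hom, ← Functor.map_comp, ← Functor.map_comp, h₂]
  · have := comm.hom.naturality a.hom
    rw [Functor.comp_map, Functor.comp_map] at this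
    have key : (F.map h ≫ comm.hom.app A) ≫ (susp P').map (F.map a.hom) =
        F.map c.hom ≫ F.map (toSusp d) ≫ comm.hom.app _ := by
      rw [Category.assoc, ← this, ← Functor.map_comp_assoc, h₃, Functor.map_comp, Category.assoc]
    exact key

end Preserve

section Columns

variable {R G : Type u} [CommRing R] [Group G] [Fintype G]

/-- Projectivity over `RG`, as projectivity over `R` together with relative projectivity. -/
def IsProj (F : FGRep R G) : Prop := Module.Projective R F.obj.V ∧ IsRelProj F

theorem projective_fun (L : Type u) [AddCommGroup L] [Module R L] [Module.Projective R L] :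
    Module.Projective R (G → L) := by
  classical
  exact Module.Projective.of_equiv' (DFinsupp.linearEquivFunOnFintype (R := R) (M := fun _ : G => L))

theorem isProj_ind (L : Type u) [AddCommGroup L] [Module R L] [Module.Finite R L]
    [Module.Projective R L] : IsProj (ind R G L) :=
  ⟨projective_fun L, isRelProj_ind L⟩

theorem IsProj.prod {M N : FGRep R G} (hM : IsProj M) (hN : IsProj N) : IsProj (prodObj M N) := by
  have := hM.1
  have := hN.1
  exact ⟨inferInstanceAs (Module.Projective R (M.obj.V × N.obj.V)), hM.2.prod hN.2⟩

theorem IsProj.exists_lift {F E M : FGRep R G} (hF : IsProj F) (e : E ⟶ M)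
    (he : Function.Surjective (lin e)) (f : F ⟶ M) : ∃ l : F ⟶ E, l ≫ e = f := by
  have := hF.1
  obtain ⟨θ, hθ⟩ := hF.2.exists_tr_from f
  obtain ⟨l, hl⟩ := Module.projective_lifting_property (lin e) θ he
  exact ⟨trHom l, lin_injective (by rw [lin_comp, lin_trHom, comp_tr, hl, hθ])⟩

variable {P : ObjectProperty (FGRep R G)} [TraceClass P]

/-- Two maps of short exact sequences with relatively projective middle term in the source agree
stably on the kernels if they agree on the quotients. -/
theorem stable_eq_of_lifts {Y F Y' F' X' : FGRep R G} {j : Y ⟶ F} {j' : Y' ⟶ F'}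
    {q' : F' ⟶ X'} (hF : IsRelProj F) (h' : IsSES j' q') {y₁ y₂ : Y ⟶ Y'}
    (l₁ l₂ : F ⟶ F') (h₁ : y₁ ≫ j' = j ≫ l₁) (h₂ : y₂ ≫ j' = j ≫ l₂) (hl : l₁ ≫ q' = l₂ ≫ q') :
    (toStable P).map y₁ = (toStable P).map y₂ := by
  obtain ⟨δ, hδ⟩ := h'.exists_lift (l₁ - l₂) (by rw [Preadditive.sub_comp, hl, sub_self])
  have key : y₁ - y₂ = j ≫ δ := by
    refine cancel_injective j' h'.1 ?_
    rw [Preadditive.sub_comp, h₁, h₂, Category.assoc, hδ, Preadditive.comp_sub]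
  rw [← sub_eq_zero, ← Functor.map_sub, key, Functor.map_comp,
    stable_map_eq_zero_iff.2 (hF.exists_tr_from δ), Limits.comp_zero]

/-- Schanuel's lemma: the kernels of two projective presentations are stably isomorphic. -/
theorem exists_schanuel {Y F X Y' F' : FGRep R G} {j : Y ⟶ F} {q : F ⟶ X} {j' : Y' ⟶ F'}
    {q' : F' ⟶ X} (h : IsSES j q) (hF : IsProj F) (h' : IsSES j' q') (hF' : IsProj F') :
    ∃ (c : Y ⟶ Y') (l : F ⟶ F'), l ≫ q' = q ∧ c ≫ j' = j ≫ l ∧ IsIso ((toStable P).map c) := by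
  obtain ⟨l, hl⟩ := hF.exists_lift q' h'.2.2 q
  obtain ⟨l', hl'⟩ := hF'.exists_lift q h.2.2 q'
  obtain ⟨c, hc⟩ := h'.exists_lift (j ≫ l) (by rw [Category.assoc, hl, h.comp_eq_zero])
  obtain ⟨c', hc'⟩ := h.exists_lift (j' ≫ l') (by rw [Category.assoc, hl', h'.comp_eq_zero])
  refine ⟨c, l, hl, hc, (toStable P).map c', ?_, ?_⟩
  · rw [← Functor.map_comp, ← CategoryTheory.Functor.map_id]
    refine stable_eq_of_lifts (j := j) hF.2 h (l ≫ l') (𝟙 F) ?_ ?_ ?_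
    · rw [Category.assoc, hc', ← Category.assoc, hc, Category.assoc]
    · rw [Category.id_comp, Category.comp_id]
    · rw [Category.assoc, hl', hl, Category.id_comp]
  · rw [← Functor.map_comp, ← CategoryTheory.Functor.map_id]
    refine stable_eq_of_lifts (j := j') hF'.2 h' (l' ≫ l) (𝟙 F') ?_ ?_ ?_
    · rw [Category.assoc, hc, ← Category.assoc, hc', Category.assoc]
    · rw [Category.id_comp, Category.comp_id]
    · rw [Category.assoc, hl, hl', Category.id_comp]

/-- The suspension is exact on all short exact sequences, not only on the `R`-split ones. -/
theorem isSES_suspMap {Y F X : FGRep R G} {j : Y ⟶ F} {q : F ⟶ X} (h : IsSES j q) :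
    IsSES (suspMap j) (suspMap q) := by
  have hj : ∀ a, lin (suspMap j) (lin (suspProj Y) a) = lin (suspProj F) (lin (indMap j) a) :=
    hom_congr (suspProj_suspMap j)
  have hq : ∀ a, lin (suspMap q) (lin (suspProj F) a) = lin (suspProj X) (lin (indMap q) a) :=
    hom_congr (suspProj_suspMap q)
  refine ⟨?_, ?_, ?_⟩
  · refine (injective_iff_map_eq_zero _).2 fun w hw => ?_
    obtain ⟨a, rfl⟩ := suspProj_surjective Y w
    rw [hj] at hw
    obtain ⟨f, hf⟩ := ((isSplitSES_unit F).1.2.1 _).1 hw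
    have hf' : ∀ g, F.obj.ρ g⁻¹ f = lin j ((a : G → Y.obj.V) g) := fun g => congrFun hf g
    refine ((isSplitSES_unit Y).1.2.1 _).2 ⟨(a : G → Y.obj.V) 1, ?_⟩
    funext g
    refine h.1 ?_
    rw [unit_apply, lin_equivariant, ← hf', ← hf']
    simp
  · intro w
    obtain ⟨a, rfl⟩ := suspProj_surjective F w
    constructor
    · intro hw
      rw [hq] at hw
      obtain ⟨x, hx⟩ := ((isSplitSES_unit X).1.2.1 _).1 hw
      obtain ⟨f, rfl⟩ := h.2.2 x
      have hx' : ∀ g, X.obj.ρ g⁻¹ (lin q f) = lin q ((a : G → F.obj.V) g) := fun g => congrFun hx g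
      have : ∀ g, ∃ y, lin j y = (a : G → F.obj.V) g - F.obj.ρ g⁻¹ f := fun g => by
        refine (h.2.1 _).1 ?_
        rw [map_sub, lin_equivariant, hx', sub_self]
      choose b hb using this
      refine ⟨lin (suspProj Y) (b : G → Y.obj.V), ?_⟩
      rw [hj]
      have e₁ : lin (indMap j) (b : G → Y.obj.V) = a - lin (unit F) f := funext hb
      rw [e₁, map_sub, (isSplitSES_unit F).1.2.1.apply_apply_eq_zero, sub_zero]
    · rintro ⟨v, hv⟩
      obtain ⟨b, rfl⟩ := suspProj_surjective Y v
      rw [← hv, hj, hq]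
      have : lin (indMap q) (lin (indMap j) b) = 0 :=
        funext fun g => h.2.1.apply_apply_eq_zero _
      rw [this, map_zero]
  · intro w
    obtain ⟨a, rfl⟩ := suspProj_surjective X w
    choose b hb using fun g => h.2.2 ((a : G → X.obj.V) g)
    refine ⟨lin (suspProj F) (b : G → F.obj.V), ?_⟩
    rw [hq]
    congr 1
    exact funext hb

theorem IsProj.susp {F : FGRep R G} (hF : IsProj F) : IsProj (suspObj F) := by
  constructor
  · obtain ⟨s, hs⟩ := (isSplitSES_unit F).2
    have := hF.1
    have : Module.Projective R (ind R G F.obj.V).obj.V :=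
      projective_fun F.obj.V
    exact Module.Projective.of_split s _ hs
  · obtain ⟨θ, hθ⟩ := hF.2
    refine ⟨suspLin θ, ?_⟩
    rw [← suspLin_tr, ← hθ]
    exact (congrArg lin (suspMod.map_id F)).symm

end Columns

section SyzygyTriangulated

variable {R G : Type u} [CommRing R] [Group G] [Fintype G] [IsNoetherianRing R]

theorem isSES_syz (M : FGRep R G) : IsSES (syzIncl M) (cover M) :=
  ⟨syzIncl_injective M, LinearMap.exact_subtype_ker_map (lin (cover M)), cover_surjective M⟩

theorem isProj_cover (M : FGRep R G) : IsProj (coverObj M) := isProj_ind _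

theorem syzygy_map_map {M N : FGRep R G} (f : M ⟶ N) :
    (syzygy R G).map ((toStable _).map f) =
      (toStable _).map (syzMapOf f (coverMap f) (coverMap_comm f)) := rfl

/-- The syzygy functor on a morphism can be computed by any map of short exact sequences. -/
theorem syzygy_map_eq {M N : FGRep R G} (f : M ⟶ N) (y : syzObj M ⟶ syzObj N)
    (l : coverObj M ⟶ coverObj N) (hy : y ≫ syzIncl N = syzIncl M ≫ l)
    (hl : l ≫ cover N = cover M ≫ f) :
    (syzygy R G).map ((toStable _).map f) = (toStable _).map y :=
  stable_eq_of_lifts (isProj_cover M).2 (isSES_syz N) (coverMap f) l (syzMapOf_incl _ _ _) hy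
    (by rw [hl, coverMap_comm])

instance syzygy_additive : (syzygy R G).Additive where
  map_add {M N f g} := by
    obtain ⟨M⟩ := M
    obtain ⟨N⟩ := N
    obtain ⟨f, rfl⟩ := exists_rep f
    obtain ⟨g, rfl⟩ := exists_rep g
    rw [← Functor.map_add]
    refine (syzygy_map_eq (f + g) (syzMapOf f _ (coverMap_comm f) + syzMapOf g _ (coverMap_comm g))
      (coverMap f + coverMap g) ?_ ?_).trans ((toStable (weaklyProjective R G)).map_add)
    · rw [Preadditive.add_comp, syzMapOf_incl, syzMapOf_incl, Preadditive.comp_add]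
    · rw [Preadditive.add_comp, coverMap_comm, coverMap_comm, Preadditive.comp_add]

/-- The suspension of the cover of `M` is a projective presentation of `ΣM` with kernel `ΣΩM`, so
Schanuel's lemma compares `ΣΩM` with `ΩΣM`. -/
theorem exists_syzSusp (M : FGRep R G) :
    ∃ (c : suspObj (syzObj M) ⟶ syzObj (suspObj M)) (l : suspObj (coverObj M) ⟶ coverObj (suspObj M)),
      l ≫ cover (suspObj M) = suspMap (cover M) ∧
      c ≫ syzIncl (suspObj M) = suspMap (syzIncl M) ≫ l ∧
      IsIso ((toStable (weaklyProjective R G)).map c) :=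
  exists_schanuel (isSES_suspMap (isSES_syz M)) (isProj_cover M).susp (isSES_syz _) (isProj_cover _)

/-- The comparison `ΣΩM → ΩΣM`, obtained from the suspension of `0 → ΩM → F → M → 0`. -/
def syzSusp (M : FGRep R G) : suspObj (syzObj M) ⟶ syzObj (suspObj M) := (exists_syzSusp M).choose

/-- The map of projective modules that induces `ΣΩM → ΩΣM`. -/
def coverSusp (M : FGRep R G) : suspObj (coverObj M) ⟶ coverObj (suspObj M) :=
  (exists_syzSusp M).choose_spec.choose

theorem coverSusp_cover (M : FGRep R G) : coverSusp M ≫ cover (suspObj M) = suspMap (cover M) :=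
  (exists_syzSusp M).choose_spec.choose_spec.1

theorem syzSusp_incl (M : FGRep R G) :
    syzSusp M ≫ syzIncl (suspObj M) = suspMap (syzIncl M) ≫ coverSusp M :=
  (exists_syzSusp M).choose_spec.choose_spec.2.1

instance (M : FGRep R G) : IsIso ((toStable (weaklyProjective R G)).map (syzSusp M)) :=
  (exists_syzSusp M).choose_spec.choose_spec.2.2

/-- The natural isomorphism `ΩΣ ≅ ΣΩ`. -/
def syzygyComm : susp (weaklyProjective R G) ⋙ syzygy R G ≅
    syzygy R G ⋙ susp (weaklyProjective R G) :=
  (NatIso.ofComponents (F := syzygy R G ⋙ susp (weaklyProjective R G))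
    (G := susp (weaklyProjective R G) ⋙ syzygy R G)
    (fun X => (asIso ((toStable (weaklyProjective R G)).map (syzSusp X.as)) :
      (toStable (weaklyProjective R G)).obj (suspObj (syzObj X.as)) ≅
        (toStable (weaklyProjective R G)).obj (syzObj (suspObj X.as)))) (by
      rintro ⟨M⟩ ⟨N⟩ f
      obtain ⟨f, rfl⟩ := exists_rep f
      change (toStable _).map (suspMap (syzMapOf f (coverMap f) (coverMap_comm f))) ≫
          (toStable _).map (syzSusp N) = (toStable _).map (syzSusp M) ≫
          (toStable _).map (syzMapOf (suspMap f) (coverMap (suspMap f)) (coverMap_comm _))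
      rw [← Functor.map_comp, ← Functor.map_comp]
      refine stable_eq_of_lifts (j := suspMap (syzIncl M)) (isProj_cover M).susp.2 (isSES_syz _)
        (suspMap (coverMap f) ≫ coverSusp N) (coverSusp M ≫ coverMap (suspMap f)) ?_ ?_ ?_
      · rw [Category.assoc, syzSusp_incl, ← Category.assoc, ← Category.assoc]
        congr 1
        change suspMod.map _ ≫ suspMod.map _ = suspMod.map _ ≫ suspMod.map _
        rw [← Functor.map_comp, ← Functor.map_comp, syzMapOf_incl]
      · rw [Category.assoc, syzMapOf_incl, ← Category.assoc, syzSusp_incl, Category.assoc]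
      · rw [Category.assoc, coverSusp_cover, Category.assoc, coverMap_comm, ← Category.assoc,
          coverSusp_cover]
        change suspMod.map _ ≫ suspMod.map _ = suspMod.map _ ≫ suspMod.map _
        rw [← Functor.map_comp, ← Functor.map_comp, coverMap_comm])).symm

theorem comp_inv_eq_id_comp {C : Type*} [Category* C] {X Y Y' : C} {f : X ⟶ Y} {c : Y' ⟶ Y} [IsIso c]
    {f' : X ⟶ Y'} (h : f = f' ≫ c) : f ≫ inv c = 𝟙 X ≫ f' := by simp [h]

theorem comp_id_eq_inv_comp {C : Type*} [Category* C] {Y Y' Z : C} {c : Y' ⟶ Y} [IsIso c]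
    {g : Y ⟶ Z} {g' : Y' ⟶ Z} (h : c ≫ g = g') : g ≫ 𝟙 Z = inv c ≫ g' := by simp [← h]

theorem comp_map_id_eq {C : Type*} [Category* C] (F : C ⥤ C) {X Z : C} {f f' : Z ⟶ F.obj X}
    (h : f = f') : f ≫ F.map (𝟙 X) = 𝟙 Z ≫ f' := by simp [h]

theorem comp_map_id_eq' {C : Type*} [Category* C] (F : C ⥤ C) {X Z : C} {f f' : Z ⟶ F.obj X}
    (h : f = f') : f ≫ F.map (𝟙 X) = f' := by simp [h]

/-- The isomorphism `ΩΣ ≅ ΣΩ` is inverse to the comparison map of `syzSusp`. -/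
theorem comp_syzygyComm_eq {M : FGRep R G} {A : StRel R G}
    {f : A ⟶ (syzygy R G).obj ((susp _).obj ((toStable _).obj M))}
    {g : A ⟶ (susp _).obj ((syzygy R G).obj ((toStable _).obj M))}
    (h : g ≫ (toStable (weaklyProjective R G)).map (syzSusp M) = f) :
    f ≫ syzygyComm.hom.app ((toStable _).obj M) = g := by
  subst h
  refine (Category.assoc _ _ _).trans ?_
  exact (congrArg (g ≫ ·) (asIso ((toStable (weaklyProjective R G)).map (syzSusp M)) :
    (toStable (weaklyProjective R G)).obj (suspObj (syzObj M)) ≅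
      (toStable (weaklyProjective R G)).obj (syzObj (suspObj M))).hom_inv_id).trans (Category.comp_id g)

/-- The horseshoe lemma, with a retraction compatible with a given retraction of the sequence that
is resolved. The triangle of the sequence of syzygies is the image of the given triangle. -/
theorem syzygy_standard {X Y Z : FGRep R G} {i : X ⟶ Y} {p : Y ⟶ Z} {e : Y ⟶ ind R G X.obj.V}
    {d : Z ⟶ suspObj X} (h : IsSplitSES i p) (he : i ≫ e = unit X)
    (hd : p ≫ d = e ≫ suspProj X) :
    (splitTri (weaklyProjective R G)).dist ((syzygy R G).map ((toStable _).map i))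
      ((syzygy R G).map ((toStable _).map p))
      ((syzygy R G).map (toSusp d) ≫ syzygyComm.hom.app _) := by
  obtain ⟨m, hm⟩ := (isProj_cover Z).exists_lift p h.1.2.2 (cover Z)
  -- the horseshoe: a projective presentation `q` of `Y` by the sum of the covers of `X` and `Z`
  let F := prodObj (coverObj X) (coverObj Z)
  let inl : coverObj X ⟶ F := prodInl _ _
  let fst : F ⟶ coverObj X := prodFst _ _
  let snd : F ⟶ coverObj Z := prodSnd _ _
  let q : F ⟶ Y := fst ≫ cover X ≫ i + snd ≫ m
  have hq_apply : ∀ w : F.obj.V, lin q w = lin i (lin (cover X) w.1) + lin m w.2 := fun _ => rfl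
  have hqp : q ≫ p = snd ≫ cover Z := by
    simp only [q, Preadditive.add_comp, Category.assoc, h.1.comp_eq_zero, hm, Limits.comp_zero,
      zero_add]
  have hq : Function.Surjective (lin q) := by
    intro y
    obtain ⟨b, hb⟩ := cover_surjective Z (lin p y)
    obtain ⟨x, hx⟩ := (h.1.2.1 (y - lin m b)).1 (by
      rw [map_sub, ← hb, ← hm]; exact sub_self _)
    obtain ⟨a, rfl⟩ := cover_surjective X x
    refine ⟨(a, b), ?_⟩
    rw [hq_apply, hx, sub_add_cancel]
  have hF : IsProj F := (isProj_cover X).prod (isProj_cover Z)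
  have hK := isSES_ker q hq
  obtain ⟨i', hi'⟩ := hK.exists_lift (syzIncl X ≫ inl) (by
    refine hom_ext' fun x => ?_
    change lin i (lin (cover X) (lin (syzIncl X) x)) + lin m 0 = 0
    rw [(isSES_syz X).2.1.apply_apply_eq_zero, map_zero, map_zero, add_zero])
  obtain ⟨p', hp'⟩ := (isSES_syz Z).exists_lift (kerIncl q ≫ snd) (by
    rw [Category.assoc, ← hqp, ← Category.assoc, hK.comp_eq_zero, Limits.zero_comp])
  have hi'_apply : ∀ x, lin (kerIncl q) (lin i' x) = (lin (syzIncl X) x, 0) := hom_congr hi'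
  have hp'_apply : ∀ w, lin (syzIncl Z) (lin p' w) = (lin (kerIncl q) w).2 := hom_congr hp'
  have h' : IsSES i' p' := by
    refine ⟨?_, ?_, ?_⟩
    · intro x y hxy
      refine syzIncl_injective X ?_
      have := hi'_apply x
      rw [hxy, hi'_apply] at this
      exact (congrArg Prod.fst this).symm
    · intro w
      constructor
      · intro hw
        have h0 : (lin (kerIncl q) w).2 = 0 := by rw [← hp'_apply, hw, map_zero]
        have h1 : lin q (lin (kerIncl q) w) = 0 := hK.2.1.apply_apply_eq_zero w
        rw [hq_apply, h0, map_zero, add_zero, ← map_zero (lin i)] at h1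
        obtain ⟨x, hx⟩ := ((isSES_syz X).2.1 _).1 (h.1.1 h1)
        refine ⟨x, hK.1 ?_⟩
        rw [hi'_apply]
        exact Prod.ext hx h0.symm
      · rintro ⟨x, rfl⟩
        refine syzIncl_injective Z ?_
        rw [hp'_apply, hi'_apply, map_zero]
    · intro z
      have h0 : lin p (lin m (lin (syzIncl Z) z)) = 0 :=
        (hom_congr hm _).trans ((isSES_syz Z).2.1.apply_apply_eq_zero z)
      obtain ⟨x, hx⟩ := (h.1.2.1 _).1 h0
      obtain ⟨a, rfl⟩ := cover_surjective X x
      obtain ⟨w, hw⟩ := (hK.2.1 ((-a, lin (syzIncl Z) z) : F.obj.V)).1 (by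
        rw [hq_apply, map_neg, map_neg, hx]
        exact neg_add_cancel _)
      refine ⟨w, syzIncl_injective Z ?_⟩
      rw [hp'_apply, hw]
  -- a retraction of the middle row that lifts the retraction `y ↦ e y 1` of the bottom row
  let r : Y.obj.V →ₗ[R] X.obj.V := LinearMap.proj (1 : G) ∘ₗ lin e
  have hr : ∀ x, r (lin i x) = x := fun x => by
    have := congrFun (hom_congr he x) (1 : G)
    refine this.trans ?_
    rw [unit_apply]; simp
  have hre : ∀ y (g : G), r (Y.obj.ρ g⁻¹ y) = (lin e y : G → X.obj.V) g := fun y g =>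
    (apply_eq_apply_one e y g).symm
  have := (isProj_cover Z).1
  obtain ⟨s, hs⟩ := Module.projective_lifting_property (lin (cover X)) (r ∘ₗ lin m)
    (cover_surjective X)
  let rF : F.obj.V →ₗ[R] (coverObj X).obj.V := LinearMap.fst R _ _ + s ∘ₗ LinearMap.snd R _ _
  have hrF : ∀ w, lin (cover X) (rF w) = r (lin q w) := fun w => by
    change lin (cover X) (w.1 + s w.2) = _
    rw [hq_apply, map_add, map_add, hr]
    exact congrArg _ (LinearMap.congr_fun hs w.2)
  have hrF_inl : rF ∘ₗ lin inl = LinearMap.id := by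
    refine LinearMap.ext fun a => ?_
    change a + s 0 = a
    rw [map_zero, add_zero]
  obtain ⟨r', hr'⟩ := exists_linear_corestrict (lin (syzIncl X)) (syzIncl_injective X)
    (rF ∘ₗ lin (kerIncl q)) (fun w => ((isSES_syz X).2.1 _).1 (by
      rw [LinearMap.comp_apply, hrF, hK.2.1.apply_apply_eq_zero, map_zero]))
  have hr'_apply : ∀ w, lin (syzIncl X) (r' w) = rF (lin (kerIncl q) w) := LinearMap.congr_fun hr'
  have hr'i' : r' ∘ₗ lin i' = LinearMap.id := by
    refine LinearMap.ext fun x => syzIncl_injective X ?_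
    rw [LinearMap.comp_apply, hr'_apply, hi'_apply]
    exact LinearMap.congr_fun hrF_inl _
  -- the connecting maps of the three rows, and the squares between them
  have he' := comp_coindLift_of_retraction i' r' hr'i'
  obtain ⟨d', hd'⟩ := h'.exists_desc (coindLift r' ≫ suspProj _) (by
    rw [← Category.assoc, he', (isSplitSES_unit _).1.comp_eq_zero])
  have heF := comp_coindLift_of_retraction inl rF hrF_inl
  have hprod : IsSES inl snd := by
    refine ⟨fun a b hab => congrArg Prod.fst hab, fun w => ⟨fun hw => ⟨w.1, ?_⟩, ?_⟩,
      fun b => ⟨(0, b), rfl⟩⟩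
    · exact Prod.ext rfl hw.symm
    · rintro ⟨a, rfl⟩; rfl
  obtain ⟨dF, hdF⟩ := hprod.exists_desc (coindLift rF ≫ suspProj _) (by
    rw [← Category.assoc, heF, (isSplitSES_unit _).1.comp_eq_zero])
  have sq₁ : coindLift rF ≫ indMap (cover X) = q ≫ e := by
    refine hom_ext' fun w => funext fun g => ?_
    change lin (cover X) (rF (F.obj.ρ g⁻¹ w)) = (lin e (lin q w) : G → X.obj.V) g
    rw [hrF, lin_equivariant, hre]
  have sq₂ : coindLift r' ≫ indMap (syzIncl X) = kerIncl q ≫ coindLift rF := by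
    refine hom_ext' fun w => funext fun g => ?_
    change lin (syzIncl X) (r' ((kerObj q).obj.ρ g⁻¹ w)) = rF (F.obj.ρ g⁻¹ (lin (kerIncl q) w))
    rw [hr'_apply, lin_equivariant]
  have c₁ : dF ≫ suspMap (cover X) = cover Z ≫ d := by
    refine cancel_surjective snd hprod.2.2 ?_
    rw [← Category.assoc, hdF, Category.assoc, suspProj_suspMap, ← Category.assoc, sq₁,
      Category.assoc, ← hd, ← Category.assoc, hqp, Category.assoc]
  have c₂ : d' ≫ suspMap (syzIncl X) = syzIncl Z ≫ dF := by
    refine cancel_surjective p' h'.2.2 ?_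
    rw [← Category.assoc, hd', Category.assoc, suspProj_suspMap, ← Category.assoc, sq₂,
      ← Category.assoc p', hp', Category.assoc, Category.assoc, hdF]
  obtain ⟨c, l, hl, hc, hiso⟩ := exists_schanuel (P := weaklyProjective R G) hK hF (isSES_syz Y)
    (isProj_cover Y)
  refine splitTri_dist_of_iso (Iso.refl _) (asIso ((toStable _).map c)).symm (Iso.refl _) ?_ ?_ ?_
    (dist_of_isSplitSES (isSplitSES_of_retraction h' r' hr'i') he' hd')
  · have : (syzygy R G).map ((toStable _).map i) = (toStable _).map i' ≫ (toStable _).map c := by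
      rw [← Functor.map_comp]
      refine syzygy_map_eq i _ (inl ≫ l) ?_ ?_
      · rw [Category.assoc, hc, ← Category.assoc, hi', Category.assoc]
      · rw [Category.assoc, hl]
        refine hom_ext' fun a => ?_
        change lin i (lin (cover X) a) + lin m 0 = lin i (lin (cover X) a)
        rw [map_zero, add_zero]
    exact comp_inv_eq_id_comp this
  · have : (toStable _).map c ≫ (syzygy R G).map ((toStable _).map p) = (toStable _).map p' := by
      refine ((toStable _).map_comp c (syzMapOf p _ (coverMap_comm p))).symm.trans ?_
      refine stable_eq_of_lifts (j := kerIncl q) hF.2 (isSES_syz Z) (l ≫ coverMap p) snd ?_ hp' ?_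
      · rw [Category.assoc, syzMapOf_incl, ← Category.assoc, hc, Category.assoc]
      · rw [Category.assoc, coverMap_comm, ← Category.assoc, hl, hqp]
    exact comp_id_eq_inv_comp this
  · have : (syzygy R G).map (toSusp d) ≫ syzygyComm.hom.app _ = toSusp d' := by
      refine comp_syzygyComm_eq ?_
      refine ((toStable _).map_comp d' (syzSusp X)).symm.trans (Eq.symm ?_)
      refine syzygy_map_eq d _ (dF ≫ coverSusp X) ?_ ?_
      · rw [Category.assoc, syzSusp_incl, ← Category.assoc, c₂, Category.assoc]
      · rw [Category.assoc, coverSusp_cover, c₁]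
    exact comp_map_id_eq _ this

theorem syzygy_preserves_dist {A B C : StRel R G} {f : A ⟶ B} {g : B ⟶ C}
    {h : C ⟶ (susp _).obj A} (hd : (relTri R G).dist f g h) :
    (relTri R G).dist ((syzygy R G).map f) ((syzygy R G).map g)
      ((syzygy R G).map h ≫ syzygyComm.hom.app A) :=
  preserves_dist_of_standard (syzygy R G) syzygyComm (fun h he hd => syzygy_standard h he hd) hd

end SyzygyTriangulated

/-! ### Modules over the rings `S / t ^ n` -/

section UniserialRings

variable {S : Type u} [CommRing S] [IsDomain S] [IsDiscreteValuationRing S] {t : S}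
  (ht : Irreducible t) {n : ℕ} (hn : 1 ≤ n)

variable (t n) in
/-- The image of the uniformiser `t` in `S / t ^ n`. -/
def unif : Rn S t n := Ideal.Quotient.mk _ t

theorem mk_eq_zero_iff {a : S} : (Ideal.Quotient.mk (Ideal.span {t ^ n}) a) = 0 ↔ t ^ n ∣ a := by
  rw [Ideal.Quotient.eq_zero_iff_mem, Ideal.mem_span_singleton]

theorem unif_pow_eq_zero : unif t n ^ n = 0 := by
  rw [unif, ← map_pow]
  exact mk_eq_zero_iff.2 dvd_rfl

include ht in
theorem exists_of_unif_pow_mul_eq_zero {i : ℕ} (hi : i ≤ n) {r : Rn S t n}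
    (h : unif t n ^ i * r = 0) : ∃ s, r = unif t n ^ (n - i) * s := by
  obtain ⟨a, rfl⟩ := Ideal.Quotient.mk_surjective r
  rw [unif, ← map_pow, ← map_mul, mk_eq_zero_iff] at h
  obtain ⟨b, hb⟩ := h
  refine ⟨Ideal.Quotient.mk _ b, ?_⟩
  rw [unif, ← map_pow, ← map_mul]
  congr 1
  refine mul_left_cancel₀ (pow_ne_zero i ht.ne_zero) ?_
  rw [hb, ← mul_assoc, ← pow_add, Nat.add_sub_cancel' hi]

include ht in
theorem unif_pow_ne_zero {i : ℕ} (hi : i < n) : unif t n ^ i ≠ 0 := by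
  rw [unif, ← map_pow, Ne, mk_eq_zero_iff, pow_dvd_pow_iff ht.ne_zero ht.not_isUnit]
  omega

include ht in
theorem ideal_eq_span_unif_pow (I : Ideal (Rn S t n)) :
    ∃ i ≤ n, I = Ideal.span {unif t n ^ i} := by
  have hmem : t ^ n ∈ I.comap (Ideal.Quotient.mk _) := by
    rw [Ideal.mem_comap, mk_eq_zero_iff.2 dvd_rfl]
    exact I.zero_mem
  obtain ⟨i, hi⟩ := IsDiscreteValuationRing.ideal_eq_span_pow_irreducible
    (s := I.comap (Ideal.Quotient.mk (Ideal.span {t ^ n}))) (fun h => by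
      rw [h, Ideal.mem_bot] at hmem
      exact pow_ne_zero n ht.ne_zero hmem) ht
  refine ⟨i, ?_, ?_⟩
  · rwa [hi, Ideal.mem_span_singleton, pow_dvd_pow_iff ht.ne_zero ht.not_isUnit] at hmem
  · rw [← Ideal.map_comap_of_surjective _ Ideal.Quotient.mk_surjective I, hi, Ideal.map_span,
      Set.image_singleton, map_pow]
    rfl

include ht in
/-- The ring `S / t ^ n` is self-injective. -/
theorem baer_self : Module.Baer (Rn S t n) (Rn S t n) := by
  intro I f
  obtain ⟨i, hi, rfl⟩ := ideal_eq_span_unif_pow ht I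
  have hmem : unif t n ^ i ∈ Ideal.span {unif t n ^ i} := Ideal.mem_span_singleton_self _
  obtain ⟨s, hs⟩ := exists_of_unif_pow_mul_eq_zero ht (i := n - i) (Nat.sub_le n i)
    (r := f ⟨_, hmem⟩) (by
      rw [← smul_eq_mul, ← map_smul]
      have : unif t n ^ (n - i) • (⟨_, hmem⟩ : Ideal.span {unif t n ^ i}) = 0 := by
        apply Subtype.ext
        change unif t n ^ (n - i) * unif t n ^ i = 0
        rw [← pow_add, Nat.sub_add_cancel hi, unif_pow_eq_zero]
      rw [this, map_zero])
  rw [Nat.sub_sub_self hi] at hs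
  refine ⟨LinearMap.mulRight _ s, fun x mem => ?_⟩
  obtain ⟨a, rfl⟩ := Ideal.mem_span_singleton'.1 mem
  have : (⟨a * unif t n ^ i, mem⟩ : Ideal.span {unif t n ^ i}) = a • ⟨_, hmem⟩ := rfl
  rw [this, map_smul, hs]
  simp [mul_assoc]

theorem baer_pi {R ι : Type*} {E : ι → Type*} [CommRing R] [∀ i, AddCommGroup (E i)]
    [∀ i, Module R (E i)] (h : ∀ i, Module.Baer R (E i)) : Module.Baer R (∀ i, E i) := by
  intro I f
  choose g hg using fun i => h i I (LinearMap.proj i ∘ₗ f)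
  exact ⟨LinearMap.pi g, fun x mem => funext fun i => hg i x mem⟩

include ht in
/-- The ring `S / t ^ n` is a cogenerator: if the annihilator of `y` is generated by `t ^ i`, then
`y ↦ t ^ (n - i)` is well defined on the submodule generated by `y`, and extends as the ring is
self-injective. -/
theorem exists_functional_ne_zero {Y : Type u} [AddCommGroup Y] [Module (Rn S t n) Y] {y : Y}
    (hy : y ≠ 0) : ∃ φ : Y →ₗ[Rn S t n] Rn S t n, φ y ≠ 0 := by
  let q := LinearMap.toSpanSingleton (Rn S t n) Y y
  obtain ⟨i, hi, hI⟩ := ideal_eq_span_unif_pow ht (LinearMap.ker q)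
  have hi0 : 0 < i := by
    rw [Nat.pos_iff_ne_zero]
    rintro rfl
    rw [pow_zero, Ideal.span_singleton_one] at hI
    have h1 : (1 : Rn S t n) ∈ LinearMap.ker q := hI ▸ Submodule.mem_top
    exact hy (by simpa [q] using h1)
  obtain ⟨l, hl⟩ := exists_linear_descend q.rangeRestrict q.surjective_rangeRestrict
    (LinearMap.mulRight (Rn S t n) (unif t n ^ (n - i))) (fun r hr => by
      have : r ∈ LinearMap.ker q := congrArg Subtype.val hr
      rw [hI] at this
      obtain ⟨a, rfl⟩ := Ideal.mem_span_singleton'.1 this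
      rw [LinearMap.mulRight_apply, mul_assoc, ← pow_add, Nat.add_sub_cancel' hi,
        unif_pow_eq_zero, mul_zero])
  obtain ⟨φ, hφ⟩ := (baer_self ht).extension_property (LinearMap.range q).subtype
    Subtype.val_injective l
  refine ⟨φ, ?_⟩
  have h1 : φ y = l (q.rangeRestrict 1) := by
    rw [← hφ]
    simp [q]
  have h2 := LinearMap.congr_fun hl 1
  rw [LinearMap.comp_apply, LinearMap.mulRight_apply, one_mul] at h2
  rw [h1, h2]
  exact unif_pow_ne_zero ht (by omega)

include ht in
/-- A finitely generated module over `S / t ^ n` embeds in a finitely generated free module: take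
generators of its dual. -/
theorem exists_embedding (Y : Type u) [AddCommGroup Y] [Module (Rn S t n) Y]
    [Module.Finite (Rn S t n) Y] :
    ∃ (m : ℕ) (j : Y →ₗ[Rn S t n] (Fin m → Rn S t n)), Function.Injective j := by
  obtain ⟨a, s, hs⟩ := Module.Finite.exists_fin' (Rn S t n) Y
  have : Module.Finite (Rn S t n) (Y →ₗ[Rn S t n] Rn S t n) :=
    Module.Finite.of_injective
      (LinearMap.pi fun i => LinearMap.applyₗ (s (Pi.single i 1)) :
        (Y →ₗ[Rn S t n] Rn S t n) →ₗ[Rn S t n] (Fin a → Rn S t n)) (fun f g hfg => by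
      refine LinearMap.cancel_right hs |>.1 ?_
      refine LinearMap.pi_ext' fun i => LinearMap.ext_ring ?_
      exact congrFun hfg i)
  obtain ⟨m, d, hd⟩ := Module.Finite.exists_fin' (Rn S t n) (Y →ₗ[Rn S t n] Rn S t n)
  refine ⟨m, LinearMap.pi fun i => d (Pi.single i 1), ?_⟩
  refine (injective_iff_map_eq_zero _).2 fun y hy => ?_
  by_contra hne
  obtain ⟨φ, hφ⟩ := exists_functional_ne_zero (n := n) ht hne
  obtain ⟨c, rfl⟩ := hd φ
  apply hφ
  have : LinearMap.applyₗ y ∘ₗ d = 0 := by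
    refine LinearMap.pi_ext' fun i => LinearMap.ext_ring ?_
    exact congrFun hy i
  exact LinearMap.congr_fun this c

include ht hn in
/-- In a free module over `S / t ^ n`, the elements killed by `t` are multiples of `t ^ (n - 1)`. -/
theorem exists_of_unif_smul_eq_zero {ι : Type*} {x : ι → Rn S t n} (h : unif t n • x = 0) :
    ∃ y, x = unif t n ^ (n - 1) • y := by
  choose y hy using fun i => exists_of_unif_pow_mul_eq_zero ht hn (r := x i) (by
    rw [pow_one]; exact congrFun h i)
  exact ⟨y, funext hy⟩

include hn in
theorem unif_mul_unif_pow : unif t n * unif t n ^ (n - 1) = 0 := by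
  rw [← pow_succ', Nat.sub_add_cancel hn, unif_pow_eq_zero]

include ht in
/-- A linear map with values in `t Y'` that vanishes on the elements killed by `t` is `t` times a
linear map. This is clear for cyclic modules, and the general case follows from the structure
theorem. -/
theorem exists_eq_unif_smul {Y Y' : Type u} [AddCommGroup Y] [Module (Rn S t n) Y]
    [Module.Finite (Rn S t n) Y] [AddCommGroup Y'] [Module (Rn S t n) Y']
    (η : Y →ₗ[Rn S t n] Y') (h₁ : ∀ y, ∃ u, η y = unif t n • u)
    (h₂ : ∀ y, unif t n • y = 0 → η y = 0) :
    ∃ θ : Y →ₗ[Rn S t n] Y', ∀ y, η y = unif t n • θ y := by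
  let _ : Module S Y := Module.compHom Y (algebraMap S (Rn S t n))
  let _ : Module S Y' := Module.compHom Y' (algebraMap S (Rn S t n))
  have _ : IsScalarTower S (Rn S t n) Y := ⟨fun r s x => by
    rw [Algebra.smul_def, mul_smul]; rfl⟩
  have _ : IsScalarTower S (Rn S t n) Y' := ⟨fun r s x => by
    rw [Algebra.smul_def, mul_smul]; rfl⟩
  have hsurj : Function.Surjective (algebraMap S (Rn S t n)) := Ideal.Quotient.mk_surjective
  have _ : Module.Finite S Y :=
    have : Module.Finite S (Rn S t n) := inferInstance
    Module.Finite.trans (Rn S t n) Y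
  have htY : ∀ y : Y, t • y = unif t n • y := fun y => rfl
  have htY' : ∀ y : Y', t • y = unif t n • y := fun y => rfl
  have htor : Module.IsTorsion S Y := by
    intro y
    refine ⟨⟨t ^ n, mem_nonZeroDivisors_of_ne_zero (pow_ne_zero n ht.ne_zero)⟩, ?_⟩
    change (algebraMap S (Rn S t n) (t ^ n)) • y = 0
    have : algebraMap S (Rn S t n) (t ^ n) = 0 := mk_eq_zero_iff.2 dvd_rfl
    rw [this, zero_smul]
  -- `Y` is the direct sum of cyclic modules with generators `y i` of annihilators `t ^ a i`, up to
  -- units; the value of the quotient at `y i` is a `u` with `η (y i) = t u`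
  obtain ⟨ι, _, p, hp, a, ⟨e⟩⟩ := Module.equiv_directSum_of_isTorsion htor
  classical
  let y : ι → Y := fun i => e.symm (DirectSum.lof S ι _ i (Submodule.Quotient.mk 1))
  have hy : ∀ i, p i ^ a i • y i = 0 := by
    intro i
    rw [← map_smul, ← map_smul, ← Submodule.Quotient.mk_smul,
      (Submodule.Quotient.mk_eq_zero _).2 (by
        rw [smul_eq_mul, mul_one]; exact Submodule.mem_span_singleton_self _), map_zero, map_zero]
  let ηS : Y →ₗ[S] Y' := η.restrictScalars S
  have hu : ∀ i, ∃ u, ηS (y i) = t • u ∧ p i ^ a i • u = 0 := by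
    intro i
    obtain ⟨w, hw⟩ := IsDiscreteValuationRing.associated_of_irreducible S (hp i) ht
    rcases Nat.eq_zero_or_pos (a i) with h0 | h0
    · refine ⟨0, ?_, smul_zero _⟩
      have : y i = 0 := by simpa [h0] using hy i
      rw [this, map_zero, smul_zero]
    · obtain ⟨u, hu⟩ := h₁ (y i)
      refine ⟨u, hu, ?_⟩
      have h3 : ηS (p i ^ (a i - 1) • y i) = 0 := by
        refine h₂ _ ?_
        rw [← htY, ← hw, mul_comm, mul_smul, smul_smul (p i), ← pow_succ', Nat.sub_add_cancel h0,
          hy, smul_zero]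
      have h4 : t • p i ^ (a i - 1) • u = 0 := by
        rw [smul_comm, htY', ← hu, ← h3, map_smul]; rfl
      have h5 : p i = t * (↑w⁻¹ : S) := by rw [← hw, mul_assoc, Units.mul_inv, mul_one]
      rw [← Nat.sub_add_cancel h0, pow_succ']
      nth_rw 1 [h5]
      rw [mul_comm t, mul_assoc, mul_smul, mul_smul, h4, smul_zero]
  choose u hu₁ hu₂ using hu
  let θS : Y →ₗ[S] Y' := DirectSum.toModule S ι Y' (fun i =>
    (S ∙ p i ^ a i).liftQ (LinearMap.toSpanSingleton S Y' (u i)) (by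
      rw [Submodule.span_le, Set.singleton_subset_iff]
      exact hu₂ i)) ∘ₗ e.toLinearMap
  have hθ : ηS ∘ₗ e.symm.toLinearMap = (t • θS) ∘ₗ e.symm.toLinearMap := by
    refine DirectSum.linearMap_ext S fun i => ?_
    refine Submodule.linearMap_qext _ (LinearMap.ext_ring ?_)
    have : θS (y i) = u i := by
      simp only [θS, y, LinearMap.comp_apply, LinearEquiv.coe_coe, LinearEquiv.apply_symm_apply,
        DirectSum.toModule_lof]
      exact ((S ∙ p i ^ a i).liftQ_apply _ 1).trans (one_smul S (u i))
    change ηS (y i) = t • θS (y i)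
    rw [this, hu₁]
  refine ⟨θS.extendScalarsOfSurjective hsurj, fun z => ?_⟩
  have := LinearMap.congr_fun hθ (e z)
  simp only [LinearMap.comp_apply, LinearEquiv.coe_coe, LinearEquiv.symm_apply_apply] at this
  exact this

include ht hn in
theorem isArtinianRing_Rn : IsArtinianRing (Rn S t n) := by
  have : Nontrivial (Rn S t n) := ⟨⟨_, _, unif_pow_ne_zero ht (i := 0) hn⟩⟩
  have : IsLocalRing (Rn S t n) :=
    IsLocalRing.of_surjective' _ (Ideal.Quotient.mk_surjective (I := Ideal.span {t ^ n}))
  rw [isArtinianRing_iff_isNilpotent_maximalIdeal]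
  refine ⟨n, ?_⟩
  have hle : IsLocalRing.maximalIdeal (Rn S t n) ≤ Ideal.span {unif t n} := by
    obtain ⟨i, -, hI⟩ := ideal_eq_span_unif_pow ht (IsLocalRing.maximalIdeal (Rn S t n))
    rw [hI, Ideal.span_singleton_le_span_singleton]
    refine dvd_pow_self _ ?_
    rintro rfl
    rw [pow_zero, Ideal.span_singleton_one] at hI
    exact (IsLocalRing.maximalIdeal.isMaximal (Rn S t n)).ne_top hI
  have := Ideal.pow_right_mono hle n
  rw [Ideal.span_singleton_pow, unif_pow_eq_zero, Ideal.span_singleton_zero] at this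
  exact le_bot_iff.1 this

theorem toPred_eq_zero {r : Rn S t n} (h : toPred S t n r = 0) :
    ∃ s, r = unif t n ^ (n - 1) * s := by
  obtain ⟨a, rfl⟩ := Ideal.Quotient.mk_surjective r
  obtain ⟨b, rfl⟩ := mk_eq_zero_iff.1 h
  exact ⟨Ideal.Quotient.mk _ b, by rw [map_mul, map_pow]; rfl⟩

theorem toPred_unif_pow : toPred S t n (unif t n ^ (n - 1)) = 0 := by
  rw [unif, ← map_pow]
  exact mk_eq_zero_iff.2 dvd_rfl

theorem toResidue_eq_zero {r : Rn S t n} (h : toResidue S ht.not_isUnit hn r = 0) :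
    ∃ s, r = unif t n * s := by
  obtain ⟨a, rfl⟩ := Ideal.Quotient.mk_surjective r
  have ha : a ∈ IsLocalRing.maximalIdeal S := Ideal.Quotient.eq_zero_iff_mem.1 h
  rw [ht.maximalIdeal_eq, Ideal.mem_span_singleton] at ha
  obtain ⟨b, rfl⟩ := ha
  exact ⟨Ideal.Quotient.mk _ b, by rw [map_mul]; rfl⟩

theorem toResidue_unif : toResidue S ht.not_isUnit hn (unif t n) = 0 := by
  refine Ideal.Quotient.eq_zero_iff_mem.2 ?_
  rw [ht.maximalIdeal_eq]
  exact Ideal.mem_span_singleton_self t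

end UniserialRings

/-! ### The syzygy functor is an autoequivalence -/

section SyzygyEquivalence

variable {R G : Type u} [CommRing R] [Group G] [Fintype G]

/-- A module induced from an injective `R`-module is injective. -/
theorem exists_extension {A B : FGRep R G} (i : A ⟶ B) (hi : Function.Injective (lin i))
    {L : Type u} [AddCommGroup L] [Module R L] [Module.Finite R L] (hL : Module.Baer R L)
    (f : A ⟶ ind R G L) : ∃ h : B ⟶ ind R G L, i ≫ h = f := by
  obtain ⟨r, hr⟩ := hL.extension_property (lin i) hi
    ((LinearMap.proj (1 : G) : (G → L) →ₗ[R] L) ∘ₗ lin f)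
  refine ⟨coindLift r, hom_ext' fun x => funext fun g => ?_⟩
  rw [lin_comp_apply, coindLift_apply, ← lin_equivariant, apply_eq_apply_one f]
  exact LinearMap.congr_fun hr _

variable [IsNoetherianRing R]

/-- Over a self-injective ring, a morphism is stably trivial if its syzygy is: if the map of syzygies
is the trace of `θ`, extend `θ` to an `R`-linear map `l` of the covers. The difference of the map of
covers and the trace of `l` factors through the quotient `M`, and `l` induces a map `M → N`. -/
theorem stable_map_eq_zero_of_syzygy (hR : Module.Baer R R) {M N : FGRep R G} (f : M ⟶ N)
    (h : (syzygy R G).map ((toStable _).map f) = 0) :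
    (toStable (weaklyProjective R G)).map f = 0 := by
  rw [syzygy_map_map] at h
  obtain ⟨θ, hθ⟩ := stable_map_eq_zero_iff.1 h
  obtain ⟨l, hl⟩ := (baer_pi fun _ => baer_pi fun _ => hR :
      Module.Baer R (G → Fin (coverRank N) → R)).extension_property (lin (syzIncl M))
    (syzIncl_injective M) (lin (syzIncl N) ∘ₗ θ)
  let l' : (coverObj M).obj.V →ₗ[R] (coverObj N).obj.V := l
  have hl' : l' ∘ₗ lin (syzIncl M) = lin (syzIncl N) ∘ₗ θ := hl
  obtain ⟨δ, hδ⟩ := (isSES_syz M).exists_desc (coverMap f - trHom l') (by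
    apply lin_injective
    rw [Preadditive.comp_sub, ← syzMapOf_incl f (coverMap f) (coverMap_comm f), lin_sub, lin_comp,
      lin_comp, lin_trHom, tr_comp, hl', hθ, ← comp_tr, sub_self]
    rfl)
  obtain ⟨m, hm⟩ := exists_linear_descend (lin (cover M)) (cover_surjective M)
    (lin (cover N) ∘ₗ l') (fun x hx => by
      obtain ⟨y, rfl⟩ := ((isSES_syz M).2.1 x).1 hx
      have := LinearMap.congr_fun hl' y
      rw [LinearMap.comp_apply] at this ⊢
      rw [this]
      exact (isSES_syz N).2.1.apply_apply_eq_zero _)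
  have key : f = δ ≫ cover N + trHom m := by
    refine cancel_surjective (cover M) (cover_surjective M) ?_
    rw [Preadditive.comp_add, ← Category.assoc, hδ, Preadditive.sub_comp, coverMap_comm]
    have : trHom l' ≫ cover N = cover M ≫ trHom m := by
      apply lin_injective
      rw [lin_comp, lin_comp, lin_trHom, lin_trHom, comp_tr, tr_comp, hm]
    rw [this, sub_add_cancel]
  rw [key, Functor.map_add, stable_map_trHom, add_zero, stable_comp_ind]

theorem syzygy_faithful (hR : Module.Baer R R) : (syzygy R G).Faithful where
  map_injective {X Y f g} h := by
    obtain ⟨M⟩ := X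
    obtain ⟨N⟩ := Y
    obtain ⟨f, rfl⟩ := exists_rep f
    obtain ⟨g, rfl⟩ := exists_rep g
    rw [← sub_eq_zero, ← Functor.map_sub]
    refine stable_map_eq_zero_of_syzygy hR _ ?_
    rw [Functor.map_sub, Functor.map_sub, h, sub_self]

/-- Over a self-injective ring, a map of syzygies extends to the covers, hence to the quotients. -/
theorem syzygy_full (hR : Module.Baer R R) : (syzygy R G).Full where
  map_surjective {X Y} g := by
    obtain ⟨M⟩ := X
    obtain ⟨N⟩ := Y
    obtain ⟨y, hy⟩ := (toStable (weaklyProjective R G)).map_surjective (X := syzObj M)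
      (Y := syzObj N) g
    obtain ⟨l, hl⟩ := exists_extension (syzIncl M) (syzIncl_injective M) (baer_pi fun _ => hR)
      (y ≫ syzIncl N)
    obtain ⟨f, hf⟩ := (isSES_syz M).exists_desc (l ≫ cover N) (by
      rw [← Category.assoc, hl, Category.assoc, (isSES_syz N).comp_eq_zero, Limits.comp_zero])
    exact ⟨(toStable _).map f, (syzygy_map_eq f y l hl.symm hf.symm).trans hy⟩

/-- A module that embeds in a free `R`-module embeds in a free `RG`-module, and is the syzygy of the
quotient. -/
theorem exists_syzygy_iso (Y : FGRep R G) {m : ℕ} (j : Y.obj.V →ₗ[R] (Fin m → R))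
    (hj : Function.Injective j) :
    ∃ X : StRel R G, Nonempty ((syzygy R G).obj X ≅ (toStable _).obj Y) := by
  have hinj : Function.Injective (lin (coindLift (G := G) j)) := fun x y hxy => hj (by
    have := congrFun hxy (1 : G)
    rw [coindLift_apply, coindLift_apply] at this
    simpa using this)
  obtain ⟨c, -, -, -, hc⟩ := exists_schanuel (P := weaklyProjective R G) (isSES_coker _ hinj)
    (isProj_ind _) (isSES_syz _) (isProj_cover _)
  exact ⟨(toStable _).obj (cokerObj (coindLift j)), ⟨(asIso ((toStable _).map c)).symm⟩⟩

theorem syzygy_reflects_dist (hR : Module.Baer R R) {A B C : StRel R G} (f : A ⟶ B) (g : B ⟶ C)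
    (h : C ⟶ (susp _).obj A)
    (hd : (relTri R G).dist ((syzygy R G).map f) ((syzygy R G).map g)
      ((syzygy R G).map h ≫ syzygyComm.hom.app A)) : (relTri R G).dist f g h := by
  have := syzygy_full (G := G) hR
  have := syzygy_faithful (G := G) hR
  exact dist_reflects (relTri R G) (relTri R G) (syzygy R G) syzygyComm
    (fun hd => syzygy_preserves_dist hd) (fun f => splitTri_exists_dist f)
    (fun c g' h' h₁ h₂ hd => splitTri_dist_of_iso (Iso.refl _) (Iso.refl _) c (by simp)
      (by simpa using h₁) (comp_map_id_eq' _ h₂) hd)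
    (fun hd hd' => splitTri_unique hd hd') f g h hd

end SyzygyEquivalence

/-! ### The image of the kernel of base change under the syzygy functor -/

section StablyKilled

variable {R G : Type u} [CommRing R] [Group G] [Fintype G]

theorem tr_smul {M N : FGRep R G} (r : R) (θ : M.obj.V →ₗ[R] N.obj.V) :
    tr (M := M) (N := N) (r • θ) = r • tr θ := by
  ext x; simp [tr_apply, Finset.smul_sum]

/-- Multiplication by `r` on `M` is the trace of a multiple of `r`. Equivalently, the identity of
`M` is stably equal to an endomorphism killed by `r`. -/
def IsStablyKilled (r : R) (M : FGRep R G) : Prop :=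
  ∃ θ : M.obj.V →ₗ[R] M.obj.V, r • LinearMap.id = tr (r • θ)

/-- The condition passes to stable retracts: if `p i - 1` is the trace of `μ`, take `p θ i - μ`. -/
theorem IsStablyKilled.of_retract {r : R} {M N : FGRep R G} (h : IsStablyKilled r N)
    (e : Retract ((toStable (weaklyProjective R G)).obj M) ((toStable _).obj N)) :
    IsStablyKilled r M := by
  obtain ⟨θ, hθ⟩ := h
  obtain ⟨i, hi⟩ := exists_rep e.i
  obtain ⟨p, hp⟩ := exists_rep e.r
  have := e.retract
  rw [← hi, ← hp, ← Functor.map_comp, ← CategoryTheory.Functor.map_id, stable_map_eq_iff] at this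
  obtain ⟨μ, hμ⟩ := this
  refine ⟨lin p ∘ₗ θ ∘ₗ lin i - μ, ?_⟩
  rw [tr_smul, sub_eq_add_neg, tr_add, ← comp_tr, ← tr_comp]
  have hneg : tr (-μ) = -tr μ := by ext x; simp [tr_apply]
  rw [hneg, ← hμ, smul_add]
  rw [tr_smul] at hθ
  have : r • (lin p ∘ₗ tr θ ∘ₗ lin i) = lin p ∘ₗ (r • LinearMap.id) ∘ₗ lin i := by
    rw [hθ, LinearMap.smul_comp, LinearMap.comp_smul]
  rw [this, lin_comp, lin_id, LinearMap.smul_comp, LinearMap.comp_smul, LinearMap.id_comp, ← smul_add]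
  congr 1
  abel

theorem IsStablyKilled.of_iso {r : R} {M N : FGRep R G} (h : IsStablyKilled r N)
    (e : (toStable (weaklyProjective R G)).obj M ≅ (toStable _).obj N) : IsStablyKilled r M :=
  h.of_retract ⟨e.hom, e.inv, e.hom_inv_id⟩

theorem isStablyKilled_of_isRelProj {r : R} {M : FGRep R G} (h : IsRelProj M) :
    IsStablyKilled r M := by
  obtain ⟨θ, hθ⟩ := h
  exact ⟨θ, by rw [tr_smul, ← hθ]⟩

theorem isStablyKilled_of_smul_eq_zero {r : R} {M : FGRep R G} (h : ∀ x : M.obj.V, r • x = 0) :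
    IsStablyKilled r M :=
  ⟨0, by ext x; simp [tr_apply, h]⟩

/-- The tensor product with the diagonal action. -/
abbrev tens (M N : FGRep R G) : FGRep R G := FGRep.of (M.obj.ρ.tprod N.obj.ρ)

theorem tens_rho {M N : FGRep R G} (g : G) (x : M.obj.V) (y : N.obj.V) :
    (tens M N).obj.ρ g (x ⊗ₜ y) = M.obj.ρ g x ⊗ₜ N.obj.ρ g y := rfl

/-- The tensor product of morphisms. -/
def tensMap {M N M' N' : FGRep R G} (f : M ⟶ M') (f' : N ⟶ N') : tens M N ⟶ tens M' N' :=
  mkHom (M := tens M N) (N := tens M' N') (TensorProduct.map (lin f) (lin f')) (fun g x => by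
    induction x using TensorProduct.induction_on with
    | zero => simp only [map_zero]
    | tmul x y =>
      rw [tens_rho, TensorProduct.map_tmul, TensorProduct.map_tmul, tens_rho, lin_equivariant,
        lin_equivariant]
    | add x y hx hy => simp only [map_add, hx, hy])

/-- The projection formula: the trace of `θ ⊗ f` is the trace of `θ`, tensored with `f`, if `f` is
equivariant. -/
theorem tr_map_left {M M' N N' : FGRep R G} (θ : M.obj.V →ₗ[R] M'.obj.V) (f : N ⟶ N') :
    tr (M := tens M N) (N := tens M' N') (TensorProduct.map θ (lin f)) =
      TensorProduct.map (tr θ) (lin f) := by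
  refine TensorProduct.ext' fun x y => ?_
  rw [tr_apply, TensorProduct.map_tmul, tr_apply, TensorProduct.sum_tmul]
  refine Finset.sum_congr rfl fun g _ => ?_
  rw [tens_rho, TensorProduct.map_tmul, tens_rho, lin_equivariant, rho_self_inv]

theorem tr_map_right {M M' N N' : FGRep R G} (f : M ⟶ M') (θ : N.obj.V →ₗ[R] N'.obj.V) :
    tr (M := tens M N) (N := tens M' N') (TensorProduct.map (lin f) θ) =
      TensorProduct.map (lin f) (tr θ) := by
  refine TensorProduct.ext' fun x y => ?_
  rw [tr_apply, TensorProduct.map_tmul, tr_apply, TensorProduct.tmul_sum]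
  refine Finset.sum_congr rfl fun g _ => ?_
  rw [tens_rho, TensorProduct.map_tmul, tens_rho, lin_equivariant, rho_self_inv]

theorem IsStablyKilled.tens {r : R} {M : FGRep R G} (h : IsStablyKilled r M) (N : FGRep R G) :
    IsStablyKilled r (tens N M) := by
  obtain ⟨θ, hθ⟩ := h
  refine ⟨TensorProduct.map LinearMap.id θ, ?_⟩
  rw [← TensorProduct.map_smul_right, ← lin_id N, tr_map_right, ← hθ, TensorProduct.map_smul_right,
    lin_id, TensorProduct.map_id]

end StablyKilled

section BaseChange

variable {S : Type u} [CommRing S] [IsDomain S] [IsDiscreteValuationRing S] {t : S}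
  (ht : Irreducible t) {n : ℕ} (hn : 1 ≤ n) {G : Type u} [Group G] [Fintype G]

variable (t n G) in
/-- The trivial module `R_{n-1}` over `R_n`. -/
abbrev predRep : FGRep (Rn S t n) G :=
  alongObj (toPred S t n) (toPred_surjective S t n) (trivialRep (Rn S t (n - 1)) G)

variable (t n) in
/-- The linear map `R_n → R_{n-1}`. -/
def toPredLin : Rn S t n →ₗ[Rn S t n] (predRep t n G).obj.V where
  toFun := toPred S t n
  map_add' := map_add _
  map_smul' r x := map_mul (toPred S t n) r x

/-- The kernel of `R_n → R_{n-1}` is generated by `t ^ (n - 1)`. -/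
theorem exact_toPredLin :
    Function.Exact (LinearMap.lsmul (Rn S t n) (Rn S t n) (unif t n ^ (n - 1)))
      (toPredLin t n (G := G)) := by
  intro x
  constructor
  · intro h
    obtain ⟨s, rfl⟩ := toPred_eq_zero h
    exact ⟨s, rfl⟩
  · rintro ⟨s, rfl⟩
    change toPred S t n (unif t n ^ (n - 1) * s) = 0
    rw [map_mul, toPred_unif_pow, zero_mul]

variable (t n) in
/-- The projection `M → M ⊗ R_{n-1}`. -/
def toBaseChange (M : FGRep (Rn S t n) G) : M ⟶ tens M (predRep t n G) :=
  mkHom ((TensorProduct.mk (Rn S t n) M.obj.V (predRep t n G).obj.V).flip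
    (toPredLin t n (G := G) 1)) (fun _ _ => rfl)

theorem toBaseChange_surjective (M : FGRep (Rn S t n) G) :
    Function.Surjective (lin (toBaseChange t n M)) := by
  intro z
  change M.obj.V ⊗[Rn S t n] (predRep t n G).obj.V at z
  induction z using TensorProduct.induction_on with
  | zero => exact ⟨0, map_zero _⟩
  | tmul x y =>
    obtain ⟨r, rfl⟩ := toPred_surjective S t n y
    refine ⟨r • x, ?_⟩
    change (r • x) ⊗ₜ toPredLin t n (G := G) 1 = x ⊗ₜ toPredLin t n (G := G) r
    rw [TensorProduct.smul_tmul, ← map_smul, smul_eq_mul, mul_one]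
  | add x y hx hy =>
    obtain ⟨a, ha⟩ := hx
    obtain ⟨b, hb⟩ := hy
    exact ⟨a + b, by rw [map_add, ha, hb]⟩

theorem toBaseChange_eq_zero_iff {M : FGRep (Rn S t n) G} {x : M.obj.V} :
    lin (toBaseChange t n M) x = 0 ↔ ∃ y, x = unif t n ^ (n - 1) • y := by
  have hex := lTensor_exact M.obj.V (exact_toPredLin (t := t) (n := n) (G := G))
    (toPred_surjective S t n)
  constructor
  · intro h
    obtain ⟨z, hz⟩ := (hex (x ⊗ₜ 1)).1 h
    refine ⟨TensorProduct.rid (Rn S t n) M.obj.V z, ?_⟩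
    have h1 : (LinearMap.lsmul (Rn S t n) (Rn S t n) (unif t n ^ (n - 1))).lTensor M.obj.V =
        unif t n ^ (n - 1) • LinearMap.id :=
      TensorProduct.ext' fun a b => TensorProduct.tmul_smul (unif t n ^ (n - 1)) a b
    rw [h1] at hz
    change unif t n ^ (n - 1) • z = _ at hz
    rw [← map_smul, hz, TensorProduct.rid_tmul, one_smul]
  · rintro ⟨y, rfl⟩
    change (unif t n ^ (n - 1) • y) ⊗ₜ toPredLin t n (G := G) 1 = 0
    rw [TensorProduct.smul_tmul, ← map_smul, smul_eq_mul, mul_one]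
    have : toPredLin t n (G := G) (unif t n ^ (n - 1)) = 0 := toPred_unif_pow
    rw [this, TensorProduct.tmul_zero]

theorem K_iff {M : FGRep (Rn S t n) G} :
    K t n G ((toStable _).obj M) ↔ IsRelProj (tens M (predRep t n G)) :=
  isZero_stable_iff

include ht hn in
theorem exists_of_unif_smul_eq_zero_cover {M : FGRep (Rn S t n) G} {x : (coverObj M).obj.V}
    (h : unif t n • x = 0) : ∃ y, x = unif t n ^ (n - 1) • y := by
  choose y hy using fun g : G => exists_of_unif_smul_eq_zero ht hn
    (x := (x : G → Fin (coverRank M) → Rn S t n) g) (congrFun h g)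
  exact ⟨y, funext hy⟩

include ht hn in
/-- An object lies in the kernel of base change to `R_{n-1}` if and only if its syzygy is stably
killed by `t`. Let `F → M` be the cover, `Y` its kernel and `Z = Y + t ^ (n - 1) F` the kernel of
`F → M ⊗ R_{n-1}`. Both conditions mean that the identity of `F` is the trace of an `R_n`-linear
map that preserves `Z`. -/
theorem K_iff_syzygy {M : FGRep (Rn S t n) G} :
    K t n G ((toStable _).obj M) ↔ IsStablyKilled (unif t n) (syzObj M) := by
  rw [K_iff]
  let q := cover M ≫ toBaseChange t n M
  have hq : Function.Surjective (lin q) :=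
    (toBaseChange_surjective M).comp (cover_surjective M)
  have hqZ : ∀ x, lin q x = 0 ↔
      ∃ (y : (syzObj M).obj.V) (f : (coverObj M).obj.V),
        x = lin (syzIncl M) y + unif t n ^ (n - 1) • f := by
    intro x
    change lin (toBaseChange t n M) (lin (cover M) x) = 0 ↔ _
    rw [toBaseChange_eq_zero_iff]
    constructor
    · rintro ⟨m, hm⟩
      obtain ⟨f, rfl⟩ := cover_surjective M m
      obtain ⟨y, hy⟩ := ((isSES_syz M).2.1 (x - unif t n ^ (n - 1) • f)).1 (by
        rw [map_sub, map_smul, hm, sub_self])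
      exact ⟨y, f, by rw [hy, sub_add_cancel]⟩
    · rintro ⟨y, f, rfl⟩
      exact ⟨lin (cover M) f, by
        rw [map_add, (isSES_syz M).2.1.apply_apply_eq_zero, zero_add, map_smul]⟩
  constructor
  · rintro ⟨θ, hθ⟩
    -- `ν` has trace one and preserves `Z`: lift `θ` to `F`, and correct its trace by a map to `Z`
    have := (isProj_cover M).1
    obtain ⟨l, hl⟩ := Module.projective_lifting_property (lin q) (θ ∘ₗ lin q) hq
    obtain ⟨w, hw⟩ := (isSES_ker q hq).exists_lift (𝟙 _ - trHom l) (by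
      have : tr θ ∘ₗ lin q = lin q ∘ₗ tr l := by rw [comp_tr, hl, tr_comp]
      rw [← hθ] at this
      refine hom_ext' fun x => ?_
      change lin q (x - tr l x) = 0
      rw [map_sub, sub_eq_zero]
      exact LinearMap.congr_fun this x)
    obtain ⟨μ, hμ⟩ := (isProj_cover M).2.exists_tr_from w
    let ν := l + lin (kerIncl q) ∘ₗ μ
    have hν : tr (M := coverObj M) (N := coverObj M) ν = LinearMap.id := by
      rw [tr_add, ← comp_tr, ← hμ, ← lin_comp, hw, lin_sub, lin_trHom, lin_id, add_sub_cancel]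
    have hνZ : ∀ y, lin q (ν (lin (syzIncl M) y)) = 0 := by
      intro y
      have h1 : lin q (l (lin (syzIncl M) y)) = θ (lin q (lin (syzIncl M) y)) :=
        LinearMap.congr_fun hl _
      have h2 : lin q (lin (syzIncl M) y) = 0 :=
        (hqZ _).2 ⟨y, 0, by rw [smul_zero, add_zero]⟩
      rw [LinearMap.add_apply, map_add, h1, h2, map_zero, zero_add]
      exact (isSES_ker q hq).2.1.apply_apply_eq_zero _
    have hνY : ∀ y, ∃ y', unif t n • ν (lin (syzIncl M) y) = lin (syzIncl M) (unif t n • y') := by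
      intro y
      obtain ⟨y', f, h⟩ := (hqZ _).1 (hνZ y)
      refine ⟨y', ?_⟩
      rw [h, smul_add, smul_smul, unif_mul_unif_pow hn, zero_smul, add_zero, map_smul]
    -- `t ν` maps `Y` to `t Z = t Y`, and its restriction `η` to `Y` is a multiple of `t`
    obtain ⟨η, hη⟩ := exists_linear_corestrict (lin (syzIncl M)) (syzIncl_injective M)
      (unif t n • ν ∘ₗ lin (syzIncl M)) (fun y => by
        obtain ⟨y', h⟩ := hνY y
        exact ⟨_, h.symm⟩)
    have hη' : ∀ y, lin (syzIncl M) (η y) = unif t n • ν (lin (syzIncl M) y) :=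
      LinearMap.congr_fun hη
    obtain ⟨ψ, hψ⟩ := exists_eq_unif_smul ht η (fun y => by
        obtain ⟨y', h⟩ := hνY y
        exact ⟨y', syzIncl_injective M (by rw [hη', h])⟩) (fun y hy => by
        refine syzIncl_injective M ?_
        rw [hη', ← map_smul, ← map_smul, hy, map_zero, map_zero])
    have hψ' : η = unif t n • ψ := LinearMap.ext hψ
    refine ⟨ψ, LinearMap.ext fun y => syzIncl_injective M ?_⟩
    have h1 : lin (syzIncl M) ∘ₗ tr η = unif t n • lin (syzIncl M) := by
      rw [comp_tr, hη, tr_smul, ← tr_comp, hν, LinearMap.id_comp]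
    rw [← hψ']
    refine Eq.trans ?_ (LinearMap.congr_fun h1 y).symm
    simp
  · rintro ⟨θ, hθ⟩
    -- extend `θ` to `F` by injectivity; the defect `w` of its trace has `t w (Z) = 0`, so `w` maps `Z`
    -- to `t ^ (n - 1) F ⊆ Z`, and so does `κ w`, whatever the linear map `κ`
    obtain ⟨l, hl⟩ := (baer_pi fun _ => baer_pi fun _ => baer_self ht :
        Module.Baer (Rn S t n) (G → Fin (coverRank M) → Rn S t n)).extension_property
      (lin (syzIncl M)) (syzIncl_injective M) (lin (syzIncl M) ∘ₗ θ)
    let l' : (coverObj M).obj.V →ₗ[Rn S t n] (coverObj M).obj.V := l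
    have hl' : ∀ y, l' (lin (syzIncl M) y) = lin (syzIncl M) (θ y) := LinearMap.congr_fun hl
    have hl'' : l' ∘ₗ lin (syzIncl M) = lin (syzIncl M) ∘ₗ θ := hl
    let w : coverObj M ⟶ coverObj M := 𝟙 _ - trHom l'
    have hwY : ∀ y, unif t n • lin w (lin (syzIncl M) y) = 0 := by
      intro y
      have h1 : tr l' (lin (syzIncl M) y) = lin (syzIncl M) (tr θ y) := by
        have : tr l' ∘ₗ lin (syzIncl M) = lin (syzIncl M) ∘ₗ tr θ := by
          rw [tr_comp, hl'', comp_tr]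
        exact LinearMap.congr_fun this y
      have h2 : unif t n • y = unif t n • tr θ y := by
        have := LinearMap.congr_fun hθ y
        rw [tr_smul] at this
        exact this
      change unif t n • (lin (syzIncl M) y - tr l' (lin (syzIncl M) y)) = 0
      rw [h1, smul_sub, ← map_smul, ← map_smul, h2, sub_self]
    have hwZ : ∀ x, lin q x = 0 → unif t n • lin w x = 0 := by
      intro x hx
      obtain ⟨y, f, rfl⟩ := (hqZ x).1 hx
      rw [map_add, smul_add, hwY, map_smul, smul_smul, unif_mul_unif_pow hn, zero_smul, add_zero]
    obtain ⟨κ, hκ⟩ := (isProj_cover M).2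
    let ν := l' + κ ∘ₗ lin w
    have hν : tr (M := coverObj M) (N := coverObj M) ν = LinearMap.id := by
      rw [tr_add, ← tr_comp, ← hκ, LinearMap.id_comp, lin_sub, lin_trHom, lin_id, add_sub_cancel]
    obtain ⟨η, hη⟩ := exists_linear_descend (lin q) hq (lin q ∘ₗ ν) (fun x hx => by
      have h1 : unif t n • κ (lin w x) = 0 := by rw [← map_smul, hwZ x hx, map_zero]
      obtain ⟨f', hf'⟩ := exists_of_unif_smul_eq_zero_cover ht hn h1
      obtain ⟨y, f, rfl⟩ := (hqZ x).1 hx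
      refine (hqZ _).2 ⟨θ y, l' f + f', ?_⟩
      rw [LinearMap.add_apply, LinearMap.comp_apply, hf', map_add, hl', map_smul, smul_add, add_assoc])
    refine ⟨η, ?_⟩
    have h1 : tr η ∘ₗ lin q = LinearMap.id ∘ₗ lin q := by
      rw [tr_comp, hη, ← comp_tr, hν, LinearMap.comp_id, LinearMap.id_comp]
    refine LinearMap.ext fun z => ?_
    obtain ⟨x, rfl⟩ := hq z
    exact (LinearMap.congr_fun h1 x).symm

end BaseChange

/-! ### The kernel of base change is the thick tensor ideal of `W_n` -/

section TensorSplit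

variable {R G : Type u} [CommRing R] [Group G] [Fintype G]

theorem IsSplitSES.tens_left {X Y Z : FGRep R G} {i : X ⟶ Y} {p : Y ⟶ Z} (h : IsSplitSES i p)
    (N : FGRep R G) : IsSplitSES (tensMap (𝟙 N) i) (tensMap (𝟙 N) p) := by
  obtain ⟨r, hr⟩ := h.exists_linear_retraction
  have hr' : (r.lTensor N.obj.V) ∘ₗ ((lin i).lTensor N.obj.V) = LinearMap.id := by
    rw [← LinearMap.lTensor_comp, hr, LinearMap.lTensor_id]
  refine isSplitSES_of_retraction ⟨?_, ?_, ?_⟩ _ hr'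
  · exact Function.LeftInverse.injective (LinearMap.congr_fun hr')
  · exact lTensor_exact N.obj.V h.1.2.1 h.1.2.2
  · exact LinearMap.lTensor_surjective N.obj.V h.1.2.2

theorem IsSplitSES.tens_right {X Y Z : FGRep R G} {i : X ⟶ Y} {p : Y ⟶ Z} (h : IsSplitSES i p)
    (N : FGRep R G) : IsSplitSES (tensMap i (𝟙 N)) (tensMap p (𝟙 N)) := by
  obtain ⟨r, hr⟩ := h.exists_linear_retraction
  have hr' : (r.rTensor N.obj.V) ∘ₗ ((lin i).rTensor N.obj.V) = LinearMap.id := by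
    rw [← LinearMap.rTensor_comp, hr, LinearMap.rTensor_id]
  refine isSplitSES_of_retraction ⟨?_, ?_, ?_⟩ _ hr'
  · exact Function.LeftInverse.injective (LinearMap.congr_fun hr')
  · exact rTensor_exact N.obj.V h.1.2.1 h.1.2.2
  · exact LinearMap.rTensor_surjective N.obj.V h.1.2.2

theorem IsRelProj.tens_right {M : FGRep R G} (h : IsRelProj M) (N : FGRep R G) :
    IsRelProj (tens M N) := by
  obtain ⟨θ, hθ⟩ := h
  refine ⟨TensorProduct.map θ (lin (𝟙 N)), ?_⟩
  rw [tr_map_left, ← hθ, lin_id, TensorProduct.map_id]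

theorem IsRelProj.tens_left {M : FGRep R G} (h : IsRelProj M) (N : FGRep R G) :
    IsRelProj (tens N M) := by
  obtain ⟨θ, hθ⟩ := h
  refine ⟨TensorProduct.map (lin (𝟙 N)) θ, ?_⟩
  rw [tr_map_right, ← hθ, lin_id, TensorProduct.map_id]

/-- The associativity of the tensor product. -/
def tensAssoc (M N K : FGRep R G) : tens (tens M N) K ≅ tens M (tens N K) where
  hom := mkHom (M := tens (tens M N) K) (N := tens M (tens N K))
    (TensorProduct.assoc R M.obj.V N.obj.V K.obj.V).toLinearMap (fun g =>
      LinearMap.congr_fun (TensorProduct.ext_threefold (g := (TensorProduct.assoc R M.obj.V N.obj.V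
        K.obj.V).toLinearMap ∘ₗ (tens (tens M N) K).obj.ρ g) (h := (tens M (tens N K)).obj.ρ g ∘ₗ
        (TensorProduct.assoc R M.obj.V N.obj.V K.obj.V).toLinearMap) fun _ _ _ => rfl))
  inv := mkHom (N := tens (tens M N) K) (M := tens M (tens N K))
    (TensorProduct.assoc R M.obj.V N.obj.V K.obj.V).symm.toLinearMap (fun g =>
      LinearMap.congr_fun (TensorProduct.ext_threefold' (g := (TensorProduct.assoc R M.obj.V N.obj.V
        K.obj.V).symm.toLinearMap ∘ₗ (tens M (tens N K)).obj.ρ g) (h := (tens (tens M N) K).obj.ρ g ∘ₗ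
        (TensorProduct.assoc R M.obj.V N.obj.V K.obj.V).symm.toLinearMap) fun _ _ _ => rfl))
  hom_inv_id := hom_ext' (TensorProduct.assoc R M.obj.V N.obj.V K.obj.V).symm_apply_apply
  inv_hom_id := hom_ext' (TensorProduct.assoc R M.obj.V N.obj.V K.obj.V).apply_symm_apply

/-- The trivial module is a right unit of the tensor product. -/
def tensUnit (M : FGRep R G) : tens M (trivialRep R G) ≅ M where
  hom := mkHom (M := tens M (trivialRep R G)) (TensorProduct.rid R M.obj.V).toLinearMap
    (fun g => LinearMap.congr_fun (TensorProduct.ext' (g := (TensorProduct.rid R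
      M.obj.V).toLinearMap ∘ₗ (tens M (trivialRep R G)).obj.ρ g) (h := M.obj.ρ g ∘ₗ
      (TensorProduct.rid R M.obj.V).toLinearMap) fun x (r : R) =>
        (map_smul (M.obj.ρ g) r x).symm))
  inv := mkHom (N := tens M (trivialRep R G)) (TensorProduct.rid R M.obj.V).symm.toLinearMap
    (fun _ _ => rfl)
  hom_inv_id := hom_ext' (TensorProduct.rid R M.obj.V).symm_apply_apply
  inv_hom_id := hom_ext' (TensorProduct.rid R M.obj.V).apply_symm_apply

theorem isRelProj_tens_of_retract {M M' : FGRep R G}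
    (e : Retract ((toStable (weaklyProjective R G)).obj M) ((toStable _).obj M')) {N : FGRep R G}
    (h : IsRelProj (tens M' N)) : IsRelProj (tens M N) := by
  obtain ⟨i, hi⟩ := exists_rep e.i
  obtain ⟨p, hp⟩ := exists_rep e.r
  have := e.retract
  rw [← hi, ← hp, ← Functor.map_comp, ← CategoryTheory.Functor.map_id, stable_map_eq_iff] at this
  obtain ⟨μ, hμ⟩ := this
  obtain ⟨θ, hθ⟩ := h.exists_tr_to (tensMap i (𝟙 N))
  refine ⟨lin (tensMap p (𝟙 N)) ∘ₗ θ + TensorProduct.map (-μ) (lin (𝟙 N)), ?_⟩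
  have hneg : tr (-μ) = -tr μ := by ext x; simp [tr_apply]
  rw [tr_add, ← comp_tr, ← hθ, tr_map_left, hneg, ← hμ]
  refine TensorProduct.ext' fun x y => ?_
  change x ⊗ₜ y = lin p (lin i x) ⊗ₜ y + (-(lin p (lin i x) - x)) ⊗ₜ[R] y
  rw [← TensorProduct.add_tmul]
  congr 1
  abel

/-- Tensoring preserves `R`-split sequences and relative projectivity, so the objects that become
relatively projective after tensoring with `N` form a thick tensor ideal. -/
theorem isThickTensorIdeal_isRelProj_tens (N : FGRep R G) :
    IsThickTensorIdeal (fun X : StRel R G => IsRelProj (tens X.as N)) where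
  zero X hX := (isZero_stable_iff.1 hX : IsRelProj X.as).tens_right N
  iso e h := isRelProj_tens_of_retract ⟨e.inv, e.hom, e.inv_hom_id⟩ h
  susp_iff X := by
    have h := (isSplitSES_unit X.as).tens_right N
    have h' : IsRelProj (tens (ind R G X.as.obj.V) N) := (isRelProj_ind X.as.obj.V).tens_right N
    exact ⟨h.isRelProj₁ h', fun hX => h.isRelProj₃ hX h'⟩
  ext₁ := by
    rintro A B C f g h ⟨X, Y, Z, i, p, hs, e, d, -, -, a, b, c, -⟩ hB hC
    refine isRelProj_tens_of_retract ⟨a.hom, a.inv, a.hom_inv_id⟩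
      ((hs.tens_right N).isRelProj₁ ?_ ?_)
    · exact isRelProj_tens_of_retract ⟨b.inv, b.hom, b.inv_hom_id⟩ hB
    · exact isRelProj_tens_of_retract ⟨c.inv, c.hom, c.inv_hom_id⟩ hC
  ext₂ := by
    rintro A B C f g h ⟨X, Y, Z, i, p, hs, e, d, -, -, a, b, c, -⟩ hA hC
    refine isRelProj_tens_of_retract ⟨b.hom, b.inv, b.hom_inv_id⟩
      ((hs.tens_right N).isRelProj₂ ?_ ?_)
    · exact isRelProj_tens_of_retract ⟨a.inv, a.hom, a.inv_hom_id⟩ hA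
    · exact isRelProj_tens_of_retract ⟨c.inv, c.hom, c.inv_hom_id⟩ hC
  ext₃ := by
    rintro A B C f g h ⟨X, Y, Z, i, p, hs, e, d, -, -, a, b, c, -⟩ hA hB
    refine isRelProj_tens_of_retract ⟨c.hom, c.inv, c.hom_inv_id⟩
      ((hs.tens_right N).isRelProj₃ ?_ ?_)
    · exact isRelProj_tens_of_retract ⟨a.inv, a.hom, a.inv_hom_id⟩ hA
    · exact isRelProj_tens_of_retract ⟨b.inv, b.hom, b.inv_hom_id⟩ hB
  retract e h := isRelProj_tens_of_retract e h
  tensor X Y h := (h.tens_left Y.as).retract (tensAssoc Y.as X.as N).hom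
    (tensAssoc Y.as X.as N).inv (tensAssoc Y.as X.as N).hom_inv_id

/-- Tensoring with the suspension of the trivial module is the suspension. -/
theorem nonempty_iso_tens_susp (X : FGRep R G) :
    Nonempty ((toStable (weaklyProjective R G)).obj (tens X (suspObj (trivialRep R G))) ≅
      (susp _).obj ((toStable _).obj X)) := by
  obtain ⟨e⟩ := nonempty_iso_susp (P := weaklyProjective R G)
    ((isSplitSES_unit (trivialRep R G)).tens_left X) ((isRelProj_ind _).tens_left X)
  exact ⟨e ≪≫ (susp _).mapIso ((toStable _).mapIso (tensUnit X))⟩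

end TensorSplit

section Generation

variable {S : Type u} [CommRing S] [IsDomain S] [IsDiscreteValuationRing S] {t : S}
  (ht : Irreducible t) {n : ℕ} (hn : 1 ≤ n) {G : Type u} [Group G] [Fintype G]

theorem isThickTensorIdeal_K : IsThickTensorIdeal (K t n G) := by
  have : K t n G = fun X : StRel (Rn S t n) G => IsRelProj (tens X.as (predRep t n G)) :=
    funext fun X => propext (K_iff (M := X.as))
  rw [this]
  exact isThickTensorIdeal_isRelProj_tens _

variable (t n G) in
/-- The module `W_n`. -/
abbrev WRep : FGRep (Rn S t n) G := normCoker G (unif t n ^ (n - 1))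

variable (t n G) in
/-- The projection from the group algebra to `W_n`. -/
def projW : ind (Rn S t n) G (Rn S t n) ⟶ WRep t n G :=
  mkHom (N := WRep t n G) (Submodule.mkQ _) (fun _ _ => rfl)

theorem projW_surjective : Function.Surjective (lin (projW t n G)) := Submodule.mkQ_surjective _

theorem projW_eq_zero_iff {a : G → Rn S t n} :
    lin (projW t n G) a = 0 ↔ ∃ r : Rn S t n, a = fun _ => r * unif t n ^ (n - 1) := by
  refine (Submodule.Quotient.mk_eq_zero _).trans ?_
  rw [Submodule.mem_span_singleton]
  exact exists_congr fun r => eq_comm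

/-- The `R_n`-split sequence `R_{n-1} → W_n → ΣR_n`. The first map sends `1` to the class of the
norm element `∑ g, g`, and evaluation at `1 ∈ G` is a retraction. -/
theorem exists_isSplitSES_W : ∃ (i : predRep t n G ⟶ WRep t n G)
    (p : WRep t n G ⟶ suspObj (trivialRep (Rn S t n) G)), IsSplitSES i p := by
  have hproj : ∀ a : G → Rn S t n, lin (suspProj (trivialRep (Rn S t n) G)) a = 0 ↔
      ∃ r : Rn S t n, a = fun _ => r := fun a => by
    refine ((isSplitSES_unit (trivialRep (Rn S t n) G)).1.2.1 a).trans ?_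
    exact exists_congr fun r => eq_comm
  let c : trivialRep (Rn S t n) G ⟶ WRep t n G := unit (trivialRep (Rn S t n) G) ≫ projW t n G
  have hc : ∀ r : Rn S t n, lin c r = lin (projW t n G) (fun _ => r) := fun _ => rfl
  let q : trivialRep (Rn S t n) G ⟶ predRep t n G :=
    mkHom (M := trivialRep (Rn S t n) G) (N := predRep t n G) (toPredLin t n) (fun _ _ => rfl)
  obtain ⟨i, hi⟩ := exists_descend q (toPred_surjective S t n) c (fun r hr => by
    obtain ⟨s, rfl⟩ := toPred_eq_zero hr
    rw [hc, projW_eq_zero_iff]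
    exact ⟨s, funext fun _ => mul_comm _ _⟩)
  obtain ⟨p, hp⟩ := exists_descend (projW t n G) projW_surjective
    (suspProj (trivialRep (Rn S t n) G)) (fun a ha => by
      obtain ⟨r, rfl⟩ := projW_eq_zero_iff.1 ha
      exact (hproj _).2 ⟨_, rfl⟩)
  obtain ⟨ρ, hρ⟩ := exists_linear_descend (lin (projW t n G)) projW_surjective
    (toPredLin t n (G := G) ∘ₗ LinearMap.proj (1 : G)) (fun a ha => by
      obtain ⟨r, rfl⟩ := projW_eq_zero_iff.1 ha
      change toPred S t n (r * unif t n ^ (n - 1)) = 0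
      rw [map_mul, toPred_unif_pow, mul_zero])
  have hi' : ∀ r : Rn S t n, lin i (toPredLin t n r) = lin (projW t n G) (fun _ => r) :=
    fun r => hom_congr hi r
  have hp' : ∀ a, lin p (lin (projW t n G) a) = lin (suspProj (trivialRep (Rn S t n) G)) a :=
    hom_congr hp
  have hret : ρ ∘ₗ lin i = LinearMap.id := by
    refine LinearMap.ext fun x => ?_
    obtain ⟨r, rfl⟩ := toPred_surjective S t n x
    exact (congrArg ρ (hi' r)).trans (LinearMap.congr_fun hρ (fun _ => r))
  refine ⟨i, p, isSplitSES_of_retraction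
    ⟨Function.LeftInverse.injective (LinearMap.congr_fun hret), fun w => ?_, fun z => ?_⟩ ρ hret⟩
  · obtain ⟨a, rfl⟩ := projW_surjective w
    rw [hp', hproj]
    constructor
    · rintro ⟨r, rfl⟩
      exact ⟨_, hi' r⟩
    · rintro ⟨x, hx⟩
      obtain ⟨r, rfl⟩ := toPred_surjective S t n x
      have h0 : lin (projW t n G) (a - fun _ => r) = 0 := by
        rw [map_sub, ← hi', sub_eq_zero]
        exact hx.symm
      obtain ⟨s, hs⟩ := projW_eq_zero_iff.1 h0
      exact ⟨s * unif t n ^ (n - 1) + r, eq_add_of_sub_eq hs⟩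
  · obtain ⟨a, rfl⟩ := suspProj_surjective _ z
    exact ⟨_, hp' a⟩

/-- Tensor the sequence `R_{n-1} → W_n → ΣR_n` with `X`: the first term vanishes stably. -/
theorem nonempty_iso_tens_W {X : FGRep (Rn S t n) G} (hX : K t n G ((toStable _).obj X)) :
    Nonempty (tensorObj ((toStable _).obj X) (W t n G) ≅
      (susp (weaklyProjective (Rn S t n) G)).obj ((toStable _).obj X)) := by
  obtain ⟨i, p, h⟩ := exists_isSplitSES_W (t := t) (n := n) (G := G)
  obtain ⟨e⟩ := (h.tens_left X).nonempty_iso (P := weaklyProjective (Rn S t n) G) (K_iff.1 hX)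
  obtain ⟨e'⟩ := nonempty_iso_tens_susp X
  exact ⟨e ≪≫ e'⟩

theorem K_le_thickIdeal : K t n G ≤ thickIdeal (W t n G) := by
  intro X hX Q hQ hW
  obtain ⟨e⟩ := nonempty_iso_tens_W (X := X.as) hX
  exact (hQ.susp_iff X).1 (hQ.iso e (hQ.tensor _ _ hW))

variable (t n G) in
/-- The trivial module `k` over `R_n`. -/
abbrev resRep : FGRep (Rn S t n) G :=
  alongObj (toResidue S ht.not_isUnit hn) (toResidue_surjective S ht.not_isUnit hn)
    (trivialRep (IsLocalRing.ResidueField S) G)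

/-- The sequence `k → A_n → W_n` that defines `W_n`. -/
theorem exists_isSES_W : ∃ j : resRep t ht n hn G ⟶ ind (Rn S t n) G (Rn S t n),
    IsSES j (projW t n G) := by
  let q : trivialRep (Rn S t n) G ⟶ resRep t ht n hn G :=
    mkHom (M := trivialRep (Rn S t n) G) (N := resRep t ht n hn G)
      { toFun := toResidue S ht.not_isUnit hn
        map_add' := map_add _
        map_smul' := fun r x => map_mul (toResidue S ht.not_isUnit hn) r x } (fun _ _ => rfl)
  have hq : Function.Surjective (lin q) := toResidue_surjective S ht.not_isUnit hn
  let c : trivialRep (Rn S t n) G ⟶ ind (Rn S t n) G (Rn S t n) :=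
    mkHom (M := trivialRep (Rn S t n) G) (N := ind (Rn S t n) G (Rn S t n))
      (LinearMap.pi fun _ => LinearMap.toSpanSingleton (Rn S t n) (Rn S t n) (unif t n ^ (n - 1)))
      (fun _ _ => rfl)
  have hc : ∀ r : Rn S t n, lin c r = (fun _ : G => r * unif t n ^ (n - 1)) := fun _ => rfl
  obtain ⟨j, hj⟩ := exists_descend q hq c (fun (r : Rn S t n) hr => by
    obtain ⟨s, rfl⟩ := toResidue_eq_zero ht hn hr
    rw [hc]
    funext _
    rw [mul_right_comm, unif_mul_unif_pow hn, zero_mul]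
    rfl)
  have hj' : ∀ r : Rn S t n, lin j (lin q r) = (fun _ : G => r * unif t n ^ (n - 1)) := hom_congr hj
  refine ⟨j, (injective_iff_map_eq_zero _).2 fun x hx => ?_, fun a => ?_, projW_surjective⟩
  · obtain ⟨r, rfl⟩ := hq x
    change Rn S t n at r
    have h1 : unif t n ^ (n - 1) * r = 0 :=
      (mul_comm _ _).trans (congrFun ((hj' r).symm.trans hx) 1)
    obtain ⟨s, hs⟩ := exists_of_unif_pow_mul_eq_zero ht (Nat.sub_le n 1) h1
    rw [show n - (n - 1) = 1 by omega, pow_one] at hs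
    rw [hs]
    change toResidue S ht.not_isUnit hn (unif t n * s) = 0
    rw [map_mul, toResidue_unif ht hn, zero_mul]
  · rw [projW_eq_zero_iff]
    constructor
    · rintro ⟨r, rfl⟩
      exact ⟨lin q r, hj' r⟩
    · rintro ⟨x, rfl⟩
      obtain ⟨r, rfl⟩ := hq x
      exact ⟨r, hj' r⟩

/-- The syzygy of `W_n` is `k`. -/
theorem nonempty_iso_syzygy_W :
    Nonempty ((syzygy (Rn S t n) G).obj (W t n G) ≅ kObj ht.not_isUnit hn G) := by
  obtain ⟨j, hj⟩ := exists_isSES_W ht hn (G := G)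
  obtain ⟨c, l, -, -, hc⟩ := exists_schanuel (P := weaklyProjective (Rn S t n) G) (isSES_syz _)
    (isProj_cover _) hj (isProj_ind _)
  exact ⟨@asIso _ _ _ _ _ hc⟩

/-- Inflated modules are killed by `t`. -/
theorem alongObj_smul_eq_zero {M : FGRep (IsLocalRing.ResidueField S) G}
    (x : (alongObj (toResidue S ht.not_isUnit hn) (toResidue_surjective S ht.not_isUnit hn)
      M).obj.V) : unif t n • x = 0 := by
  change toResidue S ht.not_isUnit hn (unif t n) • (show M.obj.V from x) = 0
  rw [toResidue_unif ht hn]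
  exact zero_smul _ (show M.obj.V from x)

include ht hn in
/-- The module `W_n` lies in the kernel of base change, as its syzygy `k` is killed by `t`. -/
theorem K_W : K t n G (W t n G) := by
  obtain ⟨e⟩ := nonempty_iso_syzygy_W ht hn (G := G)
  refine (K_iff_syzygy ht hn (M := WRep t n G)).2 (IsStablyKilled.of_iso (N := resRep t ht n hn G)
    (isStablyKilled_of_smul_eq_zero fun x => alongObj_smul_eq_zero ht hn x) e)

include ht hn in
theorem thickIdeal_W_eq : thickIdeal (W t n G) = K t n G :=
  le_antisymm (fun _ hX => hX _ isThickTensorIdeal_K (K_W ht hn)) K_le_thickIdeal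

end Generation

/-! ### The objects stably killed by `t` are the inflated ones -/

section Descent

variable {R R' G : Type u} [CommRing R] [CommRing R'] [Group G] [Fintype G] (φ : R →+* R')
  (hφ : Function.Surjective φ)

/-- A module killed by the kernel of a surjection `R → R'` is a module over `R'`. -/
theorem exists_alongObj_iso (M : FGRep R G) (h : ∀ r, φ r = 0 → ∀ x : M.obj.V, r • x = 0) :
    ∃ N : FGRep R' G, Nonempty (alongObj φ hφ N ≅ M) := by
  let ψ : R' →+* AddMonoid.End M.obj.V := φ.liftOfSurjective hφ
    ⟨Module.toAddMonoidEnd R M.obj.V, fun r hr => RingHom.mem_ker.2 (AddMonoidHom.ext (h r hr))⟩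
  have hψ : ∀ r, ψ (φ r) = Module.toAddMonoidEnd R M.obj.V r :=
    fun r => RingHom.liftOfRightInverse_comp_apply _ _ _ _ r
  let _ : Module R' M.obj.V := Module.compHom _ ψ
  have hsmul : ∀ (r : R) (x : M.obj.V), φ r • x = r • x := fun r x =>
    DFunLike.congr_fun (hψ r) x
  have : RingHomSurjective φ := ⟨hφ⟩
  have : Module.Finite R' M.obj.V := Module.Finite.of_surjective
    ({ toFun := id, map_add' := fun _ _ => rfl, map_smul' := fun r x => (hsmul r x).symm } :
      M.obj.V →ₛₗ[φ] M.obj.V) Function.surjective_id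
  let ρ : Representation R' G M.obj.V :=
    { toFun := fun g =>
        { toFun := M.obj.ρ g
          map_add' := map_add _
          map_smul' := fun r x => by
            obtain ⟨r, rfl⟩ := hφ r
            rw [hsmul, map_smul]
            exact (hsmul r _).symm }
      map_one' := LinearMap.ext fun x => by
        change M.obj.ρ 1 x = x
        rw [map_one]
        rfl
      map_mul' := fun g h => LinearMap.ext fun x => rho_mul M g h x }
  refine ⟨FGRep.of ρ, ⟨⟨mkHom (M := alongObj φ hφ (FGRep.of ρ)) (N := M)
    { toFun := fun x => x
      map_add' := fun _ _ => rfl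
      map_smul' := fun r x => hsmul r x } (fun _ _ => rfl),
    mkHom (M := M) (N := alongObj φ hφ (FGRep.of ρ))
    { toFun := fun x => x
      map_add' := fun _ _ => rfl
      map_smul' := fun r x => (hsmul r x).symm } (fun _ _ => rfl), rfl, rfl⟩⟩⟩

/-- Tensoring an inflated module with the inflated trivial module does not change it. -/
theorem nonempty_iso_tens_along (M : FGRep R' G) :
    Nonempty (tens (alongObj φ hφ M) (alongObj φ hφ (trivialRep R' G)) ≅ alongObj φ hφ M) := by
  let l : Along φ M.obj.V ⊗[R] Along φ R' →ₗ[R] Along φ M.obj.V :=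
    TensorProduct.lift (LinearMap.mk₂ R
      (fun (m : Along φ M.obj.V) (x : Along φ R') =>
        (show Along φ M.obj.V from (show R' from x) • (show M.obj.V from m)))
      (fun m m' x => smul_add (show R' from x) (show M.obj.V from m) (show M.obj.V from m'))
      (fun r m x => smul_comm (show R' from x) (φ r) (show M.obj.V from m))
      (fun m x x' => add_smul (show R' from x) (show R' from x') (show M.obj.V from m))
      (fun r m x => mul_smul (φ r) (show R' from x) (show M.obj.V from m)))
  let f : tens (alongObj φ hφ M) (alongObj φ hφ (trivialRep R' G)) ⟶ alongObj φ hφ M :=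
    mkHom (M := tens (alongObj φ hφ M) (alongObj φ hφ (trivialRep R' G))) (N := alongObj φ hφ M) l
      (fun g => LinearMap.congr_fun (TensorProduct.ext'
        (g := l ∘ₗ (tens (alongObj φ hφ M) (alongObj φ hφ (trivialRep R' G))).obj.ρ g)
        (h := (alongObj φ hφ M).obj.ρ g ∘ₗ l)
        fun m x => (map_smul (M.obj.ρ g) (show R' from x) (show M.obj.V from m)).symm))
  let f' : alongObj φ hφ M ⟶ tens (alongObj φ hφ M) (alongObj φ hφ (trivialRep R' G)) :=
    mkHom (N := tens (alongObj φ hφ M) (alongObj φ hφ (trivialRep R' G))) (M := alongObj φ hφ M)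
      ((TensorProduct.mk R (Along φ M.obj.V) (Along φ R')).flip (1 : R')) (fun _ _ => rfl)
  refine ⟨⟨f, f', ?_, ?_⟩⟩
  · apply lin_injective
    refine TensorProduct.ext' fun (m : Along φ M.obj.V) (x : Along φ R') => ?_
    obtain ⟨r, rfl⟩ := hφ x
    change (r • m) ⊗ₜ[R] (show Along φ R' from (1 : R')) = m ⊗ₜ (show Along φ R' from φ r)
    rw [TensorProduct.smul_tmul]
    congr 1
    exact mul_one (φ r)
  · exact hom_ext' fun (m : M.obj.V) => one_smul R' m

end Descent

section Fitting

variable {R G : Type u} [CommRing R] [Group G] [Fintype G]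

/-- Over an artinian ring, an object stably killed by `r` is stably isomorphic to a module killed
by `r`: if `f` is killed by `r` and stably equal to the identity of `M`, then by Fitting's lemma `M`
is stably isomorphic to the image of a power of `f`. -/
theorem IsStablyKilled.exists_iso [IsArtinianRing R] {r : R} {M : FGRep R G}
    (h : IsStablyKilled r M) : ∃ N : FGRep R G, (∀ x : N.obj.V, r • x = 0) ∧
      Nonempty ((toStable (weaklyProjective R G)).obj N ≅ (toStable _).obj M) := by
  obtain ⟨θ, hθ⟩ := h
  let f : M ⟶ M := 𝟙 M - trHom θ
  have hf : ∀ x, r • lin f x = 0 := by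
    intro x
    rw [tr_smul] at hθ
    change r • (x - tr θ x) = 0
    rw [smul_sub, sub_eq_zero]
    exact LinearMap.congr_fun hθ x
  have hf1 : (toStable (weaklyProjective R G)).map f = 𝟙 _ := by
    rw [Functor.map_sub, stable_map_trHom, sub_zero, CategoryTheory.Functor.map_id]
  have hpow : ∀ N : ℕ, ∃ g : M ⟶ M, lin g = lin f ^ N ∧
      (toStable (weaklyProjective R G)).map g = 𝟙 _ := by
    intro N
    induction N with
    | zero => exact ⟨𝟙 M, rfl, CategoryTheory.Functor.map_id _ _⟩
    | succ N ih =>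
      obtain ⟨g, hg, hg1⟩ := ih
      exact ⟨g ≫ f, by rw [lin_comp, hg, pow_succ']; rfl,
        by rw [Functor.map_comp, hg1, hf1, Category.comp_id]⟩
  -- Fitting's lemma needs a positive power, as the image of `f ^ 0` need not be killed by `r`
  have : IsNoetherian R M.obj.V := inferInstance
  have : IsArtinian R M.obj.V := inferInstance
  obtain ⟨N, hN⟩ := (((lin f).eventually_isCompl_ker_pow_range_pow).and
    (Filter.eventually_ge_atTop 1)).exists
  obtain ⟨g, hg, hg1⟩ := hpow N
  rw [← hg] at hN
  let I : FGRep R G := FGRep.of (V := LinearMap.range (lin g))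
    (M.obj.ρ.subrepresentation (LinearMap.range (lin g)) (by
      rintro a _ ⟨x, rfl⟩
      exact ⟨M.obj.ρ a x, lin_equivariant g a x⟩))
  let i : I ⟶ M := mkHom (M := I) (LinearMap.range (lin g)).subtype (fun _ _ => rfl)
  let p : M ⟶ I := mkHom (N := I) (lin g).rangeRestrict
    (fun a x => Subtype.ext (lin_equivariant g a x))
  have hpi : p ≫ i = g := rfl
  have hip : Function.Surjective (lin (i ≫ p)) := by
    rintro ⟨_, x, rfl⟩
    have hx : x ∈ LinearMap.ker (lin g) ⊔ LinearMap.range (lin g) := by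
      rw [hN.1.sup_eq_top]
      trivial
    obtain ⟨y, hy, z, hz, rfl⟩ := Submodule.mem_sup.1 hx
    refine ⟨⟨z, hz⟩, Subtype.ext ?_⟩
    change lin g z = lin g (y + z)
    rw [map_add, LinearMap.mem_ker.1 hy, zero_add]
  obtain ⟨q, hq⟩ := exists_descend (i ≫ p) hip (𝟙 I) (fun x hx => by
    have h1 : lin g x.1 = 0 := congrArg Subtype.val hx
    have h2 : x.1 ∈ LinearMap.ker (lin g) ⊓ LinearMap.range (lin g) := ⟨h1, x.2⟩
    rw [hN.1.inf_eq_bot] at h2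
    exact Subtype.ext h2)
  have hpi' : (toStable (weaklyProjective R G)).map p ≫ (toStable _).map i = 𝟙 _ := by
    rw [← Functor.map_comp, hpi, hg1]
  have hq' : (toStable (weaklyProjective R G)).map i ≫ (toStable _).map p ≫
      (toStable _).map q = 𝟙 _ := by
    rw [← Functor.map_comp, ← Functor.map_comp, ← Category.assoc, hq,
      CategoryTheory.Functor.map_id]
  have hpq : (toStable (weaklyProjective R G)).map p ≫ (toStable _).map q =
      (toStable _).map p := by
    have := congrArg (fun w => (toStable (weaklyProjective R G)).map p ≫ w) hq'
    rwa [← Category.assoc, hpi', Category.id_comp, Category.comp_id] at this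
  rw [hpq] at hq'
  refine ⟨I, ?_, ⟨⟨(toStable _).map i, (toStable _).map p, hq', hpi'⟩⟩⟩
  rintro ⟨_, x, rfl⟩
  refine Subtype.ext ?_
  change r • lin g x = 0
  rw [hg, ← Nat.sub_add_cancel hN.2, pow_succ']
  exact hf _

end Fitting

section Inflated

variable {S : Type u} [CommRing S] [IsDomain S] [IsDiscreteValuationRing S] {t : S}
  (ht : Irreducible t) {n : ℕ} (hn : 1 ≤ n) {G : Type u} [Group G] [Fintype G]

/-- An object is stably killed by `t` if and only if it is isomorphic to an inflated `kG`-module. -/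
theorem isStablyKilled_iff_essImage {Y : StRel (Rn S t n) G} :
    IsStablyKilled (unif t n) Y.as ↔ (inflateResidue ht.not_isUnit hn G).essImage Y := by
  constructor
  · intro h
    have := isArtinianRing_Rn ht hn
    obtain ⟨N, hN, ⟨e⟩⟩ := h.exists_iso
    obtain ⟨N', ⟨e'⟩⟩ := exists_alongObj_iso (toResidue S ht.not_isUnit hn)
      (toResidue_surjective S ht.not_isUnit hn) N (fun r hr x => by
        obtain ⟨s, rfl⟩ := toResidue_eq_zero ht hn hr
        rw [mul_comm, mul_smul, hN, smul_zero])
    exact ⟨(toStable _).obj N', ⟨(toStable _).mapIso e' ≪≫ e⟩⟩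
  · rintro ⟨X, ⟨e⟩⟩
    exact IsStablyKilled.of_iso (isStablyKilled_of_smul_eq_zero fun x =>
      alongObj_smul_eq_zero ht hn (M := X.as) x) e.symm

include ht in
theorem exists_syzygy_iso_obj (Y : StRel (Rn S t n) G) :
    ∃ X, Nonempty ((syzygy (Rn S t n) G).obj X ≅ Y) := by
  obtain ⟨m, j, hj⟩ := exists_embedding ht (n := n) Y.as.obj.V
  exact exists_syzygy_iso Y.as j hj

include ht hn in
theorem K_iff_of_iso {X Y : StRel (Rn S t n) G} (e : (syzygy (Rn S t n) G).obj X ≅ Y) :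
    K t n G X ↔ IsStablyKilled (unif t n) Y.as := by
  refine (K_iff_syzygy ht hn (M := X.as)).trans ⟨fun h => ?_, fun h => ?_⟩
  · exact IsStablyKilled.of_iso h e.symm
  · exact IsStablyKilled.of_iso h e

/-- A full functor that commutes with the suspensions and reflects the distinguished triangles lifts
every distinguished triangle between objects of its image. -/
theorem exists_dist_lift {C D : Type*} [Category* C] [Category* D] (S : TriData C) (T : TriData D)
    (F : C ⥤ D) [F.Full] (comm : S.susp ⋙ F ≅ F ⋙ T.susp)
    (hF : ∀ {X Y Z : C} (f : X ⟶ Y) (g : Y ⟶ Z) (h : Z ⟶ S.susp.obj X),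
      T.dist (F.map f) (F.map g) (F.map h ≫ comm.hom.app X) → S.dist f g h)
    (hT : ∀ {A B C A' B' C' : D} (a : A ≅ A') (b : B ≅ B') (c : C ≅ C') {f : A ⟶ B} {g : B ⟶ C}
      {h : C ⟶ T.susp.obj A} {f' : A' ⟶ B'} {g' : B' ⟶ C'} {h' : C' ⟶ T.susp.obj A'},
      f ≫ b.hom = a.hom ≫ f' → g ≫ c.hom = b.hom ≫ g' → h ≫ T.susp.map a.hom = c.hom ≫ h' →
      T.dist f' g' h' → T.dist f g h)
    {X Y Z : C} {A B E : D} (a : F.obj X ≅ A) (b : F.obj Y ≅ B) (c : F.obj Z ≅ E)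
    {f : A ⟶ B} {g : B ⟶ E} {h : E ⟶ T.susp.obj A} (hd : T.dist f g h) :
    ∃ (f' : X ⟶ Y) (g' : Y ⟶ Z) (h' : Z ⟶ S.susp.obj X), S.dist f' g' h' := by
  obtain ⟨f', hf'⟩ := F.map_surjective (a.hom ≫ f ≫ b.inv)
  obtain ⟨g', hg'⟩ := F.map_surjective (b.hom ≫ g ≫ c.inv)
  obtain ⟨h', hh'⟩ := F.map_surjective (c.hom ≫ h ≫ T.susp.map a.inv ≫ comm.inv.app X)
  refine ⟨f', g', h', hF f' g' h' (hT a b c ?_ ?_ ?_ hd)⟩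
  · simp [hf']
  · simp [hg']
  · have h2 : T.susp.map a.inv ≫ T.susp.map a.hom = 𝟙 _ := by
      rw [← Functor.map_comp, a.inv_hom_id, CategoryTheory.Functor.map_id]
    simp [hh', h2]

include ht in
/-- Every distinguished triangle is the syzygy of one. -/
theorem exists_syzygy_triangle {A B C : StRel (Rn S t n) G} {f : A ⟶ B} {g : B ⟶ C}
    {h : C ⟶ (relTri (Rn S t n) G).susp.obj A} (hd : (relTri (Rn S t n) G).dist f g h) :
    ∃ (A' B' C' : StRel (Rn S t n) G) (f' : A' ⟶ B') (g' : B' ⟶ C')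
      (h' : C' ⟶ (relTri (Rn S t n) G).susp.obj A'), (relTri (Rn S t n) G).dist f' g' h' ∧
      Nonempty ((syzygy (Rn S t n) G).obj A' ≅ A) ∧ Nonempty ((syzygy (Rn S t n) G).obj B' ≅ B) ∧
      Nonempty ((syzygy (Rn S t n) G).obj C' ≅ C) := by
  obtain ⟨A', ⟨a⟩⟩ := exists_syzygy_iso_obj ht A
  obtain ⟨B', ⟨b⟩⟩ := exists_syzygy_iso_obj ht B
  obtain ⟨C', ⟨c⟩⟩ := exists_syzygy_iso_obj ht C
  have hR : Module.Baer (Rn S t n) (Rn S t n) := baer_self ht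
  have := syzygy_full (G := G) hR
  obtain ⟨f', g', h', hd'⟩ := exists_dist_lift (relTri (Rn S t n) G) (relTri (Rn S t n) G)
    (syzygy (Rn S t n) G) syzygyComm (syzygy_reflects_dist hR) splitTri_dist_of_iso a b c hd
  exact ⟨A', B', C', f', g', h', hd', ⟨a⟩, ⟨b⟩, ⟨c⟩⟩

/-- A functor that commutes with the suspensions takes `ΣX` to `ΣY` if it takes `X` to `Y`. -/
def suspIso {C D : Type*} [Category* C] [Category* D] {S : C ⥤ C} {T : D ⥤ D} {F : C ⥤ D}
    (comm : S ⋙ F ≅ F ⋙ T) {X : C} {Y : D} (e : F.obj X ≅ Y) : F.obj (S.obj X) ≅ T.obj Y :=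
  comm.app X ≪≫ T.mapIso e

include ht hn in
/-- The syzygy functor transports the kernel of base change to the objects stably killed by `t`, so
these form a thick subcategory. -/
theorem isThickTensorIdeal_isStablyKilled :
    IsThickTensorIdeal (fun Y : StRel (Rn S t n) G => IsStablyKilled (unif t n) Y.as) where
  zero X hX := isStablyKilled_of_isRelProj (isZero_stable_iff.1 hX)
  iso e h := IsStablyKilled.of_iso h e.symm
  susp_iff Y := by
    obtain ⟨X, ⟨e⟩⟩ := exists_syzygy_iso_obj ht Y
    rw [← K_iff_of_iso ht hn e, ← isThickTensorIdeal_K.susp_iff X]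
    exact (K_iff_of_iso ht hn (suspIso syzygyComm e)).symm
  ext₁ f g h hd := by
    obtain ⟨A, B, C, f', g', h', hd', ⟨a⟩, ⟨b⟩, ⟨c⟩⟩ := exists_syzygy_triangle ht hd
    rw [← K_iff_of_iso ht hn a, ← K_iff_of_iso ht hn b, ← K_iff_of_iso ht hn c]
    exact isThickTensorIdeal_K.ext₁ f' g' h' hd'
  ext₂ f g h hd := by
    obtain ⟨A, B, C, f', g', h', hd', ⟨a⟩, ⟨b⟩, ⟨c⟩⟩ := exists_syzygy_triangle ht hd
    rw [← K_iff_of_iso ht hn a, ← K_iff_of_iso ht hn b, ← K_iff_of_iso ht hn c]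
    exact isThickTensorIdeal_K.ext₂ f' g' h' hd'
  ext₃ f g h hd := by
    obtain ⟨A, B, C, f', g', h', hd', ⟨a⟩, ⟨b⟩, ⟨c⟩⟩ := exists_syzygy_triangle ht hd
    rw [← K_iff_of_iso ht hn a, ← K_iff_of_iso ht hn b, ← K_iff_of_iso ht hn c]
    exact isThickTensorIdeal_K.ext₃ f' g' h' hd'
  retract e h := IsStablyKilled.of_retract h e
  tensor X Y h := h.tens Y.as

/-- The thick tensor ideal of `k` consists of the inflated modules: these form a thick tensor ideal,
and an inflated module `M` is `M ⊗ k`. -/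
theorem thickIdeal_k_eq :
    thickIdeal (kObj ht.not_isUnit hn G) = (inflateResidue ht.not_isUnit hn G).essImage := by
  refine le_antisymm (fun Y hY => ?_) ?_
  · refine (isStablyKilled_iff_essImage ht hn).1
      (hY _ (isThickTensorIdeal_isStablyKilled ht hn) ?_)
    exact isStablyKilled_of_smul_eq_zero fun x => alongObj_smul_eq_zero ht hn x
  · rintro Y ⟨X, ⟨e⟩⟩ Q hQ hk
    obtain ⟨e'⟩ := nonempty_iso_tens_along (toResidue S ht.not_isUnit hn)
      (toResidue_surjective S ht.not_isUnit hn) X.as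
    refine hQ.iso e (hQ.iso ((toStable _).mapIso e') ?_)
    exact hQ.tensor _ ((toStable _).obj (alongObj (toResidue S ht.not_isUnit hn)
      (toResidue_surjective S ht.not_isUnit hn) X.as)) hk

/-- The syzygy functor maps the kernel of base change onto the inflated modules. -/
theorem syzygy_K_iff (Y : StRel (Rn S t n) G) :
    (∃ X, K t n G X ∧ Nonempty ((syzygy (Rn S t n) G).obj X ≅ Y)) ↔
      (inflateResidue ht.not_isUnit hn G).essImage Y := by
  rw [← isStablyKilled_iff_essImage ht hn]
  constructor
  · rintro ⟨X, hX, ⟨e⟩⟩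
    exact (K_iff_of_iso ht hn e).1 hX
  · intro h
    obtain ⟨X, ⟨e⟩⟩ := exists_syzygy_iso_obj ht Y
    exact ⟨X, (K_iff_of_iso ht hn e).2 h, ⟨e⟩⟩

/-- The syzygy functor is an equivalence from the thick tensor ideal of `W_n` to that of `k`. -/
theorem exists_triEquiv_syzygy :
    ∃ E : TriEquiv (thickTri (W t n G)) (thickTri (kObj ht.not_isUnit hn G)),
      Nonempty (E.equiv.functor ⋙ (thickIdeal (kObj ht.not_isUnit hn G)).ι ≅
        (thickIdeal (W t n G)).ι ⋙ syzygy (Rn S t n) G) := by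
  have hR : Module.Baer (Rn S t n) (Rn S t n) := baer_self ht
  have := syzygy_full (G := G) hR
  have := syzygy_faithful (G := G) hR
  refine exists_triEquiv (thickTri (W t n G)) (relTri (Rn S t n) G) _ _
    ((thickIdeal (W t n G)).ι ⋙ syzygy (Rn S t n) G)
    (NatIso.ofComponents (fun X => syzygyComm.app X.obj)
      (fun f => syzygyComm.hom.naturality f.hom)) (fun f g h => ?_) (fun X => ?_) (fun Y hY => ?_)
  · exact ⟨fun hd => syzygy_preserves_dist hd, fun hd => syzygy_reflects_dist hR _ _ _ hd⟩
  · rw [thickIdeal_k_eq ht hn]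
    refine (syzygy_K_iff ht hn _).1 ⟨X.obj, ?_, ⟨Iso.refl _⟩⟩
    rw [← thickIdeal_W_eq ht hn]
    exact X.property
  · rw [thickIdeal_k_eq ht hn] at hY
    obtain ⟨X, hX, e⟩ := (syzygy_K_iff ht hn Y).2 hY
    rw [← thickIdeal_W_eq ht hn] at hX
    exact ⟨⟨X, hX⟩, e⟩

end Inflated

/-! ### Inflation from the residue field is triangulated -/

section Inflation

variable {R R' G : Type u} [CommRing R] [CommRing R'] [Group G] [Fintype G] (φ : R →+* R')
  (hφ : Function.Surjective φ)

include hφ in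
/-- Restriction of scalars along a surjection is full. -/
theorem exists_eq_alongMap {M N : Type u} [AddCommGroup M] [Module R' M] [AddCommGroup N]
    [Module R' N] (θ : Along φ M →ₗ[R] Along φ N) :
    ∃ θ' : M →ₗ[R'] N, alongMap φ θ' = θ :=
  ⟨{ toFun := θ
     map_add' := θ.map_add
     map_smul' := fun r x => by
      obtain ⟨r, rfl⟩ := hφ r
      exact θ.map_smul r x }, rfl⟩

/-- Inflation commutes with induction. -/
def alongInd (M : FGRep R' G) :
    alongObj φ hφ (ind R' G M.obj.V) ⟶ ind R G (alongObj φ hφ M).obj.V :=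
  mkHom (M := alongObj φ hφ (ind R' G M.obj.V)) (N := ind R G (alongObj φ hφ M).obj.V)
    { toFun := fun a => a
      map_add' := fun _ _ => rfl
      map_smul' := fun _ _ => rfl } (fun _ _ => rfl)

/-- The suspension of `M` is the same quotient of the functions `G → M` over both rings. -/
theorem alongHom_suspProj_eq_zero_iff {M : FGRep R' G} {a : G → M.obj.V} :
    lin (alongHom φ hφ (suspProj M)) a = 0 ↔ lin (suspProj (alongObj φ hφ M)) a = 0 :=
  ((isSplitSES_unit M).1.2.1 a).trans ((isSplitSES_unit (alongObj φ hφ M)).1.2.1 a).symm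

theorem exists_alongSusp (M : FGRep R' G) :
    ∃ f : alongObj φ hφ (suspObj M) ⟶ suspObj (alongObj φ hφ M),
      alongHom φ hφ (suspProj M) ≫ f =
        alongInd φ hφ M ≫ suspProj (alongObj φ hφ M) ∧
      Function.Bijective (lin f) := by
  obtain ⟨f, hf⟩ := exists_descend (alongHom φ hφ (suspProj M)) (suspProj_surjective M)
    (alongInd φ hφ M ≫ suspProj (alongObj φ hφ M))
    (fun a ha => (alongHom_suspProj_eq_zero_iff φ hφ).1 ha)
  refine ⟨f, hf, (injective_iff_map_eq_zero _).2 fun x hx => ?_, fun y => ?_⟩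
  · obtain ⟨a, rfl⟩ := suspProj_surjective M x
    exact (alongHom_suspProj_eq_zero_iff φ hφ).2 ((hom_congr hf a).symm.trans hx)
  · obtain ⟨a, rfl⟩ := suspProj_surjective (alongObj φ hφ M) y
    exact ⟨_, hom_congr hf a⟩

/-- Inflation commutes with the suspension. -/
def alongSusp (M : FGRep R' G) : alongObj φ hφ (suspObj M) ⟶ suspObj (alongObj φ hφ M) :=
  (exists_alongSusp φ hφ M).choose

theorem suspProj_alongSusp (M : FGRep R' G) : alongHom φ hφ (suspProj M) ≫ alongSusp φ hφ M =
    alongInd φ hφ M ≫ suspProj (alongObj φ hφ M) :=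
  (exists_alongSusp φ hφ M).choose_spec.1

theorem isIso_of_bijective {M N : FGRep R G} (f : M ⟶ N) (hf : Function.Bijective (lin f)) :
    IsIso f := by
  obtain ⟨g, hg⟩ := exists_descend f hf.2 (𝟙 M) (fun x hx => hf.1 (hx.trans (map_zero _).symm))
  refine ⟨g, hg, cancel_surjective f hf.2 ?_⟩
  rw [← Category.assoc, hg, Category.id_comp, Category.comp_id]

instance (M : FGRep R' G) : IsIso (alongSusp φ hφ M) :=
  isIso_of_bijective _ (exists_alongSusp φ hφ M).choose_spec.2

theorem alongSusp_natural {M N : FGRep R' G} (f : M ⟶ N) :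
    alongHom φ hφ (suspMap f) ≫ alongSusp φ hφ N = alongSusp φ hφ M ≫ suspMap (alongHom φ hφ f) := by
  refine cancel_surjective (alongHom φ hφ (suspProj M)) (suspProj_surjective M)
    (hom_ext' fun (a : G → M.obj.V) => ?_)
  have h1 : lin (suspMap f) (lin (suspProj M) a) = lin (suspProj N) (lin (indMap f) a) :=
    hom_congr (suspProj_suspMap f) a
  have h2 : lin (alongSusp φ hφ N) (lin (suspProj N) (lin (indMap f) a)) =
      lin (suspProj (alongObj φ hφ N)) (lin (indMap f) a) :=
    hom_congr (suspProj_alongSusp φ hφ N) _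
  have h3 : lin (alongSusp φ hφ M) (lin (suspProj M) a) = lin (suspProj (alongObj φ hφ M)) a :=
    hom_congr (suspProj_alongSusp φ hφ M) _
  have h4 : lin (suspMap (alongHom φ hφ f)) (lin (suspProj (alongObj φ hφ M)) a) =
      lin (suspProj (alongObj φ hφ N)) (lin (indMap (alongHom φ hφ f)) a) :=
    hom_congr (suspProj_suspMap (alongHom φ hφ f)) a
  exact ((congrArg (lin (alongSusp φ hφ N)) h1).trans h2).trans
    ((congrArg (lin (suspMap (alongHom φ hφ f))) h3).trans h4).symm

theorem IsSplitSES.along {X Y Z : FGRep R' G} {i : X ⟶ Y} {p : Y ⟶ Z} (h : IsSplitSES i p) :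
    IsSplitSES (alongHom φ hφ i) (alongHom φ hφ p) := by
  obtain ⟨h, s, hs⟩ := h
  exact ⟨h, alongMap φ (M := Z.obj.V) (N := Y.obj.V) s,
    LinearMap.ext fun x => LinearMap.congr_fun hs x⟩

variable (P : ObjectProperty (FGRep R' G)) [TraceClass P]

theorem inflate_full : (inflate φ hφ P).Full where
  map_surjective {X Y} g := by
    obtain ⟨g, rfl⟩ := exists_rep (M := alongObj φ hφ X.as) (N := alongObj φ hφ Y.as) g
    obtain ⟨θ, hθ⟩ := exists_eq_alongMap φ hφ (M := X.as.obj.V) (N := Y.as.obj.V) (lin g)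
    have hθ' : ∀ x, θ x = lin g x := LinearMap.congr_fun hθ
    exact ⟨(toStable P).map (mkHom θ fun a x =>
      (hθ' _).trans ((lin_equivariant g a x).trans (congrArg _ (hθ' x).symm))),
      congrArg (toStable (weaklyProjective R G)).map (lin_injective hθ)⟩

theorem inflate_faithful : (inflate φ hφ P).Faithful where
  map_injective {X Y f g} h := by
    obtain ⟨X⟩ := X
    obtain ⟨Y⟩ := Y
    obtain ⟨f, rfl⟩ := exists_rep f
    obtain ⟨g, rfl⟩ := exists_rep g
    obtain ⟨θ, hθ⟩ := stable_map_eq_iff.1 (show (toStable (weaklyProjective R G)).map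
      (alongHom φ hφ f) = (toStable _).map (alongHom φ hφ g) from h)
    obtain ⟨θ, rfl⟩ := exists_eq_alongMap φ hφ (M := X.obj.V) (N := Y.obj.V) θ
    rw [← alongMap_tr φ hφ (M := X) (N := Y)] at hθ
    exact stable_map_eq_iff.2 ⟨θ, LinearMap.ext fun x => LinearMap.congr_fun hθ x⟩

instance inflate_additive : (inflate φ hφ P).Additive where
  map_add {X Y f g} := by
    obtain ⟨X⟩ := X
    obtain ⟨Y⟩ := Y
    obtain ⟨f, rfl⟩ := exists_rep f
    obtain ⟨g, rfl⟩ := exists_rep g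
    rw [← Functor.map_add]
    exact (toStable (weaklyProjective R G)).map_add (f := alongHom φ hφ f) (g := alongHom φ hφ g)

/-- The natural isomorphism between the inflation of the suspension and the suspension of the
inflation. -/
def inflateComm : susp P ⋙ inflate φ hφ P ≅ inflate φ hφ P ⋙ susp (weaklyProjective R G) :=
  NatIso.ofComponents
    (fun X => ((toStable (weaklyProjective R G)).mapIso (asIso (alongSusp φ hφ X.as)) :
      (toStable (weaklyProjective R G)).obj (alongObj φ hφ (suspObj X.as)) ≅
        (toStable (weaklyProjective R G)).obj (suspObj (alongObj φ hφ X.as)))) (by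
    intro X Y f
    obtain ⟨X⟩ := X
    obtain ⟨Y⟩ := Y
    obtain ⟨f, rfl⟩ := exists_rep f
    have := congrArg (toStable (weaklyProjective R G)).map (alongSusp_natural φ hφ f)
    rw [Functor.map_comp, Functor.map_comp] at this
    exact this)

/-- Inflation preserves the triangles that come from split sequences. -/
theorem inflate_standard {X Y Z : FGRep R' G} {i : X ⟶ Y} {p : Y ⟶ Z} {e : Y ⟶ ind R' G X.obj.V}
    {d : Z ⟶ suspObj X} (h : IsSplitSES i p) (he : i ≫ e = unit X)
    (hd : p ≫ d = e ≫ suspProj X) :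
    (splitTri (weaklyProjective R G)).dist ((inflate φ hφ P).map ((toStable P).map i))
      ((inflate φ hφ P).map ((toStable P).map p))
      ((inflate φ hφ P).map (toSusp d) ≫ (inflateComm φ hφ P).hom.app _) := by
  have h1 := dist_of_isSplitSES (P := weaklyProjective R G) (h.along φ hφ)
    (e := alongHom φ hφ e ≫ alongInd φ hφ X)
    (d := alongHom φ hφ d ≫ alongSusp φ hφ X)
    (hom_ext' fun x => hom_congr he x) (hom_ext' fun x => by
      have h2 : lin d (lin p x) = lin (suspProj X) (lin e x) := hom_congr hd x
      exact (congrArg (lin (alongSusp φ hφ X)) h2).trans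
        (hom_congr (suspProj_alongSusp φ hφ X) (lin e x)))
  have h3 : (inflate φ hφ P).map (toSusp d) ≫ (inflateComm φ hφ P).hom.app _ =
      toSusp (alongHom φ hφ d ≫ alongSusp φ hφ X) :=
    ((toStable (weaklyProjective R G)).map_comp (alongHom φ hφ d) (alongSusp φ hφ X)).symm
  exact (congrArg (fun w => (splitTri (weaklyProjective R G)).dist
    ((inflate φ hφ P).map ((toStable P).map i)) ((inflate φ hφ P).map ((toStable P).map p)) w)
    h3).mpr h1

theorem inflate_dist_iff {A B C : Stable P} (f : A ⟶ B) (g : B ⟶ C) (h : C ⟶ (susp P).obj A) :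
    (splitTri P).dist f g h ↔ (relTri R G).dist ((inflate φ hφ P).map f) ((inflate φ hφ P).map g)
      ((inflate φ hφ P).map h ≫ (inflateComm φ hφ P).hom.app A) := by
  have := inflate_full φ hφ P
  have := inflate_faithful φ hφ P
  have hF : ∀ {A B C : Stable P} {f : A ⟶ B} {g : B ⟶ C} {h : C ⟶ (susp P).obj A},
      (splitTri P).dist f g h → (splitTri (weaklyProjective R G)).dist ((inflate φ hφ P).map f)
        ((inflate φ hφ P).map g) ((inflate φ hφ P).map h ≫ (inflateComm φ hφ P).hom.app A) :=
    preserves_dist_of_standard (inflate φ hφ P) (inflateComm φ hφ P)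
      (fun h he hd => inflate_standard φ hφ P h he hd)
  exact ⟨hF, dist_reflects (splitTri P) (relTri R G) (inflate φ hφ P) (inflateComm φ hφ P)
    hF (fun f => splitTri_exists_dist f)
    (fun c g' h' h₁ h₂ hd => splitTri_dist_of_iso (Iso.refl _) (Iso.refl _) c (by simp)
      (by simpa using h₁) (comp_map_id_eq' _ h₂) hd)
    (fun hd hd' => splitTri_unique hd hd') f g h⟩

end Inflation

section Residue

/-- Over a field every short exact sequence splits linearly. -/
theorem isSES_eq_isSplitSES (k G : Type u) [Field k] [Group G] [Fintype G] :
    (@IsSES k G _ _) = @IsSplitSES k G _ _ := by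
  funext X Y Z i p
  refine propext ⟨fun h => ⟨h, ?_⟩, fun h => h.1⟩
  exact (lin p).exists_rightInverse_of_surjective (LinearMap.range_eq_top.2 h.2.2)

theorem stTri_eq (k G : Type u) [Field k] [Group G] [Fintype G] :
    stTri k G = splitTri (projectiveObj k G) :=
  congrArg (triData (projectiveObj k G)) (isSES_eq_isSplitSES k G)

variable {S : Type u} [CommRing S] [IsDomain S] [IsDiscreteValuationRing S] {t : S}
  (ht : Irreducible t) {n : ℕ} (hn : 1 ≤ n) {G : Type u} [Group G] [Fintype G]

/-- Inflation is an equivalence of triangulated categories from `stmod kG` to the thick tensor ideal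
of `k`. -/
theorem exists_triEquiv_inflate :
    ∃ E : TriEquiv (stTri (IsLocalRing.ResidueField S) G) (thickTri (kObj ht.not_isUnit hn G)),
      Nonempty (E.equiv.functor ⋙ (thickIdeal (kObj ht.not_isUnit hn G)).ι ≅
        inflateResidue ht.not_isUnit hn G) := by
  rw [stTri_eq]
  have : (inflateResidue ht.not_isUnit hn G).Full := inflate_full _ _ _
  have : (inflateResidue ht.not_isUnit hn G).Faithful := inflate_faithful _ _ _
  have : (inflateResidue ht.not_isUnit hn G).Additive := inflate_additive _ _ _
  refine exists_triEquiv (splitTri (projectiveObj (IsLocalRing.ResidueField S) G))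
    (relTri (Rn S t n) G) _ _ (inflateResidue ht.not_isUnit hn G)
    (inflateComm _ (toResidue_surjective S ht.not_isUnit hn) _)
    (inflate_dist_iff _ (toResidue_surjective S ht.not_isUnit hn) _) (fun X => ?_) (fun Y hY => ?_)
  · rw [thickIdeal_k_eq ht hn]
    exact ⟨X, ⟨Iso.refl _⟩⟩
  · rwa [thickIdeal_k_eq ht hn] at hY

end Residue

/-! ### The equivalence is not monoidal -/

section TensorIso

variable {R G : Type u} [CommRing R] [Group G] [Fintype G]

theorem stable_map_tensMap_left {M M' : FGRep R G} (N : FGRep R G) {f f' : M ⟶ M'}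
    (h : (toStable (weaklyProjective R G)).map f = (toStable _).map f') :
    (toStable (weaklyProjective R G)).map (tensMap f (𝟙 N)) =
      (toStable _).map (tensMap f' (𝟙 N)) := by
  obtain ⟨θ, hθ⟩ := stable_map_eq_iff.1 h
  refine stable_map_eq_iff.2 ⟨TensorProduct.map θ (lin (𝟙 N)), ?_⟩
  rw [tr_map_left, ← hθ]
  refine TensorProduct.ext' fun x y => ?_
  change lin f x ⊗ₜ y - lin f' x ⊗ₜ y = (lin f x - lin f' x) ⊗ₜ[R] y
  rw [TensorProduct.sub_tmul]

theorem stable_map_tensMap_right {M M' : FGRep R G} (N : FGRep R G) {f f' : M ⟶ M'}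
    (h : (toStable (weaklyProjective R G)).map f = (toStable _).map f') :
    (toStable (weaklyProjective R G)).map (tensMap (𝟙 N) f) =
      (toStable _).map (tensMap (𝟙 N) f') := by
  obtain ⟨θ, hθ⟩ := stable_map_eq_iff.1 h
  refine stable_map_eq_iff.2 ⟨TensorProduct.map (lin (𝟙 N)) θ, ?_⟩
  rw [tr_map_right, ← hθ]
  refine TensorProduct.ext' fun x y => ?_
  change x ⊗ₜ lin f y - x ⊗ₜ lin f' y = x ⊗ₜ[R] (lin f y - lin f' y)
  rw [TensorProduct.tmul_sub]

theorem tensMap_comp {M N K M' N' K' : FGRep R G} (f : M ⟶ N) (g : N ⟶ K) (f' : M' ⟶ N')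
    (g' : N' ⟶ K') : tensMap f f' ≫ tensMap g g' = tensMap (f ≫ g) (f' ≫ g') :=
  lin_injective (TensorProduct.map_comp _ _ _ _).symm

theorem tensMap_id (M N : FGRep R G) : tensMap (𝟙 M) (𝟙 N) = 𝟙 (tens M N) :=
  lin_injective TensorProduct.map_id

theorem nonempty_iso_tens_left {M M' : FGRep R G} (N : FGRep R G)
    (e : (toStable (weaklyProjective R G)).obj M ≅ (toStable _).obj M') :
    Nonempty ((toStable (weaklyProjective R G)).obj (tens M N) ≅
      (toStable _).obj (tens M' N)) := by
  obtain ⟨f, hf⟩ := exists_rep e.hom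
  obtain ⟨g, hg⟩ := exists_rep e.inv
  have h₁ : (toStable (weaklyProjective R G)).map (f ≫ g) = (toStable _).map (𝟙 M) := by
    rw [Functor.map_comp, hf, hg, e.hom_inv_id, CategoryTheory.Functor.map_id]
  have h₂ : (toStable (weaklyProjective R G)).map (g ≫ f) = (toStable _).map (𝟙 M') := by
    rw [Functor.map_comp, hf, hg, e.inv_hom_id, CategoryTheory.Functor.map_id]
  refine ⟨⟨(toStable _).map (tensMap f (𝟙 N)), (toStable _).map (tensMap g (𝟙 N)), ?_, ?_⟩⟩
  · rw [← Functor.map_comp, tensMap_comp, Category.comp_id, stable_map_tensMap_left N h₁,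
      tensMap_id, CategoryTheory.Functor.map_id]
  · rw [← Functor.map_comp, tensMap_comp, Category.comp_id, stable_map_tensMap_left N h₂,
      tensMap_id, CategoryTheory.Functor.map_id]

theorem nonempty_iso_tens_right {M M' : FGRep R G} (N : FGRep R G)
    (e : (toStable (weaklyProjective R G)).obj M ≅ (toStable _).obj M') :
    Nonempty ((toStable (weaklyProjective R G)).obj (tens N M) ≅
      (toStable _).obj (tens N M')) := by
  obtain ⟨f, hf⟩ := exists_rep e.hom
  obtain ⟨g, hg⟩ := exists_rep e.inv
  have h₁ : (toStable (weaklyProjective R G)).map (f ≫ g) = (toStable _).map (𝟙 M) := by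
    rw [Functor.map_comp, hf, hg, e.hom_inv_id, CategoryTheory.Functor.map_id]
  have h₂ : (toStable (weaklyProjective R G)).map (g ≫ f) = (toStable _).map (𝟙 M') := by
    rw [Functor.map_comp, hf, hg, e.inv_hom_id, CategoryTheory.Functor.map_id]
  refine ⟨⟨(toStable _).map (tensMap (𝟙 N) f), (toStable _).map (tensMap (𝟙 N) g), ?_, ?_⟩⟩
  · rw [← Functor.map_comp, tensMap_comp, Category.comp_id, stable_map_tensMap_right N h₁,
      tensMap_id, CategoryTheory.Functor.map_id]
  · rw [← Functor.map_comp, tensMap_comp, Category.comp_id, stable_map_tensMap_right N h₂,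
      tensMap_id, CategoryTheory.Functor.map_id]

end TensorIso

section CyclicGroup

/-- For the group of order three, a nonzero trivial module killed by `3` is not isomorphic to its
suspension: maps `M → ΣM → M` compose to zero, since the invariants of `ΣM` are the classes of
the affine functions on `ℤ/3`, and the sum of the values of such a function is zero. As the trace
vanishes on linear endomorphisms of `M`, such a composite cannot be stably the identity. -/
theorem eq_zero_of_iso_susp {R : Type} [CommRing R] {M : FGRep R (Multiplicative (ZMod 3))}
    (hM : ∀ g x, M.obj.ρ g x = x) (h3 : ∀ x : M.obj.V, (3 : ℕ) • x = 0)
    (e : (toStable (weaklyProjective R (Multiplicative (ZMod 3)))).obj M ≅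
      (susp _).obj ((toStable _).obj M)) (x : M.obj.V) : x = 0 := by
  obtain ⟨f, hf⟩ := exists_rep (N := suspObj M) e.hom
  obtain ⟨g, hg⟩ := exists_rep (M := suspObj M) e.inv
  have hfg : (toStable (weaklyProjective R _)).map (f ≫ g) = (toStable _).map (𝟙 M) := by
    rw [Functor.map_comp, hf, hg, CategoryTheory.Functor.map_id]
    exact e.hom_inv_id
  obtain ⟨θ, hθ⟩ := stable_map_eq_iff.1 hfg
  obtain ⟨a, ha⟩ := suspProj_surjective M (lin f x)
  change Multiplicative (ZMod 3) → M.obj.V at a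
  have hgf : lin g (lin f x) = x := by
    have h1 := LinearMap.congr_fun hθ x
    rw [tr_apply] at h1
    simp only [hM, Finset.sum_const, Finset.card_univ] at h1
    change lin g (lin f x) - x = (3 : ℕ) • θ x at h1
    rw [h3] at h1
    exact sub_eq_zero.1 h1
  -- the difference of `a` and its translate by a generator is constant
  obtain ⟨c, hc⟩ : ∃ c, ∀ y, a (Multiplicative.ofAdd 1 * y) - a y = c := by
    have h1 : lin (suspProj M) ((ind R _ M.obj.V).obj.ρ (Multiplicative.ofAdd (1 : ZMod 3))⁻¹ a - a)
        = 0 := by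
      rw [map_sub, lin_equivariant, ha, ← lin_equivariant, hM, sub_self]
    obtain ⟨c, hc⟩ := ((isSplitSES_unit M).1.2.1 _).1 h1
    refine ⟨c, fun y => ?_⟩
    have h2 := congrFun hc y
    rw [unit_apply, hM] at h2
    rw [h2]
    change _ = a ((Multiplicative.ofAdd (1 : ZMod 3))⁻¹⁻¹ * y) - a y
    rw [inv_inv]
  have hsum : ∑ y, a y = 0 := by
    let b : Fin 3 → M.obj.V := a
    have h0 : b 1 - b 0 = c := hc (Multiplicative.ofAdd 0)
    have h1 : b 2 - b 1 = c := hc (Multiplicative.ofAdd 1)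
    change ∑ y : Fin 3, b y = 0
    rw [Fin.sum_univ_three]
    have : b 0 + b 1 + b 2 = 3 • (b 0 + c) := by
      rw [← h1, sub_eq_iff_eq_add.1 h0, sub_eq_iff_eq_add.1 (h1.trans h0.symm),
        sub_eq_iff_eq_add.1 h0]
      abel
    rw [this, h3]
  obtain ⟨η, hη⟩ := exists_tr_of_ind (suspProj M ≫ g)
  rw [← hgf, ← ha]
  have h1 := LinearMap.congr_fun hη a
  rw [tr_apply] at h1
  simp only [hM] at h1
  rw [← map_sum] at h1
  refine h1.trans ?_
  convert map_zero η
  funext y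
  rw [Finset.sum_apply]
  refine Eq.trans ?_ hsum
  exact Fintype.sum_equiv (Equiv.mulRight y) _ _ fun h => by
    rw [ind_rho, inv_inv]
    rfl

end CyclicGroup

/-- The equivalence is not monoidal for the group of order three over the `3`-adic integers, where
`Ω (W ⊗ W) ≅ ΩΣW ≅ Σk` and `ΩW ⊗ ΩW ≅ k ⊗ k ≅ k`. -/
theorem exists_not_monoidal (n : ℕ) (hn : 1 ≤ n) :
    ∃ (S : Type) (_ : CommRing S) (_ : IsDomain S) (_ : IsDiscreteValuationRing S)
      (t : S) (_ : Irreducible t) (G : Type) (_ : Group G) (_ : Fintype G)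
      (X Y : StRel (Rn S t n) G),
      thickIdeal (W t n G) X ∧ thickIdeal (W t n G) Y ∧
      ¬ Nonempty ((syzygy (Rn S t n) G).obj (tensorObj X Y) ≅
        tensorObj ((syzygy (Rn S t n) G).obj X) ((syzygy (Rn S t n) G).obj Y)) := by
  have : Fact (Nat.Prime 3) := ⟨Nat.prime_three⟩
  have ht : Irreducible (3 : ℤ_[3]) := PadicInt.irreducible_p
  refine ⟨ℤ_[3], inferInstance, inferInstance, inferInstance, 3, ht, Multiplicative (ZMod 3),
    inferInstance, inferInstance, W _ n _, W _ n _, fun Q _ h => h, fun Q _ h => h, ?_⟩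
  rintro ⟨e⟩
  obtain ⟨e₁⟩ := nonempty_iso_syzygy_W ht hn (G := Multiplicative (ZMod 3))
  obtain ⟨e₂⟩ := nonempty_iso_tens_W (X := WRep (3 : ℤ_[3]) n (Multiplicative (ZMod 3)))
    (K_W ht hn)
  let k := resRep (3 : ℤ_[3]) ht n hn (Multiplicative (ZMod 3))
  obtain ⟨e₃⟩ := nonempty_iso_tens_left (syzObj (WRep (3 : ℤ_[3]) n (Multiplicative (ZMod 3)))) e₁
  obtain ⟨e₄⟩ := nonempty_iso_tens_right k e₁
  obtain ⟨e₅⟩ := nonempty_iso_tens_along (toResidue ℤ_[3] ht.not_isUnit hn)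
    (toResidue_surjective _ _ _) (trivialRep _ (Multiplicative (ZMod 3)))
  have e₆ := (syzygy (Rn ℤ_[3] 3 n) (Multiplicative (ZMod 3))).mapIso e₂ ≪≫
    suspIso syzygyComm e₁
  have e₇ : (toStable (weaklyProjective (Rn ℤ_[3] 3 n) (Multiplicative (ZMod 3)))).obj k ≅
      (susp _).obj ((toStable _).obj k) :=
    ((toStable _).mapIso e₅).symm ≪≫ e₄.symm ≪≫ e₃.symm ≪≫ e.symm ≪≫ e₆
  have h3 : ∀ x : k.obj.V, (3 : ℕ) • x = 0 := fun x => by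
    rw [← Nat.cast_smul_eq_nsmul (Rn ℤ_[3] 3 n)]
    exact alongObj_smul_eq_zero ht hn (M := trivialRep _ (Multiplicative (ZMod 3))) x
  exact one_ne_zero (α := IsLocalRing.ResidueField ℤ_[3])
    (eq_zero_of_iso_susp (M := k) (fun _ _ => rfl) h3 e₇ (1 : IsLocalRing.ResidueField ℤ_[3]))

end

end RelStab

open RelStab

theorem theorem4p4 :
    (∀ (S : Type u) [CommRing S] [IsDomain S] [IsDiscreteValuationRing S]
      (t : S) (ht : Irreducible t) (n : ℕ) (hn : 1 ≤ n)
      (G : Type u) [Group G] [Fintype G],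
      -- `Ω_n` induces an equivalence of triangulated categories between the thick tensor ideals
      (∃ E : TriEquiv (thickTri (W t n G)) (thickTri (kObj ht.not_isUnit hn G)),
        Nonempty (E.equiv.functor ⋙ (thickIdeal (kObj ht.not_isUnit hn G)).ι ≅
          (thickIdeal (W t n G)).ι ⋙ syzygy (Rn S t n) G)) ∧
      -- the thick tensor ideal of `k` is `stmod kG`
      (∃ E : TriEquiv (stTri (IsLocalRing.ResidueField S) G)
          (thickTri (kObj ht.not_isUnit hn G)),
        Nonempty (E.equiv.functor ⋙ (thickIdeal (kObj ht.not_isUnit hn G)).ι ≅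
          inflateResidue ht.not_isUnit hn G)) ∧
      thickIdeal (kObj ht.not_isUnit hn G) = (inflateResidue ht.not_isUnit hn G).essImage ∧
      -- the thick tensor ideal of `W_n` is `K_n`, and `Ω_n K_n = D_1`
      thickIdeal (W t n G) = K t n G ∧
      (∀ Y : StRel (Rn S t n) G,
        (∃ X, K t n G X ∧ Nonempty ((syzygy (Rn S t n) G).obj X ≅ Y)) ↔
          (inflateResidue ht.not_isUnit hn G).essImage Y)) ∧
    -- the equivalence is not monoidal in general
    (∀ n : ℕ, 1 ≤ n →
      ∃ (S : Type) (_ : CommRing S) (_ : IsDomain S) (_ : IsDiscreteValuationRing S)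
        (t : S) (_ : Irreducible t) (G : Type) (_ : Group G) (_ : Fintype G)
        (X Y : StRel (Rn S t n) G),
        thickIdeal (W t n G) X ∧ thickIdeal (W t n G) Y ∧
        ¬ Nonempty ((syzygy (Rn S t n) G).obj (tensorObj X Y) ≅
          tensorObj ((syzygy (Rn S t n) G).obj X) ((syzygy (Rn S t n) G).obj Y))) :=
  ⟨fun _ _ _ _ _ ht _ hn _ _ _ => ⟨exists_triEquiv_syzygy ht hn, exists_triEquiv_inflate ht hn,
    thickIdeal_k_eq ht hn, thickIdeal_W_eq ht hn, syzygy_K_iff ht hn⟩, exists_not_monoidal⟩
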